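/- Let $n\ge 1$, let $m=(m_1,\dots,m_n)$ be positive integers, and let $\mathcal E_m=\{z\in\mathbb C^n:\sum_{j=1}^n|z_j|^{2m_j}<1\}$. Let $\mu$ be the Bonami–Lohoué surface measure on $\partial\mathcal E_m$, i.e. the measure for which Lebesgue measure on $\mathbb C^n$ is $dV(z)=\rho^{2\sum_j 1/m_j-1}\,d\rho\,d\mu(w)$ in the polar coordinates $z=(\rho^{1/m_1}w_1,\dots,\rho^{1/m_n}w_n)$, $\rho>0$, $w\in\partial\mathcal E_m$. Let $H^2_\mu(\mathcal E_m)$ be the space of holomorphic functions on $\mathcal E_m$ having $L^2(\mu)$ boundary values (as the $L^2(\mu)$-limits of $w\mapsto f(\rho w)$, $\rho\to1^-$), with the inner product of $L^2(\mu)$, and let $K^S(z)=\sum_j|\tilde\phi_j(z)|^2$ ($z\in\mathcal E_m$), where $\{\tilde\phi_j\}$ is a complete orthonormal basis of $H^2_\mu(\mathcal E_m)$, be its Szegő kernel on the diagonal; the series converges and its sum does not depend on the basis. Let $z^0\in\partial\mathcal E_m$ and put $P=\{j: z^0_j=0,\ m_j\ne1\}$, $Q=\{1,\dots,n\}\setminus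 P$, $|\tfrac1m|_P=\sum_{j\in P}\tfrac1{m_j}$, $r(z)=1-\sum_{j=1}^n|z_j|^{2m_j}$, and let $t(z)=(t_j(z))_{j\in P}$, $t_j(z)\ge0$, be given by $t_j(z)^{2m_j}=|z_j|^{2m_j}/(1-\sum_{i\in Q}|z_i|^{2m_i})$. Let $\Delta=\{t\in\mathbb R^P: t_j\ge0,\ \sum_{j\in P}t_j^{2m_j}<1\}$. Then there is a function $\Phi^S$, real analytic on a neighborhood of $\Delta$ in $\mathbb R^P$, and a function $h$, real analytic in a neighborhood of $z^0$ in $\mathbb C^n$, such that for all $z\in\mathcal E_m$ close to $z^0$ $$K^S(z)=\frac{(n-1)!}{2\pi^n}\ \prod_{j\in Q}m_j^2|z_j|^{2m_j-2}\ \frac{\Phi^S(t(z))}{r(z)^{|Q|+|\frac1m|_P}}+h(z).$$ Moreover: (i) if $P=\emptyset$ (that is, $z^0$ is a strongly pseudoconvex point), then $\Phi^S=1$ identically; (ii) if $P\ne\emptyset$ (that is, $z^0$ is a weakly pseudoconvex point), then $\Phi^S$ is positive on $\Delta$, and it is unbounded as $t\in\Delta$ approaches $\overline\Delta\setminus\Delta$: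 $\Phi^S(t)\to+\infty$ as $t\in\Delta$ tends to any point of $\overline\Delta\setminus\Delta$. -/

import Mathlib

open MeasureTheory Filter Topology
open scoped ENNReal

namespace ComplexEllipsoid

/-- The function `ψ(z) = ∑ⱼ |zⱼ|^(2 mⱼ)` on `ℂⁿ`. -/
noncomputable def psi {n : ℕ} (m : Fin n → ℕ) (z : Fin n → ℂ) : ℝ :=
  ∑ j, ‖z j‖ ^ (2 * m j)

/-- The complex ellipsoid `{z ∈ ℂⁿ ; ∑ⱼ |zⱼ|^(2 mⱼ) < 1}`. -/
def domain {n : ℕ} (m : Fin n → ℕ) : Set (Fin n → ℂ) :=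
  {z | psi m z < 1}

/-- The (anisotropic) radial projection of `ℂⁿ \ {0}` onto the boundary of the ellipsoid:
with the dilations `δ_ρ z = (ρ^(1/mⱼ) zⱼ)ⱼ`, for which `ψ (δ_ρ z) = ρ² ψ(z)`, it is
`z ↦ δ_ρ z` for `ρ = ψ(z)^(-1/2)`. -/
noncomputable def radialProj {n : ℕ} (m : Fin n → ℕ) (z : Fin n → ℂ) : Fin n → ℂ :=
  fun j => (psi m z ^ (-(1 / (2 * (m j : ℝ)))) : ℝ) • z j

/-- The Bonami–Lohoué surface measure `μ` on the boundary of the ellipsoid, viewed as a measure on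
`ℂⁿ` carried by that boundary. It is the measure of the polar coordinates `z = δ_ρ w`
(`ρ > 0`, `w` in the boundary), i.e. `dV(z) = ρ^(2 ∑ⱼ 1/mⱼ - 1) dρ dμ(w)` with `dV` the Lebesgue
measure of `ℂⁿ`; so `μ(A)` is `2 ∑ⱼ 1/mⱼ` times the volume of the cone
`{δ_ρ w ; w ∈ A, 0 < ρ < 1}`. (Equivalently `dμ = 2 dS / |∇ψ|` with `dS` the Euclidean surface
element; it is `dS` itself for the unit ball.) -/
noncomputable def surfaceMeasure {n : ℕ} (m : Fin n → ℕ) : Measure (Fin n → ℂ) :=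
  ENNReal.ofReal (2 * ∑ j, 1 / (m j : ℝ)) •
    Measure.map (radialProj m) (volume.restrict (domain m))

/-- `f` belongs to the Hardy space `H²` of the ellipsoid with respect to the surface measure, with
boundary value `g`: `f` is holomorphic in the ellipsoid, `g` is in `L²` of the boundary, and the
dilates `w ↦ f (ρ w)` converge to `g` in `L²` of the boundary as `ρ → 1⁻`.
Only the values of `f` inside the ellipsoid matter. -/
structure HasBoundaryValue {n : ℕ} (m : Fin n → ℕ) (f : (Fin n → ℂ) → ℂ)
    (g : Lp ℂ 2 (surfaceMeasure m)) : Prop where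
  holomorphic : DifferentiableOn ℂ f (domain m)
  tendsto : Tendsto (fun ρ : ℝ => eLpNorm (fun w => f (ρ • w) - g w) 2 (surfaceMeasure m))
    (𝓝[<] 1) (𝓝 0)

/-- `φ` is a complete orthonormal basis of the Hardy space `H²`, whose inner product is that of the
boundary values in `L²`. -/
def IsHardyBasis {n : ℕ} (m : Fin n → ℕ) {ι : Type} (φ : ι → (Fin n → ℂ) → ℂ) : Prop :=
  ∃ b : ι → Lp ℂ 2 (surfaceMeasure m),
    (∀ i, HasBoundaryValue m (φ i) (b i)) ∧
    Orthonormal ℂ b ∧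
    ∀ (f : (Fin n → ℂ) → ℂ) (g : Lp ℂ 2 (surfaceMeasure m)), HasBoundaryValue m f g →
      (∀ i, inner ℂ (b i) g = 0) → g = 0

/-- `K` is the Szegő kernel (on the diagonal) of the ellipsoid: complete orthonormal bases of `H²`
exist, and `K(z) = ∑ᵢ |φᵢ(z)|²` in the ellipsoid, with a convergent series, for each of them.
This determines `K` in the ellipsoid. -/
def IsSzegoKernel {n : ℕ} (m : Fin n → ℕ) (K : (Fin n → ℂ) → ℝ) : Prop :=
  (∃ (ι : Type) (φ : ι → (Fin n → ℂ) → ℂ), IsHardyBasis m φ) ∧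
  ∀ (ι : Type) (φ : ι → (Fin n → ℂ) → ℂ), IsHardyBasis m φ →
    ∀ z ∈ domain m, HasSum (fun i => ‖φ i z‖ ^ 2) (K z)

/-- The set `P` of indices with `z⁰ⱼ = 0` and `mⱼ ≠ 1`. -/
noncomputable def setP {n : ℕ} (m : Fin n → ℕ) (z0 : Fin n → ℂ) : Finset (Fin n) :=
  Finset.univ.filter fun j => z0 j = 0 ∧ m j ≠ 1

/-- The set `Q` of indices with `z⁰ⱼ ≠ 0` or `mⱼ = 1`. -/
noncomputable def setQ {n : ℕ} (m : Fin n → ℕ) (z0 : Fin n → ℂ) : Finset (Fin n) :=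
  Finset.univ.filter fun j => z0 j ≠ 0 ∨ m j = 1

/-- The angular variables `tⱼ(z) ≥ 0`, `j ∈ P`, given by
`tⱼ(z)^(2 mⱼ) = |zⱼ|^(2 mⱼ) / (1 - ∑_{i ∈ Q} |zᵢ|^(2 mᵢ))`. -/
noncomputable def angular {n : ℕ} (m : Fin n → ℕ) (z0 z : Fin n → ℂ) : setP m z0 → ℝ :=
  fun j => (‖z j‖ ^ (2 * m j) / (1 - ∑ i ∈ setQ m z0, ‖z i‖ ^ (2 * m i))) ^
    (1 / (2 * (m j : ℝ)))

/-- The radial variable `r(z) = 1 - ∑ⱼ |zⱼ|^(2 mⱼ)`. -/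
noncomputable def radial {n : ℕ} (m : Fin n → ℕ) (z : Fin n → ℂ) : ℝ :=
  1 - psi m z

/-- The locally closed simplex `Δ = {t ∈ ℝ^P ; tⱼ ≥ 0, ∑_{j ∈ P} tⱼ^(2 mⱼ) < 1}`. -/
def simplex {n : ℕ} (m : Fin n → ℕ) (z0 : Fin n → ℂ) : Set (setP m z0 → ℝ) :=
  {t | (∀ j, 0 ≤ t j) ∧ ∑ j, t j ^ (2 * m j) < 1}

/-- The exponent `|Q| + ∑_{j ∈ P} 1/mⱼ`. -/
noncomputable def exponent {n : ℕ} (m : Fin n → ℕ) (z0 : Fin n → ℂ) : ℝ :=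
  ((setQ m z0).card : ℝ) + ∑ j ∈ setP m z0, 1 / (m j : ℝ)

/-- The singular term `(n-1)!/(2πⁿ) ∏_{j ∈ Q} mⱼ² |zⱼ|^(2 mⱼ - 2) Φ(t(z)) / r(z)^(|Q| + |1/m|_P)`. -/
noncomputable def singularTerm {n : ℕ} (m : Fin n → ℕ) (z0 : Fin n → ℂ)
    (Φ : (setP m z0 → ℝ) → ℝ) (z : Fin n → ℂ) : ℝ :=
  ((n - 1).factorial : ℝ) / (2 * Real.pi ^ n) *
    (∏ j ∈ setQ m z0, (m j : ℝ) ^ 2 * ‖z j‖ ^ (2 * m j - 2)) *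
    (Φ (angular m z0 z) / radial m z ^ exponent m z0)

end ComplexEllipsoid

/-! The measure is invariant under rotations of each coordinate, so distinct monomials are
orthogonal. A layer-cake computation, comparing integrals over the ellipsoid with those of `exp
(-psi m z)`, gives the squared norm of `z ^ α` as `2 ∏ (π / m_j) Γ((α_j+1)/m_j) / Γ(∑ (α_j+1)/m_j)`.
Writing the Gamma function of the sum as an integral over `τ > 0` uncouples the indices: up to a
constant, the kernel is the Laplace integral of `∏ E_j(|z_j|² τ^(1/m_j))` against `e^(-τ) τ^(∑ 1/m_j
- 1)`, where `E_j(u) = ∑ u^k / Γ((k+1)/m_j)` (`hasSum_nmono_sq`).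

This sum is the Szegő kernel for every basis because the boundary values form exactly the closed
span of the monomials (`HasBoundaryValue.mem_and_eq`, `hasBoundaryValue_inner_evalVec`), on which
evaluation at a point is represented by a vector whose squared norm is the sum.

The singularity comes from the growth of the factors. One has `E_j(u) = m_j u^(m_j-1) e^(u^(m_j)) +
R_j(u)` (`mittag_eq`), where for `x > 0` the remainder `R_j(x τ^(1/m_j))` is beaten by every
`e^(-bτ)`, `b > 0`, and where `R_j = 0` if `m_j = 1`. Factors with `j ∈ P` are kept whole, the
others are split and the product is expanded. A term containing some `R_j` either vanishes or has
`z0_j ≠ 0`; then its exponential rate at `z0` loses the positive amount `|z0_j|^(2 m_j)` from a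
total of `1`, so the integral still converges near `z0` and is analytic across the boundary
(`analyticAt_mixedKernel`).

In the only other term the factors with `j ∈ Q` turn `e^(-τ)` into `e^(-Aτ)`, `A = 1 - ∑_Q |z_i|^(2
m_i)`. Rescaling by `A` leaves a power of `A` times a function of the angular variables
(`mixedKernel_univ`), and `r = A (1 - ∑ t_j^(2 m_j))` turns this into the singular term
(`singularTerm_eq`).

For empty `P` the angular integral is `Γ(n)`, so that `Φ = 1`. Otherwise, at a missing boundary
point of the simplex some `t_i` is positive and `m_i ≥ 2`; the main part of the factor `i` carries
an additional `σ^(1 - 1/m_i)`, which makes the angular integral exceed the normalizing power of `1 -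
∑ t_j^(2 m_j)` (`tendsto_simplexFun`).

Analyticity under the integral sign is obtained throughout from analytic maps into a space of
bounded continuous functions. -/

namespace ComplexEllipsoid

/-! ### Families of functions depending analytically on a parameter in the supremum norm -/

section UniformlyAnalytic

open scoped BoundedContinuousFunction

variable {𝕜 : Type*} [RCLike 𝕜] {S : Type*} [TopologicalSpace S]
  {V : Type*} [NormedAddCommGroup V] [NormedSpace 𝕜 V]
  {V' : Type*} [NormedAddCommGroup V'] [NormedSpace 𝕜 V']

/-- A family `G v` of functions on `S`, bounded and continuous for `v` near `v0`, which depends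
analytically on `v` for the supremum norm. -/
def UniformlyAnalyticAt (𝕜 : Type*) [RCLike 𝕜] {S : Type*} [TopologicalSpace S]
    {V : Type*} [NormedAddCommGroup V] [NormedSpace 𝕜 V] (G : V → S → 𝕜) (v0 : V) : Prop :=
  ∃ Γ : V → S →ᵇ 𝕜, AnalyticAt 𝕜 Γ v0 ∧ ∀ᶠ v in 𝓝 v0, ∀ s, Γ v s = G v s

namespace UniformlyAnalyticAt

theorem congr {G H : V → S → 𝕜} {v0 : V} (hG : UniformlyAnalyticAt 𝕜 G v0)
    (h : ∀ᶠ v in 𝓝 v0, ∀ s, G v s = H v s) : UniformlyAnalyticAt 𝕜 H v0 := by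
  obtain ⟨Γ, hΓ, hG⟩ := hG
  refine ⟨Γ, hΓ, ?_⟩
  filter_upwards [hG, h] with v h1 h2 s
  rw [h1, h2]

theorem comp_analyticAt {G : V → S → 𝕜} {φ : V' → V} {v0 : V'}
    (hG : UniformlyAnalyticAt 𝕜 G (φ v0)) (hφ : AnalyticAt 𝕜 φ v0) :
    UniformlyAnalyticAt 𝕜 (fun v => G (φ v)) v0 := by
  obtain ⟨Γ, hΓ, hG⟩ := hG
  exact ⟨Γ ∘ φ, hΓ.comp hφ, hφ.continuousAt.eventually hG⟩

theorem const {g : S → 𝕜} (hg : Continuous g) {M : ℝ} (hM : ∀ s, ‖g s‖ ≤ M) (v0 : V) :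
    UniformlyAnalyticAt 𝕜 (fun _ => g) v0 :=
  ⟨fun _ => BoundedContinuousFunction.ofNormedAddCommGroup g hg M hM, analyticAt_const,
    Eventually.of_forall fun _ _ => rfl⟩

theorem of_analyticAt {g : V → 𝕜} {v0 : V} (hg : AnalyticAt 𝕜 g v0) :
    UniformlyAnalyticAt 𝕜 (fun v (_ : S) => g v) v0 := by
  refine ⟨fun v => g v • (1 : S →ᵇ 𝕜), hg.smul analyticAt_const, Eventually.of_forall ?_⟩
  intro v s
  simp

theorem mul {G H : V → S → 𝕜} {v0 : V} (hG : UniformlyAnalyticAt 𝕜 G v0)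
    (hH : UniformlyAnalyticAt 𝕜 H v0) : UniformlyAnalyticAt 𝕜 (fun v s => G v s * H v s) v0 := by
  obtain ⟨Γ, hΓ, hG⟩ := hG
  obtain ⟨Γ', hΓ', hH⟩ := hH
  refine ⟨fun v => Γ v * Γ' v, hΓ.mul hΓ', ?_⟩
  filter_upwards [hG, hH] with v h1 h2 s
  simp [h1, h2]

theorem add {G H : V → S → 𝕜} {v0 : V} (hG : UniformlyAnalyticAt 𝕜 G v0)
    (hH : UniformlyAnalyticAt 𝕜 H v0) : UniformlyAnalyticAt 𝕜 (fun v s => G v s + H v s) v0 := by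
  obtain ⟨Γ, hΓ, hG⟩ := hG
  obtain ⟨Γ', hΓ', hH⟩ := hH
  refine ⟨fun v => Γ v + Γ' v, hΓ.add hΓ', ?_⟩
  filter_upwards [hG, hH] with v h1 h2 s
  simp [h1, h2]

theorem sum {ι : Type*} (t : Finset ι) {G : ι → V → S → 𝕜} {v0 : V}
    (hG : ∀ i ∈ t, UniformlyAnalyticAt 𝕜 (G i) v0) :
    UniformlyAnalyticAt 𝕜 (fun v s => ∑ i ∈ t, G i v s) v0 := by
  classical
  induction t using Finset.induction_on with
  | empty =>
    simpa using of_analyticAt (S := S) (analyticAt_const (𝕜 := 𝕜) (x := v0) (v := (0 : 𝕜)))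
  | insert i t hi ih =>
    simp only [Finset.sum_insert hi]
    exact (hG i (by simp)).add (ih fun j hj => hG j (by simp [hj]))

theorem prod {ι : Type*} (t : Finset ι) {G : ι → V → S → 𝕜} {v0 : V}
    (hG : ∀ i ∈ t, UniformlyAnalyticAt 𝕜 (G i) v0) :
    UniformlyAnalyticAt 𝕜 (fun v s => ∏ i ∈ t, G i v s) v0 := by
  classical
  induction t using Finset.induction_on with
  | empty =>
    simpa using of_analyticAt (S := S) (analyticAt_const (𝕜 := 𝕜) (x := v0) (v := (1 : 𝕜)))
  | insert i t hi ih =>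
    simp only [Finset.prod_insert hi]
    exact (hG i (by simp)).mul (ih fun j hj => hG j (by simp [hj]))

/-- A power series with coefficients in the bounded continuous functions, bounded on a polydisc
uniformly on `S`. -/
theorem of_hasSum {c : ℕ → S → 𝕜} (hc : ∀ k, Continuous (c k)) {R M : ℝ} (hR : 0 < R)
    (hM : ∀ s (t : Finset ℕ), ∑ k ∈ t, ‖c k s‖ * R ^ k ≤ M) {G : 𝕜 → S → 𝕜} {x0 : 𝕜}
    (hG : ∀ x, ‖x - x0‖ < R → ∀ s, HasSum (fun k => c k s * (x - x0) ^ k) (G x s))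
    {x1 : 𝕜} (hx1 : ‖x1 - x0‖ < R) : UniformlyAnalyticAt 𝕜 G x1 := by
  rcases isEmpty_or_nonempty S with hS | hS
  · exact ⟨0, analyticAt_const, Eventually.of_forall fun v s => hS.elim s⟩
  have hM0 : 0 ≤ M := by simpa using hM (Classical.arbitrary S) ∅
  have hb : ∀ k s, ‖c k s‖ ≤ M / R ^ k := fun k s => by
    rw [le_div_iff₀ (by positivity)]
    simpa using hM s {k}
  let C : ℕ → S →ᵇ 𝕜 := fun k =>
    BoundedContinuousFunction.ofNormedAddCommGroup (c k) (hc k) _ (hb k)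
  have hC : ∀ k, ‖C k‖ ≤ M / R ^ k := fun k =>
    BoundedContinuousFunction.norm_ofNormedAddCommGroup_le _ (by positivity) _
  let p : FormalMultilinearSeries 𝕜 𝕜 (S →ᵇ 𝕜) := fun k =>
    ContinuousMultilinearMap.mkPiRing 𝕜 (Fin k) (C k)
  have hrad : ENNReal.ofReal R ≤ p.radius := by
    rw [ENNReal.ofReal, Real.toNNReal_of_nonneg hR.le]
    refine p.le_radius_of_bound M fun k => ?_
    have := hC k
    rw [le_div_iff₀ (by positivity)] at this
    simpa [p, ContinuousMultilinearMap.norm_mkPiRing] using this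
  have hp := (p.hasFPowerSeriesOnBall (lt_of_lt_of_le (by simpa using hR) hrad))
  have hball : ∀ x, ‖x - x0‖ < R → x - x0 ∈ Metric.eball (0 : 𝕜) p.radius := by
    intro x hx
    apply Metric.eball_subset_eball hrad
    rw [Metric.mem_eball, edist_zero_right, ← ofReal_norm]
    exact (ENNReal.ofReal_lt_ofReal_iff hR).2 hx
  refine ⟨fun x => p.sum (x - x0), ?_, ?_⟩
  · have h1 : AnalyticAt 𝕜 p.sum (x1 - x0) := hp.analyticAt_of_mem (hball _ hx1)
    exact h1.comp (f := fun x => x - x0) (analyticAt_id.sub analyticAt_const)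
  · have : ∀ᶠ x in 𝓝 x1, ‖x - x0‖ < R :=
      ContinuousAt.eventually_lt (by fun_prop) continuousAt_const hx1
    filter_upwards [this] with x hx s
    have hs := p.hasSum (hball x hx)
    have hs2 := hs.mapL (BoundedContinuousFunction.evalCLM 𝕜 s)
    refine hs2.unique ?_
    convert hG x hx s using 2 with k
    simp [p, C, mul_comm]

/-- Integration against a fixed integrable weight is a continuous linear functional on bounded
continuous functions, and composing an analytic map with it keeps analyticity. No derivative has to
be dominated. -/
theorem analyticAt_integral [MeasurableSpace S] [OpensMeasurableSpace S]
    [SecondCountableTopologyEither S 𝕜]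
    {ν : Measure S} {w : S → 𝕜} (hw : Integrable w ν) {G : V → S → 𝕜} {v0 : V}
    (hG : UniformlyAnalyticAt 𝕜 G v0) :
    AnalyticAt 𝕜 (fun v => ∫ s, G v s * w s ∂ν) v0 := by
  obtain ⟨Γ, hΓ, hG⟩ := hG
  have hint : ∀ F : S →ᵇ 𝕜, Integrable (fun s => F s * w s) ν := fun F =>
    hw.bdd_mul (c := ‖F‖) F.continuous.aestronglyMeasurable
      (Eventually.of_forall F.norm_coe_le_norm)
  let L : (S →ᵇ 𝕜) →ₗ[𝕜] 𝕜 :=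
    { toFun := fun F => ∫ s, F s * w s ∂ν
      map_add' := fun F F' => by
        rw [← integral_add (hint F) (hint F')]
        simp [add_mul]
      map_smul' := fun a F => by
        simp [mul_assoc, integral_const_mul] }
  let L' := L.mkContinuous (∫ s, ‖w s‖ ∂ν) fun F => by
    refine (norm_integral_le_integral_norm _).trans ?_
    rw [mul_comm, ← integral_const_mul]
    refine integral_mono (hint F).norm (hw.norm.const_mul _) fun s => ?_
    simp only [norm_mul]
    gcongr
    exact F.norm_coe_le_norm s
  refine ((L'.analyticAt (Γ v0)).comp hΓ).congr ?_
  filter_upwards [hG] with v hv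
  simp [L', L, hv]

theorem integrable [MeasurableSpace S] [OpensMeasurableSpace S]
    [SecondCountableTopologyEither S 𝕜]
    {ν : Measure S} {w : S → 𝕜} (hw : Integrable w ν) {G : V → S → 𝕜} {v0 : V}
    (hG : UniformlyAnalyticAt 𝕜 G v0) : Integrable (fun s => G v0 s * w s) ν := by
  obtain ⟨Γ, hΓ, hG⟩ := hG
  have := hw.bdd_mul (c := ‖Γ v0‖) (Γ v0).continuous.aestronglyMeasurable
      (Eventually.of_forall (Γ v0).norm_coe_le_norm)
  simpa only [hG.self_of_nhds] using this

/-- Integration against a dominated kernel preserves uniform analyticity. -/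
theorem integral_kernel {T : Type*} [TopologicalSpace T] [FirstCountableTopology T]
    [MeasurableSpace S] [OpensMeasurableSpace S] [SecondCountableTopologyEither S 𝕜]
    {ν : Measure S} {k : T → S → 𝕜} {w : S → ℝ} (hw : Integrable w ν)
    (hkm : ∀ t, AEStronglyMeasurable (k t) ν) (hk : ∀ t, ∀ᵐ s ∂ν, ‖k t s‖ ≤ w s)
    (hkc : ∀ᵐ s ∂ν, Continuous fun t => k t s) {G : V → S → 𝕜} {v0 : V}
    (hG : UniformlyAnalyticAt 𝕜 G v0) :
    UniformlyAnalyticAt 𝕜 (fun v t => ∫ s, G v s * k t s ∂ν) v0 := by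
  obtain ⟨Γ, hΓ, hG⟩ := hG
  have hk' : ∀ t, Integrable (k t) ν := fun t => hw.mono' (hkm t) (hk t)
  have hint : ∀ (F : S →ᵇ 𝕜) t, Integrable (fun s => F s * k t s) ν := fun F t =>
    (hk' t).bdd_mul (c := ‖F‖) F.continuous.aestronglyMeasurable
      (Eventually.of_forall F.norm_coe_le_norm)
  have hbound : ∀ (F : S →ᵇ 𝕜) t, ∀ᵐ s ∂ν, ‖F s * k t s‖ ≤ ‖F‖ * w s := fun F t => by
    filter_upwards [hk t] with s hs
    rw [norm_mul]
    gcongr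
    exact F.norm_coe_le_norm s
  have hle : ∀ (F : S →ᵇ 𝕜) t, ‖∫ s, F s * k t s ∂ν‖ ≤ (∫ s, w s ∂ν) * ‖F‖ := fun F t => by
    rw [mul_comm, ← integral_const_mul]
    exact norm_integral_le_of_norm_le (hw.const_mul _) (hbound F t)
  have hcont : ∀ F : S →ᵇ 𝕜, Continuous fun t => ∫ s, F s * k t s ∂ν := fun F => by
    refine continuous_of_dominated (fun t => (hint F t).1) (hbound F) (hw.const_mul _) ?_
    filter_upwards [hkc] with s hs
    exact continuous_const.mul hs
  rcases isEmpty_or_nonempty T with hT | hT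
  · exact ⟨0, analyticAt_const, Eventually.of_forall fun v t => hT.elim t⟩
  have hw0 : 0 ≤ ∫ s, w s ∂ν := by
    refine integral_nonneg_of_ae ?_
    filter_upwards [hk (Classical.arbitrary T)] with s hs
    exact (norm_nonneg _).trans hs
  let L : (S →ᵇ 𝕜) →ₗ[𝕜] (T →ᵇ 𝕜) :=
    { toFun := fun F => BoundedContinuousFunction.ofNormedAddCommGroup
        (fun t => ∫ s, F s * k t s ∂ν) (hcont F) _ (hle F)
      map_add' := fun F F' => by
        ext t
        simp [add_mul, integral_add (hint F t) (hint F' t)]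
      map_smul' := fun a F => by
        ext t
        simp [mul_assoc, integral_const_mul] }
  let L' := L.mkContinuous (∫ s, w s ∂ν) fun F =>
    BoundedContinuousFunction.norm_ofNormedAddCommGroup_le _ (by positivity) (hle F)
  refine ⟨fun v => L' (Γ v), (L'.analyticAt (Γ v0)).comp hΓ, ?_⟩
  filter_upwards [hG] with v hv t
  simp [L', L, hv]

end UniformlyAnalyticAt

end UniformlyAnalytic

end ComplexEllipsoid

namespace ComplexEllipsoid

/-! ### Cauchy's formula on polydiscs and Osgood's lemma -/

section Osgood

/-- The Cauchy integral formula on a polydisc. -/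
theorem torusIntegral_prod_sub_inv_mul {n : ℕ} {f : (Fin n → ℂ) → ℂ} {c : Fin n → ℂ}
    {R : Fin n → ℝ} (hR : ∀ i, 0 < R i)
    (hc : ContinuousOn f (Set.univ.pi fun i => Metric.closedBall (c i) (R i)))
    (hd : ∀ z ∈ Set.univ.pi fun i => Metric.closedBall (c i) (R i), ∀ i,
      DifferentiableAt ℂ (fun x => f (Function.update z i x)) (z i))
    {z : Fin n → ℂ} (hz : z ∈ Set.univ.pi fun i => Metric.ball (c i) (R i)) :
    torusIntegral (fun ζ => (∏ i, (ζ i - z i)⁻¹) * f ζ) c R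
      = (2 * Real.pi * Complex.I) ^ n * f z := by
  induction n with
  | zero => simp [Subsingleton.elim c z]
  | succ n ih =>
    have hmem : ∀ θ, torusMap c R θ ∈ Set.univ.pi fun i => Metric.closedBall (c i) (R i) := by
      intro θ i _
      simp [torusMap, abs_of_pos (hR i)]
    have hne : ∀ θ i, torusMap c R θ i - z i ≠ 0 := by
      intro θ i h
      have h1 : ‖torusMap c R θ i - c i‖ = R i := by simp [torusMap, abs_of_pos (hR i)]
      have h2 := hz i trivial
      rw [mem_ball_iff_norm, ← sub_eq_zero.1 h, h1] at h2
      exact lt_irrefl _ h2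
    have hint : TorusIntegrable (fun ζ => (∏ i, (ζ i - z i)⁻¹) * f ζ) c R := by
      refine ContinuousOn.integrableOn_compact isCompact_Icc (Continuous.continuousOn ?_)
      have ht : Continuous (torusMap c R) := by
        unfold torusMap; fun_prop
      refine Continuous.mul (continuous_finsetProd _ fun i _ => ?_) ?_
      · exact Continuous.inv₀ (by fun_prop) fun θ => hne θ i
      · exact hc.comp_continuous ht hmem
    rw [torusIntegral_succ hint]
    -- With the first variable frozen, the induction hypothesis evaluates the inner torus integral;
    -- the one-variable Cauchy formula then disposes of the first circle.
    have hin : ∀ x ∈ Metric.closedBall (c 0) (R 0),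
        torusIntegral (fun y => (∏ i, ((Fin.cons x y : Fin (n + 1) → ℂ) i - z i)⁻¹)
          * f (Fin.cons x y)) (c ∘ Fin.succ) (R ∘ Fin.succ)
        = (2 * Real.pi * Complex.I) ^ n * ((x - z 0)⁻¹ * f (Fin.cons x (Fin.tail z))) := by
      intro x hx
      have hcons : ∀ y ∈ Set.univ.pi
          fun i => Metric.closedBall ((c ∘ Fin.succ) i) ((R ∘ Fin.succ) i),
          (Fin.cons x y : Fin (n + 1) → ℂ) ∈
            Set.univ.pi fun i => Metric.closedBall (c i) (R i) := by
        intro y hy i _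
        refine Fin.cases ?_ (fun j => ?_) i
        · simpa using hx
        · simpa using hy j trivial
      have h := ih (f := fun y => f (Fin.cons x y)) (c := c ∘ Fin.succ) (R := R ∘ Fin.succ)
        (fun i => hR _) (hc.comp (Continuous.continuousOn (by fun_prop)) hcons) ?_
        (z := Fin.tail z) (fun i _ => hz i.succ trivial)
      · calc _ = torusIntegral (fun y => (x - z 0)⁻¹ * ((∏ i, (y i - Fin.tail z i)⁻¹)
              * f (Fin.cons x y))) (c ∘ Fin.succ) (R ∘ Fin.succ) := by
              congr 1 with y
              rw [Fin.prod_univ_succ]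
              simp [Fin.tail, mul_assoc]
          _ = _ := by
            rw [torusIntegral_const_mul, h]
            ring
      · intro y hy i
        have := hd _ (hcons y hy) i.succ
        simpa only [Fin.cons_update, Fin.cons_succ] using this
    have hcirc : ∀ x ∈ Metric.sphere (c 0) (R 0), _ := fun x hx =>
      hin x (Metric.sphere_subset_closedBall hx)
    rw [circleIntegral.integral_congr (hR 0).le hcirc]
    have hz' : ∀ x ∈ Metric.closedBall (c 0) (R 0),
        (Fin.cons x (Fin.tail z) : Fin (n + 1) → ℂ) ∈
          Set.univ.pi fun i => Metric.closedBall (c i) (R i) := by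
      intro x hx i _
      refine Fin.cases ?_ (fun j => ?_) i
      · simpa using hx
      · exact Metric.ball_subset_closedBall (hz j.succ trivial)
    have hdiff : DifferentiableOn ℂ (fun x => f (Fin.cons x (Fin.tail z)))
        (Metric.closedBall (c 0) (R 0)) := by
      intro x hx
      have := hd _ (hz' x hx) 0
      simp only [Fin.update_cons_zero, Fin.cons_zero] at this
      exact this.differentiableWithinAt
    have hC := hdiff.circleIntegral_sub_inv_smul (hz 0 trivial)
    simp only [smul_eq_mul, Fin.cons_self_tail] at hC
    rw [circleIntegral.integral_const_mul, hC]
    ring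

/-- Geometric expansion of the Cauchy kernel about the centre. On the disc of half the radius the
ratio is at most `1/2` for all angles at once, whence the bound `2 / R i`. -/
theorem uniformlyAnalyticAt_inv_circle {n : ℕ} (c : Fin n → ℂ) {R : Fin n → ℝ} (i : Fin n)
    (hR : 0 < R i) :
    UniformlyAnalyticAt ℂ (fun (x : ℂ) (θ : Fin n → ℝ) => (torusMap c R θ i - x)⁻¹) (c i) := by
  have hne : ∀ θ : ℝ, (R i : ℂ) * Complex.exp (θ * Complex.I) ≠ 0 := fun θ =>
    mul_ne_zero (by exact_mod_cast hR.ne') (Complex.exp_ne_zero _)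
  refine UniformlyAnalyticAt.of_hasSum
    (c := fun k θ => ((R i : ℂ) * Complex.exp (θ i * Complex.I))⁻¹ ^ (k + 1))
    (R := R i / 2) (M := 2 / R i) (x0 := c i) ?_ (by positivity) ?_ ?_ (by simpa using hR)
  · intro k
    have h1 : Continuous fun θ : Fin n → ℝ => (R i : ℂ) * Complex.exp (θ i * Complex.I) := by
      fun_prop
    exact (h1.inv₀ fun θ => hne (θ i)).pow _
  · intro θ t
    have h : ∀ k, ‖((R i : ℂ) * Complex.exp (θ i * Complex.I))⁻¹ ^ (k + 1)‖ * (R i / 2) ^ k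
        = (1 / R i) * (1 / 2) ^ k := by
      intro k
      simp only [norm_pow, norm_inv, norm_mul, Complex.norm_real, Real.norm_eq_abs, abs_of_pos hR,
        Complex.norm_exp_ofReal_mul_I, mul_one]
      rw [div_pow, div_pow]
      have := hR.ne'
      rw [inv_pow, pow_succ, mul_inv]
      field_simp
      simp
    simp only [h]
    rw [← Finset.mul_sum]
    have := hasSum_geometric_two.summable.sum_le_tsum t (fun k _ => by positivity)
    rw [tsum_geometric_two] at this
    calc _ ≤ 1 / R i * 2 := by gcongr
      _ = _ := by ring
  · intro x hx θ
    have hx' : ‖(x - c i) * ((R i : ℂ) * Complex.exp (θ i * Complex.I))⁻¹‖ < 1 := by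
      rw [norm_mul, norm_inv, norm_mul, Complex.norm_exp_ofReal_mul_I, mul_one, Complex.norm_real,
        Real.norm_eq_abs, abs_of_pos hR, ← div_eq_mul_inv, div_lt_one hR]
      linarith
    have h := (hasSum_geometric_of_norm_lt_one hx').mul_left
      ((R i : ℂ) * Complex.exp (θ i * Complex.I))⁻¹
    have e : (torusMap c R θ i - x)⁻¹ = ((R i : ℂ) * Complex.exp (θ i * Complex.I))⁻¹
        * (1 - (x - c i) * ((R i : ℂ) * Complex.exp (θ i * Complex.I))⁻¹)⁻¹ := by
      rw [← mul_inv]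
      congr 1
      rw [mul_sub, mul_one, mul_comm (x - c i), ← mul_assoc, mul_inv_cancel₀ (hne _), one_mul]
      simp [torusMap]
      ring
    rw [e]
    refine h.congr_fun fun k => ?_
    rw [mul_pow]
    ring

/-- **Osgood's lemma**: a continuous separately holomorphic function is analytic. -/
theorem analyticAt_of_continuousOn_of_separately {n : ℕ} {f : (Fin n → ℂ) → ℂ}
    {U : Set (Fin n → ℂ)} (hU : IsOpen U) (hc : ContinuousOn f U)
    (hd : ∀ z ∈ U, ∀ i, DifferentiableAt ℂ (fun x => f (Function.update z i x)) (z i))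
    {c : Fin n → ℂ} (hcU : c ∈ U) : AnalyticAt ℂ f c := by
  obtain ⟨r, hr, hrU⟩ := Metric.nhds_basis_closedBall.mem_iff.1 (hU.mem_nhds hcU)
  set R : Fin n → ℝ := fun _ => r
  have hP : (Set.univ.pi fun i => Metric.closedBall (c i) (R i)) ⊆ U := by
    rw [← closedBall_pi _ hr.le]; exact hrU
  have hR : ∀ i, 0 < R i := fun _ => hr
  have hmem : ∀ θ, torusMap c R θ ∈ U := by
    refine fun θ => hP fun i _ => ?_
    simp [torusMap, abs_of_pos (hR i)]
  have hmap : Continuous (torusMap c R) := by unfold torusMap; fun_prop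
  have hUA : UniformlyAnalyticAt ℂ
      (fun (z : Fin n → ℂ) (θ : Fin n → ℝ) => ∏ i, (torusMap c R θ i - z i)⁻¹) c := by
    refine UniformlyAnalyticAt.prod _ fun i _ => ?_
    exact (uniformlyAnalyticAt_inv_circle c i (hR i)).comp_analyticAt
      (φ := fun z : Fin n → ℂ => z i)
      ((ContinuousLinearMap.proj (R := ℂ) (φ := fun _ : Fin n => ℂ) i).analyticAt c)
  have hw : Integrable (fun θ : Fin n → ℝ =>
      (∏ i, R i * Complex.exp (θ i * Complex.I) * Complex.I : ℂ) * f (torusMap c R θ))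
      (volume.restrict (Set.Icc (0 : Fin n → ℝ) fun _ => 2 * Real.pi)) := by
    refine ContinuousOn.integrableOn_compact isCompact_Icc (Continuous.continuousOn ?_)
    exact Continuous.mul (by fun_prop) (hc.comp_continuous hmap hmem)
  have hA := hUA.analyticAt_integral hw
  have hA' := hA.const_smul (c := ((2 * Real.pi * Complex.I) ^ n)⁻¹)
  refine hA'.congr ?_
  have hnhds : (Set.univ.pi fun i => Metric.ball (c i) (R i)) ∈ 𝓝 c := by
    rw [← ball_pi _ hr]; exact Metric.ball_mem_nhds c hr
  filter_upwards [hnhds] with z hz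
  have h := torusIntegral_prod_sub_inv_mul hR (hc.mono hP) (fun z hz => hd z (hP hz)) hz
  rw [torusIntegral] at h
  have hne : ((2 * Real.pi * Complex.I) ^ n : ℂ) ≠ 0 := by
    simp [Real.pi_ne_zero]
  rw [Pi.smul_apply, smul_eq_mul, inv_mul_eq_iff_eq_mul₀ hne, ← h]
  congr 1 with θ
  rw [smul_eq_mul]
  ring

/-- Supplies the expansion at the origin of an arbitrary function of the Hardy space. -/
theorem analyticAt_of_differentiableOn {n : ℕ} {f : (Fin n → ℂ) → ℂ}
    {U : Set (Fin n → ℂ)} (hU : IsOpen U) (hf : DifferentiableOn ℂ f U)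
    {c : Fin n → ℂ} (hcU : c ∈ U) : AnalyticAt ℂ f c := by
  refine analyticAt_of_continuousOn_of_separately hU hf.continuousOn (fun z hz i => ?_) hcU
  have h1 : DifferentiableAt ℂ f (Function.update z i (z i)) := by
    rw [Function.update_eq_self]
    exact hf.differentiableAt (hU.mem_nhds hz)
  refine h1.comp (z i) ?_
  exact (hasFDerivAt_update z (z i)).differentiableAt

end Osgood

end ComplexEllipsoid

namespace ComplexEllipsoid

/-! ### Incomplete Gamma functions and series of Mittag-Leffler type -/

section IncompleteGamma

open Real Set

/-- This is the Beta integral `B(a, l + 1)` scaled to `[0, y]`, brought back from the complex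
version. -/
theorem integral_rpow_mul_sub_pow {a y : ℝ} (ha : 0 < a) (hy : 0 < y) (l : ℕ) :
    ∫ t in (0 : ℝ)..y, t ^ (a - 1) * (y - t) ^ l =
      y ^ (l + a) * (l.factorial * Gamma a / Gamma (l + a + 1)) := by
  have h := Complex.betaIntegral_scaled (a : ℂ) ((l : ℂ) + 1) hy
  have h2 : ∫ t in (0 : ℝ)..y, (t : ℂ) ^ ((a : ℂ) - 1) * ((y : ℂ) - t) ^ ((l : ℂ) + 1 - 1)
      = ((∫ t in (0 : ℝ)..y, t ^ (a - 1) * (y - t) ^ l : ℝ) : ℂ) := by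
    rw [← intervalIntegral.integral_ofReal]
    refine intervalIntegral.integral_congr fun t ht => ?_
    rw [uIcc_of_le hy.le] at ht
    simp only [add_sub_cancel_right, Complex.cpow_natCast]
    push_cast
    rw [Complex.ofReal_cpow ht.1]
    push_cast
    rfl
  have h3 : Complex.betaIntegral a (l + 1)
      = ((l.factorial * Gamma a / Gamma (l + a + 1) : ℝ) : ℂ) := by
    have h4 := Complex.Gamma_mul_Gamma_eq_betaIntegral (s := a) (t := (l : ℂ) + 1)
      (by simpa using ha) (by simp; positivity)
    rw [Complex.Gamma_nat_eq_factorial, Complex.Gamma_ofReal,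
      show (a : ℂ) + (l + 1) = ((l + a + 1 : ℝ) : ℂ) by push_cast; ring, Complex.Gamma_ofReal] at h4
    have h5 : Gamma (l + a + 1) ≠ 0 := (Gamma_pos_of_pos (by positivity)).ne'
    have h5' : (Gamma (l + a + 1) : ℂ) ≠ 0 := by exact_mod_cast h5
    rw [Complex.ofReal_div, eq_div_iff h5', mul_comm, ← h4]
    push_cast
    ring
  rw [h2, h3] at h
  rw [show (a : ℂ) + (l + 1) - 1 = ((l + a : ℝ) : ℂ) by push_cast; ring,
    ← Complex.ofReal_cpow hy.le] at h
  exact_mod_cast h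

theorem intervalIntegrable_rpow_mul {a y : ℝ} (ha : 0 < a) {g : ℝ → ℝ}
    (hg : Continuous g) : IntervalIntegrable (fun t => t ^ (a - 1) * g t) volume 0 y :=
  (intervalIntegral.intervalIntegrable_rpow' (by linarith)).mul_continuousOn hg.continuousOn

/-- The power series of the lower incomplete Gamma function. -/
theorem hasSum_lowerGamma {a y : ℝ} (ha : 0 < a) (hy : 0 < y) :
    HasSum (fun l : ℕ => y ^ (l + a) / Gamma (l + a + 1))
      ((∫ t in (0 : ℝ)..y, t ^ (a - 1) * exp (y - t)) / Gamma a) := by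
  have hG : Gamma a ≠ 0 := (Gamma_pos_of_pos ha).ne'
  set F : ℕ → ℝ → ℝ := fun l t => t ^ (a - 1) * ((y - t) ^ l / l.factorial) with hF
  have hFi : ∀ l, IntegrableOn (F l) (Ioc 0 y) := fun l => by
    have := intervalIntegrable_rpow_mul (y := y) ha (g := fun t => (y - t) ^ l / l.factorial)
      (by fun_prop)
    rwa [intervalIntegrable_iff_integrableOn_Ioc_of_le hy.le] at this
  have hE : IntegrableOn (fun t => t ^ (a - 1) * exp (y - t)) (Ioc 0 y) := by
    have := intervalIntegrable_rpow_mul (y := y) ha (g := fun t => exp (y - t)) (by fun_prop)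
    rwa [intervalIntegrable_iff_integrableOn_Ioc_of_le hy.le] at this
  have hF0 : ∀ l, ∀ t ∈ Ioc 0 y, 0 ≤ F l t := fun l t ht => by
    have h1 := ht.1
    have h2 := sub_nonneg.2 ht.2
    simp only [hF]
    positivity
  have hnorm : ∀ l, ∫ t in Ioc 0 y, ‖F l t‖ = ∫ t in Ioc 0 y, F l t := fun l =>
    setIntegral_congr_fun measurableSet_Ioc fun t ht => by
      rw [Real.norm_of_nonneg (hF0 l t ht)]
  have hsumF : ∀ t ∈ Ioc 0 y, HasSum (fun l => F l t) (t ^ (a - 1) * exp (y - t)) := by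
    intro t ht
    have := NormedSpace.expSeries_div_hasSum_exp (y - t)
    rw [← Real.exp_eq_exp_ℝ] at this
    exact this.mul_left _
  -- All terms are nonnegative, so their integrals are summable once the partial sums stay below the
  -- integral of the full exponential.
  have hS : Summable fun l => ∫ t in Ioc 0 y, ‖F l t‖ := by
    refine summable_of_sum_le (c := ∫ t in Ioc 0 y, t ^ (a - 1) * exp (y - t))
      (fun l => integral_nonneg fun t => norm_nonneg _) fun u => ?_
    simp only [hnorm]
    rw [← integral_finsetSum _ fun l _ => hFi l]
    refine setIntegral_mono_on (integrable_finsetSum _ fun l _ => hFi l) hE measurableSet_Ioc ?_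
    intro t ht
    exact sum_le_hasSum _ (fun l _ => hF0 l t ht) (hsumF t ht)
  have h := hasSum_integral_of_summable_integral_norm hFi hS
  have e1 : ∫ t in Ioc 0 y, ∑' l, F l t = ∫ t in Ioc 0 y, t ^ (a - 1) * exp (y - t) :=
    setIntegral_congr_fun measurableSet_Ioc fun t ht => (hsumF t ht).tsum_eq
  rw [e1, ← intervalIntegral.integral_of_le hy.le] at h
  refine (h.div_const (Gamma a)).congr_fun fun l => ?_
  rw [← intervalIntegral.integral_of_le hy.le]
  have e2 : ∫ t in (0 : ℝ)..y, F l t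
      = (∫ t in (0 : ℝ)..y, t ^ (a - 1) * (y - t) ^ l) / l.factorial := by
    rw [← intervalIntegral.integral_div]
    simp only [hF, mul_div_assoc]
  rw [e2, integral_rpow_mul_sub_pow ha hy]
  have : (l.factorial : ℝ) ≠ 0 := by positivity
  field_simp

theorem integrableOn_exp_mul_sub_rpow {a ξ τ : ℝ} (ha1 : a ≤ 1) (hξ : 0 < ξ) (hτ : 0 < τ) :
    IntegrableOn (fun s => exp (-(ξ * s)) * (τ + s) ^ (a - 1)) (Ioi 0) := by
  have h := (exp_neg_integrableOn_Ioi 0 hξ).const_mul (τ ^ (a - 1))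
  refine h.mono' (Measurable.aestronglyMeasurable (by fun_prop)) ?_
  filter_upwards [ae_restrict_mem measurableSet_Ioi] with s hs
  have hs : 0 < s := hs
  rw [norm_mul, Real.norm_of_nonneg (exp_pos _).le, Real.norm_of_nonneg (by positivity), mul_comm,
    neg_mul]
  gcongr ?_ * _
  exact rpow_le_rpow_of_nonpos hτ (by linarith) (by linarith)

theorem integral_Ioi_shift {g : ℝ → ℝ} (y : ℝ) :
    ∫ t in Ioi y, g t = ∫ s in Ioi 0, g (y + s) := by
  have h := (measurePreserving_add_left (volume : Measure ℝ) y).setIntegral_preimage_emb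
    (measurableEmbedding_addLeft y) g (Ioi y)
  rw [← h]
  congr 2
  ext s
  simp

/-- The Mittag-Leffler type series `∑ y ^ (l + a - 1) / Γ(l + a)` is `e ^ y` plus a remainder which
is a Laplace transform. -/
theorem hasSum_rpow_div_Gamma_one {a y : ℝ} (ha : 0 < a) (ha1 : a ≤ 1) (hy : 0 < y) :
    HasSum (fun l : ℕ => y ^ (l + a - 1) / Gamma (l + a))
      (exp y + (∫ s in Ioi 0, exp (-(1 * s)) * (y ^ (a - 1) - (y + s) ^ (a - 1))) / Gamma a) := by
  have hG : Gamma a ≠ 0 := (Gamma_pos_of_pos ha).ne'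
  have h := hasSum_lowerGamma ha hy
  -- Complete the incomplete integral to `Γ(a)` and shift the missing tail by `y`; the factor `exp
  -- y` makes the tail a Laplace transform at `1`.
  have hI : ∫ t in (0 : ℝ)..y, t ^ (a - 1) * exp (y - t)
      = exp y * Gamma a - ∫ s in Ioi 0, exp (-(1 * s)) * (y + s) ^ (a - 1) := by
    have hc := GammaIntegral_convergent ha
    have e1 : ∫ t in (0 : ℝ)..y, t ^ (a - 1) * exp (y - t)
        = exp y * ∫ t in Ioc 0 y, exp (-t) * t ^ (a - 1) := by
      rw [intervalIntegral.integral_of_le hy.le, ← integral_const_mul]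
      congr 1 with t
      rw [show exp (y - t) = exp y * exp (-t) by rw [← exp_add, sub_eq_add_neg]]
      ring
    have e2 : Gamma a = (∫ t in Ioc 0 y, exp (-t) * t ^ (a - 1))
        + ∫ t in Ioi y, exp (-t) * t ^ (a - 1) := by
      rw [Gamma_eq_integral ha, ← setIntegral_union (Ioc_disjoint_Ioi le_rfl) measurableSet_Ioi
        (hc.mono_set Ioc_subset_Ioi_self) (hc.mono_set (Ioi_subset_Ioi hy.le)),
        Ioc_union_Ioi_eq_Ioi hy.le]
    have e3 : exp y * ∫ t in Ioi y, exp (-t) * t ^ (a - 1)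
        = ∫ s in Ioi 0, exp (-(1 * s)) * (y + s) ^ (a - 1) := by
      rw [integral_Ioi_shift, ← integral_const_mul]
      congr 1 with s
      rw [← mul_assoc, ← exp_add]
      ring_nf
    rw [e1, e2, ← e3]
    ring
  have hI2 : ∫ s in Ioi 0, exp (-(1 * s)) * (y ^ (a - 1) - (y + s) ^ (a - 1))
      = y ^ (a - 1) - ∫ s in Ioi 0, exp (-(1 * s)) * (y + s) ^ (a - 1) := by
    have hi : IntegrableOn (fun s : ℝ => exp (-(1 * s)) * y ^ (a - 1)) (Ioi 0) := by
      have := (exp_neg_integrableOn_Ioi 0 one_pos).mul_const (y ^ (a - 1))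
      simpa only [IntegrableOn, neg_mul] using this
    simp only [mul_sub]
    rw [integral_sub hi (integrableOn_exp_mul_sub_rpow ha1 one_pos hy), integral_mul_const]
    simp only [one_mul]
    rw [integral_exp_neg_Ioi_zero, one_mul]
  rw [hI] at h
  -- The incomplete Gamma series begins with the term of index `1` of the present one. The missing
  -- term `y ^ (a - 1) / Γ(a)` is `1 / Γ(a)` times the integral of `exp (-s) * y ^ (a - 1)`, and
  -- makes the remainder a difference of powers.
  have h' := (hasSum_nat_add_iff' (f := fun l : ℕ => y ^ (l + a - 1) / Gamma (l + a)) 1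
    (g := (exp y * Gamma a - ∫ s in Ioi 0, exp (-(1 * s)) * (y + s) ^ (a - 1)) / Gamma a
      + y ^ (a - 1) / Gamma a)).1 ?_
  · refine (congrArg (HasSum _) ?_).mp h'
    rw [hI2]
    field_simp
    ring
  · simp only [Finset.range_one, Finset.sum_singleton, Nat.cast_zero, zero_add,
      add_sub_cancel_right]
    refine h.congr_fun fun l => ?_
    push_cast
    ring_nf

/-- The substitution `s ↦ ξ s` moves `ξ` out of the powers: in the remainder it survives only in an
exponential and in a prefactor, which prepares analyticity in `ξ`. -/
theorem hasSum_rpow_div_Gamma {a ξ τ : ℝ} (ha : 0 < a) (ha1 : a ≤ 1) (hξ : 0 < ξ) (hτ : 0 < τ) :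
    HasSum (fun l : ℕ => (ξ * τ) ^ (l + a - 1) / Gamma (l + a))
      (exp (ξ * τ) + ξ ^ a / Gamma a *
        ∫ s in Ioi 0, exp (-(ξ * s)) * (τ ^ (a - 1) - (τ + s) ^ (a - 1))) := by
  have h := hasSum_rpow_div_Gamma_one ha ha1 (mul_pos hξ hτ)
  have e : ∫ s in Ioi 0, exp (-(1 * s)) * ((ξ * τ) ^ (a - 1) - (ξ * τ + s) ^ (a - 1))
      = ξ ^ a * ∫ s in Ioi 0, exp (-(ξ * s)) * (τ ^ (a - 1) - (τ + s) ^ (a - 1)) := by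
    have := integral_comp_mul_left_Ioi'
      (fun s => exp (-(1 * s)) * ((ξ * τ) ^ (a - 1) - (ξ * τ + s) ^ (a - 1))) 0 hξ
    rw [mul_zero] at this
    rw [← this, smul_eq_mul, ← integral_const_mul, ← integral_const_mul]
    refine setIntegral_congr_fun measurableSet_Ioi fun s hs => ?_
    have hs : 0 < s := hs
    rw [← mul_add, mul_rpow hξ.le hτ.le, mul_rpow hξ.le (by positivity)]
    rw [show ξ ^ a = ξ * ξ ^ (a - 1) by rw [← rpow_one_add' hξ.le (by linarith)]; ring_nf]
    ring_nf
  rw [e] at h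
  refine (congrArg (HasSum _) ?_).mp h
  ring

end IncompleteGamma

end ComplexEllipsoid

namespace ComplexEllipsoid

/-! ### Mittag-Leffler functions: exponential part, remainder and bounds -/

section MittagLeffler

open Real Set

/-- The Mittag-Leffler function `∑ u ^ k / Γ((k + 1) / m)`. -/
noncomputable def mittag (m : ℕ) (u : ℝ) : ℝ := ∑' k : ℕ, u ^ k / Gamma ((k + 1) / m)

/-- The exponentially growing part of the Mittag-Leffler function. -/
noncomputable def mittagMain (m : ℕ) (u : ℝ) : ℝ := m * (u ^ (m - 1) * exp (u ^ m))

variable {m : ℕ}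

theorem rpow_inv_pow (hm : 1 ≤ m) {τ : ℝ} (hτ : 0 ≤ τ) : (τ ^ (1 / (m : ℝ))) ^ m = τ := by
  rw [one_div, rpow_inv_natCast_pow hτ (by omega)]

/-- Sort the indices by residue, `k = m * l + j`. With `a = (j + 1) / m ≤ 1` the class of `j` is `u
^ (m - 1)` times the series of `hasSum_rpow_div_Gamma`; each of the `m` classes yields one copy of
`exp (u ^ m)`, which explains the factor `m` of the main part. The variables `x` and `τ` stay
separate since `x` will be the parameter and `τ` the integration variable. -/
theorem hasSum_mittag_aux (hm : 1 ≤ m) {x τ : ℝ} (hx : 0 < x) (hτ : 0 < τ) :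
    HasSum (fun k : ℕ => (x * τ ^ (1 / (m : ℝ))) ^ k / Gamma ((k + 1) / m))
      (mittagMain m (x * τ ^ (1 / (m : ℝ))) + (x * τ ^ (1 / (m : ℝ))) ^ (m - 1) *
        ∑ j ∈ Finset.range m, x ^ (j + 1) / Gamma ((j + 1) / m) * ∫ s in Ioi 0,
          exp (-(x ^ m * s)) * (τ ^ ((j + 1) / m - 1 : ℝ) - (τ + s) ^ ((j + 1) / m - 1 : ℝ))) := by
  have hm0 : (0 : ℝ) < m := by exact_mod_cast hm
  set u := x * τ ^ (1 / (m : ℝ)) with hu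
  have hu0 : 0 < u := by positivity
  have hum : u ^ m = x ^ m * τ := by rw [hu, mul_pow, rpow_inv_pow hm hτ.le]
  have h1 : ∀ j ∈ Finset.range m, HasSum
      (fun k : ℕ => if k % m = j then u ^ k / Gamma ((k + 1) / m) else 0)
      (u ^ (m - 1) * (exp (x ^ m * τ) + x ^ (j + 1) / Gamma ((j + 1) / m) * ∫ s in Ioi 0,
          exp (-(x ^ m * s)) * (τ ^ ((j + 1) / m - 1 : ℝ) - (τ + s) ^ ((j + 1) / m - 1 : ℝ)))) := by
    intro j hj
    have hjm : j < m := Finset.mem_range.1 hj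
    have hjm' : (j : ℝ) + 1 ≤ m := by exact_mod_cast hjm
    have ha : (0 : ℝ) < (j + 1) / m := by positivity
    have h := (hasSum_rpow_div_Gamma ha ((div_le_one hm0).2 hjm') (pow_pos hx m) hτ).mul_left
      (u ^ (m - 1))
    have e1 : (x ^ m) ^ (((j : ℝ) + 1) / m) = x ^ (j + 1) := by
      rw [← rpow_natCast, ← rpow_mul hx.le, mul_div_cancel₀ _ hm0.ne']
      exact_mod_cast rpow_natCast x (j + 1)
    rw [e1] at h
    have hinj : Function.Injective fun l : ℕ => m * l + j := fun l l' hl => by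
      simpa [show m ≠ 0 by omega] using hl
    refine (hinj.hasSum_iff ?_).1 (h.congr_fun fun l => ?_)
    · intro k hk
      rw [if_neg]
      rintro rfl
      exact hk ⟨k / m, Nat.div_add_mod k m⟩
    · have : (m * l + j) % m = j := by
        rw [Nat.mul_add_mod, Nat.mod_eq_of_lt hjm]
      simp only [Function.comp, this, if_true]
      rw [← hum, mul_div_assoc']
      congr 1
      · rw [← rpow_natCast u m, ← rpow_mul hu0.le, ← rpow_natCast u (m - 1), ← rpow_add hu0,
          ← rpow_natCast u (m * l + j)]
        congr 1
        rw [Nat.cast_sub hm]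
        push_cast
        field_simp
        ring
      · congr 1
        push_cast
        field_simp
        ring
  have h2 := hasSum_sum h1
  have e2 : ∀ k : ℕ, (∑ j ∈ Finset.range m,
      if k % m = j then u ^ k / Gamma ((k + 1) / m) else 0) = u ^ k / Gamma ((k + 1) / m) := by
    intro k
    rw [Finset.sum_ite_eq, if_pos (Finset.mem_range.2 (Nat.mod_lt _ (by omega)))]
  simp only [e2] at h2
  refine (congrArg (HasSum _) ?_).mp h2
  rw [← Finset.mul_sum, Finset.sum_add_distrib, mittagMain, hum]
  simp
  ring

theorem Gamma_arg_pos (hm : 1 ≤ m) (k : ℕ) : 0 < Gamma (((k : ℝ) + 1) / m) :=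
  Gamma_pos_of_pos (by positivity)

theorem hasSum_mittag (hm : 1 ≤ m) {u : ℝ} (hu : 0 ≤ u) :
    HasSum (fun k : ℕ => u ^ k / Gamma ((k + 1) / m)) (mittag m u) := by
  rcases hu.eq_or_lt with rfl | hu
  · have : ∀ k ∉ ({0} : Finset ℕ), (0 : ℝ) ^ k / Gamma ((k + 1) / m) = 0 := by
      intro k hk
      rw [zero_pow (by simpa using hk), zero_div]
    exact (summable_of_ne_finset_zero this).hasSum
  · have := (hasSum_mittag_aux hm hu one_pos).summable
    simp only [one_rpow, mul_one] at this
    exact this.hasSum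

theorem mittag_eq (hm : 1 ≤ m) {x τ : ℝ} (hx : 0 < x) (hτ : 0 < τ) :
    mittag m (x * τ ^ (1 / (m : ℝ))) =
      mittagMain m (x * τ ^ (1 / (m : ℝ))) + (x * τ ^ (1 / (m : ℝ))) ^ (m - 1) *
        ∑ j ∈ Finset.range m, x ^ (j + 1) / Gamma ((j + 1) / m) * ∫ s in Ioi 0,
          exp (-(x ^ m * s)) * (τ ^ ((j + 1) / m - 1 : ℝ) - (τ + s) ^ ((j + 1) / m - 1 : ℝ)) :=
  (hasSum_mittag_aux hm hx hτ).tsum_eq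

theorem rpow_sub_rpow_add_mem {a τ s : ℝ} (ha : a ≤ 1) (hτ : 0 < τ) (hs : 0 ≤ s) :
    τ ^ (a - 1) - (τ + s) ^ (a - 1) ∈ Icc 0 (τ ^ (a - 1)) := by
  have h1 := rpow_le_rpow_of_nonpos (x := τ) (y := τ + s) hτ (by linarith) (sub_nonpos.2 ha)
  have h2 : 0 ≤ (τ + s) ^ (a - 1) := by positivity
  constructor <;> linarith

theorem succ_div_le_one {j : ℕ} (hj : j < m) : ((j : ℝ) + 1) / m ≤ 1 := by
  have : (j : ℝ) + 1 ≤ m := by exact_mod_cast hj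
  exact div_le_one_of_le₀ this (by positivity)

theorem inv_Gamma_le_mittag (hm : 1 ≤ m) {u : ℝ} (hu : 0 ≤ u) :
    1 / Gamma (1 / m) ≤ mittag m u := by
  have := (hasSum_mittag hm hu).summable.le_tsum 0 fun k _ =>
    div_nonneg (pow_nonneg hu k) (Gamma_arg_pos hm k).le
  simpa [mittag] using this

/-- The remainder is nonnegative: the exponents `(j + 1) / m - 1` are at most `0`, so the
differences of powers under the integral are nonnegative. -/
theorem mittagMain_le_mittag (hm : 1 ≤ m) {u : ℝ} (hu : 0 < u) : mittagMain m u ≤ mittag m u := by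
  have h := mittag_eq hm hu one_pos
  rw [one_rpow, mul_one] at h
  rw [h, le_add_iff_nonneg_right]
  refine mul_nonneg (by positivity) (Finset.sum_nonneg fun j hj => mul_nonneg ?_ ?_)
  · exact div_nonneg (by positivity) (Gamma_arg_pos hm j).le
  · refine setIntegral_nonneg measurableSet_Ioi fun s hs => ?_
    exact mul_nonneg (exp_pos _).le (rpow_sub_rpow_add_mem
      (succ_div_le_one (Finset.mem_range.1 hj)) one_pos (le_of_lt hs)).1

/-- A lower bound of the Mittag-Leffler function by the exponential. -/
theorem exists_mul_exp_le_mittag (hm : 1 ≤ m) :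
    ∃ c > 0, ∀ u, 0 ≤ u → c * exp (u ^ m) ≤ mittag m u := by
  have h := Gamma_arg_pos hm 0
  simp only [Nat.cast_zero, zero_add] at h
  -- For `u ≤ 1` the constant term of the series suffices, as `exp (u ^ m) ≤ exp 1`; for `u ≥ 1` the
  -- main part already exceeds `exp (u ^ m)`.
  refine ⟨min 1 (1 / Gamma (1 / m) / exp 1), by positivity, fun u hu => ?_⟩
  rcases le_total u 1 with h1 | h1
  · calc _ ≤ 1 / Gamma (1 / m) / exp 1 * exp (u ^ m) := by gcongr; exact min_le_right _ _
      _ ≤ 1 / Gamma (1 / m) / exp 1 * exp 1 := by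
        gcongr
        exact pow_le_one₀ hu h1
      _ = 1 / Gamma (1 / m) := by field_simp
      _ ≤ _ := inv_Gamma_le_mittag hm hu
  · refine le_trans ?_ (mittagMain_le_mittag hm (by linarith : 0 < u))
    rw [mittagMain, ← mul_assoc]
    gcongr
    refine (min_le_left _ _).trans ?_
    have h2 : (1 : ℝ) ≤ u ^ (m - 1) := one_le_pow₀ h1
    have h3 : (1 : ℝ) ≤ m := by exact_mod_cast hm
    nlinarith

/-- An upper bound of the Mittag-Leffler function. -/
theorem exists_mittag_le (hm : 1 ≤ m) :
    ∃ C, 0 ≤ C ∧ ∀ u, 0 ≤ u → mittag m u ≤ C * ((1 + u ^ m) * exp (u ^ m)) := by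
  have hG : ∀ j : ℕ, 0 ≤ 1 / Gamma ((j + 1) / m) := fun j =>
    one_div_nonneg.2 (Gamma_arg_pos hm j).le
  have hS : 0 ≤ ∑ j ∈ Finset.range m, 1 / Gamma (((j : ℝ) + 1) / m) :=
    Finset.sum_nonneg fun j _ => hG j
  refine ⟨m + ∑ j ∈ Finset.range m, 1 / Gamma ((j + 1) / m), by positivity, fun u hu => ?_⟩
  rcases hu.eq_or_lt with rfl | hu
  · rw [zero_pow (by omega), exp_zero, mul_one, add_zero, mul_one]
    have e : mittag m 0 = 1 / Gamma (((0 : ℕ) + 1) / m) := by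
      rw [mittag, tsum_eq_single 0 fun k hk => by rw [zero_pow hk, zero_div]]
      simp
    rw [e]
    have := Finset.single_le_sum (f := fun j : ℕ => 1 / Gamma (((j : ℝ) + 1) / m))
      (fun j _ => hG j) (Finset.mem_range.2 hm : 0 ∈ Finset.range m)
    have h3 : (0 : ℝ) ≤ m := by positivity
    linarith
  have hpow : ∀ p ≤ m, u ^ p ≤ 1 + u ^ m := by
    intro p hp
    rcases le_total u 1 with h1 | h1
    · have := pow_le_one₀ hu.le h1 (n := p)
      have : 0 ≤ u ^ m := by positivity
      linarith
    · have := pow_le_pow_right₀ h1 hp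
      linarith
  have h := mittag_eq hm hu one_pos
  rw [one_rpow, mul_one] at h
  rw [h, add_mul, mittagMain]
  have h1e : 1 ≤ exp (u ^ m) := one_le_exp (by positivity)
  refine add_le_add ?_ ?_
  · have := hpow (m - 1) (by omega)
    gcongr
  rw [Finset.mul_sum, Finset.sum_mul]
  refine Finset.sum_le_sum fun j hj => ?_
  have hjm := Finset.mem_range.1 hj
  -- The difference of powers is at most `1`. The resulting `1 / u ^ m` cancels against `u ^ (m - 1)
  -- * u ^ (j + 1)` and leaves `u ^ j`, harmless because `j < m`.
  have hI : ∫ s in Ioi 0, exp (-(u ^ m * s)) * ((1 : ℝ) ^ ((j + 1) / m - 1 : ℝ)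
      - (1 + s) ^ ((j + 1) / m - 1 : ℝ)) ≤ 1 / u ^ m := by
    have hum : 0 < u ^ m := by positivity
    have hi := exp_neg_integrableOn_Ioi 0 hum
    have e : ∫ s in Ioi (0 : ℝ), exp (-u ^ m * s) = 1 / u ^ m := by
      have := integral_exp_mul_Ioi (a := -u ^ m) (by linarith) 0
      rw [this]
      simp
    rw [← e]
    refine setIntegral_mono_on (hi.mono' (Measurable.aestronglyMeasurable (by fun_prop)) ?_) hi
      measurableSet_Ioi ?_
    · filter_upwards [ae_restrict_mem measurableSet_Ioi] with s hs
      have := rpow_sub_rpow_add_mem (succ_div_le_one hjm) one_pos (le_of_lt hs)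
      rw [one_rpow] at this ⊢
      rw [norm_mul, Real.norm_of_nonneg (exp_pos _).le, Real.norm_of_nonneg this.1, neg_mul]
      exact mul_le_of_le_one_right (exp_pos _).le this.2
    · intro s hs
      have := rpow_sub_rpow_add_mem (succ_div_le_one hjm) one_pos (le_of_lt hs)
      rw [one_rpow] at this ⊢
      rw [neg_mul]
      exact mul_le_of_le_one_right (exp_pos _).le this.2
  calc _ ≤ u ^ (m - 1) * (u ^ (j + 1) / Gamma ((j + 1) / m) * (1 / u ^ m)) := by
        have := (Gamma_arg_pos hm j).le
        gcongr
    _ = 1 / Gamma ((j + 1) / m) * u ^ j := by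
        obtain ⟨p, rfl⟩ : ∃ p, m = p + 1 := ⟨m - 1, by omega⟩
        simp only [Nat.add_sub_cancel]
        field_simp
        ring
    _ ≤ 1 / Gamma ((j + 1) / m) * ((1 + u ^ m) * exp (u ^ m)) := by
        refine mul_le_mul_of_nonneg_left ?_ (hG j)
        have := hpow j hjm.le
        have h0 : 0 ≤ u ^ m := by positivity
        nlinarith

end MittagLeffler

end ComplexEllipsoid

namespace ComplexEllipsoid

/-! ### Analytic dependence of the weighted factors on their parameter -/

section Families

open Real Set

variable {m : ℕ}

theorem mul_exp_neg_le {b τ : ℝ} (hb : 0 < b) : τ * exp (-(b * τ)) ≤ 1 / b := by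
  have h := add_one_le_exp (b * τ)
  rw [exp_neg, ← div_eq_mul_inv, div_le_div_iff₀ (exp_pos _) hb]
  linarith

theorem rpow_mul_exp_neg_le {b τ q : ℝ} (hb : 0 < b) (hτ : 0 < τ) (hq : 0 ≤ q) (hq1 : q ≤ 1) :
    τ ^ q * exp (-(b * τ)) ≤ 1 + 1 / b := by
  have h1 : τ ^ q ≤ 1 + τ := by
    rcases le_total τ 1 with h | h
    · have := rpow_le_one hτ.le h hq
      linarith
    · have := rpow_le_rpow_of_exponent_le h hq1
      rw [rpow_one] at this
      linarith
  have h2 := mul_exp_neg_le (τ := τ) hb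
  have h3 : exp (-(b * τ)) ≤ 1 := exp_le_one_iff.2 (by simp; positivity)
  calc _ ≤ (1 + τ) * exp (-(b * τ)) := by gcongr
    _ ≤ _ := by linarith

/-- The weight `exp (-(b * τ))` makes the family bounded on the half-line: at the radius `b` the
weighted Taylor series in `ξ` sums to exactly `1`. -/
theorem uniformlyAnalyticAt_exp_mul {b ξ0 : ℝ} (h : |ξ0| < b) :
    UniformlyAnalyticAt ℝ (fun (ξ : ℝ) (τ : Ioi (0 : ℝ)) => exp (ξ * τ) * exp (-(b * τ))) ξ0 := by
  have hb : 0 < b := (abs_nonneg _).trans_lt h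
  have hs : ∀ ξ τ : ℝ, HasSum (fun k : ℕ => τ ^ k / k.factorial * exp (-(b * τ)) * ξ ^ k)
      (exp (ξ * τ) * exp (-(b * τ))) := by
    intro ξ τ
    have := NormedSpace.expSeries_div_hasSum_exp (ξ * τ)
    rw [← Real.exp_eq_exp_ℝ] at this
    refine (this.mul_right _).congr_fun fun k => ?_
    rw [mul_pow]
    ring
  refine UniformlyAnalyticAt.of_hasSum (R := b) (M := 1) (x0 := 0)
    (c := fun k (τ : Ioi (0 : ℝ)) => (τ : ℝ) ^ k / k.factorial * exp (-(b * τ)))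
      (fun k => by fun_prop) hb ?_ ?_
    (by simpa using h)
  · rintro ⟨τ, hτ⟩ t
    have hτ : 0 < τ := hτ
    have h1 := sum_le_hasSum t (fun k _ => by positivity) (hs b τ)
    rw [← exp_add, add_neg_cancel, exp_zero] at h1
    refine le_trans (le_of_eq (Finset.sum_congr rfl fun k _ => ?_)) h1
    rw [Real.norm_of_nonneg (by positivity)]
  · intro ξ _ τ
    simpa using hs ξ τ

theorem continuous_rpow_Ioi (q : ℝ) : Continuous fun τ : Ioi (0 : ℝ) => (τ : ℝ) ^ q :=
  continuous_subtype_val.rpow_const fun τ => Or.inl (ne_of_gt τ.2)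

/-- `x ^ m` is the exponential rate in `τ`. The coefficients are positive, so it is enough to bound
the series at a single radius `R > |x0|` with `R ^ m < b`, where the spare decay `b - R ^ m` absorbs
the linear factor of `exists_mittag_le`. The point `x0 = 0` is allowed, as the vanishing coordinates
of `z0` require. -/
theorem uniformlyAnalyticAt_mittag (hm : 1 ≤ m) {b x0 : ℝ} (h : |x0| ^ m < b) :
    UniformlyAnalyticAt ℝ (fun (x : ℝ) (τ : Ioi (0 : ℝ)) =>
      mittag m (x * (τ : ℝ) ^ (1 / (m : ℝ))) * exp (-(b * τ))) x0 := by
  obtain ⟨R, hR, hRb⟩ : ∃ R, |x0| < R ∧ R ^ m < b := by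
    have h1 : ∀ᶠ R in 𝓝 |x0|, R ^ m < b :=
      ContinuousAt.eventually_lt (by fun_prop) continuousAt_const h
    obtain ⟨R, h2, h3⟩ := ((h1.filter_mono nhdsWithin_le_nhds).and
      (self_mem_nhdsWithin : Ioi |x0| ∈ 𝓝[>] |x0|)).exists
    exact ⟨R, h3, h2⟩
  have hR0 : 0 < R := (abs_nonneg _).trans_lt hR
  obtain ⟨C, hC0, hC⟩ := exists_mittag_le hm
  have hsum : ∀ x v : ℝ, 0 ≤ v → Summable fun k : ℕ => (x * v) ^ k / Gamma ((k + 1) / m) := by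
    intro x v hv
    refine Summable.of_norm ?_
    refine (hasSum_mittag hm (u := |x| * v) (by positivity)).summable.congr fun k => ?_
    rw [norm_div, norm_pow, norm_mul, Real.norm_of_nonneg (Gamma_arg_pos hm k).le,
      Real.norm_of_nonneg hv, Real.norm_eq_abs]
  refine UniformlyAnalyticAt.of_hasSum (R := R) (M := C * (1 + R ^ m * (1 / (b - R ^ m))))
    (x0 := 0) (c := fun k (τ : Ioi (0 : ℝ)) => ((τ : ℝ) ^ (1 / (m : ℝ))) ^ k / Gamma ((k + 1) / m)
      * exp (-(b * τ))) (fun k => ?_) hR0 ?_ ?_ (by simpa using hR)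
  · exact (((continuous_rpow_Ioi _).pow k).div_const _).mul (by fun_prop)
  · rintro ⟨τ, hτ⟩ t
    have hτ : 0 < τ := hτ
    have hG := fun k => (Gamma_arg_pos hm k).le
    have h1 := sum_le_hasSum t (fun k _ => by have := hG k; positivity)
      (hasSum_mittag hm (u := R * τ ^ (1 / (m : ℝ))) (by positivity))
    have h2 := hC (R * τ ^ (1 / (m : ℝ))) (by positivity)
    rw [mul_pow, rpow_inv_pow hm hτ.le] at h2
    have hd : 0 < b - R ^ m := by linarith
    calc ∑ k ∈ t, ‖(τ ^ (1 / (m : ℝ))) ^ k / Gamma ((k + 1) / m) * exp (-(b * τ))‖ * R ^ k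
        = (∑ k ∈ t, (R * τ ^ (1 / (m : ℝ))) ^ k / Gamma ((k + 1) / m)) * exp (-(b * τ)) := by
          rw [Finset.sum_mul]
          refine Finset.sum_congr rfl fun k _ => ?_
          have := hG k
          rw [Real.norm_of_nonneg (by positivity), mul_pow]
          ring
      _ ≤ C * ((1 + R ^ m * τ) * exp (R ^ m * τ)) * exp (-(b * τ)) := by
          gcongr
          exact h1.trans h2
      _ = C * ((1 + R ^ m * τ) * exp (-((b - R ^ m) * τ))) := by
          rw [show -((b - R ^ m) * τ) = R ^ m * τ + -(b * τ) by ring, exp_add]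
          ring
      _ ≤ _ := by
          have h3 := mul_exp_neg_le (τ := τ) hd
          have h4 : exp (-((b - R ^ m) * τ)) ≤ 1 := exp_le_one_iff.2 (by simp; positivity)
          gcongr
          have : 0 ≤ R ^ m := by positivity
          nlinarith
  · intro x _ τ
    have hτ : (0 : ℝ) < τ := τ.2
    refine ((hsum x ((τ : ℝ) ^ (1 / (m : ℝ))) (by positivity)).hasSum.mul_right
      (exp (-(b * τ)))).congr_fun fun k => ?_
    rw [mul_pow, sub_zero]
    ring

theorem pow_le_one_add {v : ℝ} (hv : 0 ≤ v) {p q : ℕ} (hpq : p ≤ q) : v ^ p ≤ 1 + v ^ q := by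
  rcases le_total v 1 with h1 | h1
  · have := pow_le_one₀ hv h1 (n := p)
    have : 0 ≤ v ^ q := by positivity
    linarith
  · have := pow_le_pow_right₀ h1 hpq
    linarith

theorem uniformlyAnalyticAt_mittagMain (hm : 1 ≤ m) {b x0 : ℝ} (h : |x0| ^ m < b) :
    UniformlyAnalyticAt ℝ (fun (x : ℝ) (τ : Ioi (0 : ℝ)) =>
      mittagMain m (x * (τ : ℝ) ^ (1 / (m : ℝ))) * exp (-(b * τ))) x0 := by
  -- The weight is shared: `b'` controls the exponential, and `b - b'` controls the power `τ ^ ((m -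
  -- 1) / m)`.
  obtain ⟨b', hb', hb'b⟩ := exists_between h
  have h1 : UniformlyAnalyticAt ℝ (fun (x : ℝ) (τ : Ioi (0 : ℝ)) =>
      exp (x ^ m * τ) * exp (-(b' * τ))) x0 :=
    (uniformlyAnalyticAt_exp_mul (ξ0 := x0 ^ m) (by rwa [abs_pow])).comp_analyticAt
      (φ := fun x => x ^ m) (analyticAt_id.pow m)
  have h2 : UniformlyAnalyticAt ℝ (fun (x : ℝ) (τ : Ioi (0 : ℝ)) => (m : ℝ) * x ^ (m - 1)) x0 :=
    UniformlyAnalyticAt.of_analyticAt (analyticAt_const.mul (analyticAt_id.pow _))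
  have hd : 0 < b - b' := by linarith
  have h3 : UniformlyAnalyticAt ℝ (fun (_ : ℝ) (τ : Ioi (0 : ℝ)) =>
      ((τ : ℝ) ^ (1 / (m : ℝ))) ^ (m - 1) * exp (-((b - b') * τ))) x0 := by
    refine UniformlyAnalyticAt.const (M := 1 + 1 / (b - b')) ?_ ?_ _
    · exact ((continuous_rpow_Ioi _).pow _).mul (by fun_prop)
    · rintro ⟨τ, hτ⟩
      have hτ : 0 < τ := hτ
      have := pow_le_one_add (v := τ ^ (1 / (m : ℝ))) (by positivity) (Nat.sub_le m 1)
      rw [rpow_inv_pow hm hτ.le] at this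
      have h3 := mul_exp_neg_le (τ := τ) hd
      have h4 : exp (-((b - b') * τ)) ≤ 1 := exp_le_one_iff.2 (by simp; positivity)
      rw [Real.norm_of_nonneg (by positivity)]
      calc _ ≤ (1 + τ) * exp (-((b - b') * τ)) := by gcongr
        _ ≤ _ := by linarith
  refine ((h2.mul h1).mul h3).congr (Eventually.of_forall fun x τ => ?_)
  have hτ : (0 : ℝ) < τ := τ.2
  rw [mittagMain, mul_pow, mul_pow, rpow_inv_pow hm hτ.le,
    show -(b * (τ : ℝ)) = -(b' * τ) + -((b - b') * τ) by ring, exp_add]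
  ring

/-- The remainder of the Mittag-Leffler function. -/
noncomputable def mittagRem (m : ℕ) (u : ℝ) : ℝ := mittag m u - mittagMain m u

/-- The parameter occurs only in `exp (-(x ^ m * s))`, a uniformly analytic family in `s`, which is
then integrated against a dominated kernel. The factor `τ ^ q` compensates the singularity `τ ^ (a -
1)` at `0`, and an arbitrarily small `b > 0` handles infinity. Positivity of `x0` gives the decay in
`s`. -/
theorem uniformlyAnalyticAt_laplace {a q b x0 : ℝ} (ha1 : a ≤ 1) (hq : 0 ≤ q + (a - 1))
    (hq1 : q + (a - 1) ≤ 1) (hb : 0 < b) (hx0 : 0 < x0) :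
    UniformlyAnalyticAt ℝ (fun (x : ℝ) (τ : Ioi (0 : ℝ)) => (τ : ℝ) ^ q * exp (-(b * τ)) *
      ∫ s in Ioi 0, exp (-(x ^ m * s)) * ((τ : ℝ) ^ (a - 1) - (τ + s) ^ (a - 1))) x0 := by
  set ξ := x0 ^ m with hξ
  have hξ0 : 0 < ξ := by positivity
  -- The decay `exp (-(ξ * s))` is cut in two halves: one weights the family in `x`, whose exponent
  -- `ξ - x ^ m` vanishes at `x0`, and the other dominates the kernel.
  have h1 : UniformlyAnalyticAt ℝ (fun (x : ℝ) (s : Ioi (0 : ℝ)) =>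
      exp ((ξ - x ^ m) * s) * exp (-((ξ / 2) * s))) x0 :=
    (uniformlyAnalyticAt_exp_mul (b := ξ / 2) (ξ0 := ξ - x0 ^ m)
      (by rw [← hξ, sub_self, abs_zero]; positivity)).comp_analyticAt
      (φ := fun x => ξ - x ^ m) (analyticAt_const.sub (analyticAt_id.pow m))
  have hker : ∀ (τ s : Ioi (0 : ℝ)), ‖(τ : ℝ) ^ q * exp (-(b * τ)) *
      ((τ : ℝ) ^ (a - 1) - (τ + s) ^ (a - 1)) * exp (-((ξ / 2) * s))‖
      ≤ (1 + 1 / b) * exp (-(ξ / 2) * s) := by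
    rintro ⟨τ, hτ⟩ ⟨s, hs⟩
    have hτ : 0 < τ := hτ
    have hs : 0 < s := hs
    have h2 := rpow_sub_rpow_add_mem ha1 hτ hs.le
    have h3 := h2.1
    rw [Real.norm_of_nonneg (by positivity), neg_mul]
    gcongr
    calc _ ≤ τ ^ q * exp (-(b * τ)) * τ ^ (a - 1) := by gcongr; exact h2.2
      _ = τ ^ (q + (a - 1)) * exp (-(b * τ)) := by rw [rpow_add hτ]; ring
      _ ≤ _ := rpow_mul_exp_neg_le hb hτ hq hq1
  have hw : Integrable (fun s : Ioi (0 : ℝ) => (1 + 1 / b) * exp (-(ξ / 2) * s))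
      (Measure.comap Subtype.val volume) := by
    have := (exp_neg_integrableOn_Ioi 0 (half_pos hξ0)).const_mul (1 + 1 / b)
    exact (integrableOn_iff_comap_subtypeVal measurableSet_Ioi).1 this
  have h2 := UniformlyAnalyticAt.integral_kernel (T := Ioi (0 : ℝ)) hw
    (k := fun τ (s : Ioi (0 : ℝ)) => (τ : ℝ) ^ q * exp (-(b * τ)) *
      ((τ : ℝ) ^ (a - 1) - (τ + s) ^ (a - 1)) * exp (-((ξ / 2) * s)))
    (fun τ => Measurable.aestronglyMeasurable (by fun_prop))
    (fun τ => Eventually.of_forall fun s => hker τ s)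
    (Eventually.of_forall fun s => ?_) h1
  · refine h2.congr (Eventually.of_forall fun x τ => ?_)
    rw [← integral_const_mul, ← integral_subtype_comap measurableSet_Ioi]
    congr 1 with s
    rw [show -(x ^ m * (s : ℝ)) = (ξ - x ^ m) * s + -(ξ / 2 * s) + -(ξ / 2 * s) by ring, exp_add,
      exp_add]
    ring
  · have hc : Continuous fun τ : Ioi (0 : ℝ) => ((τ : ℝ) + s) ^ (a - 1) := by
      refine Continuous.rpow_const (by fun_prop) fun τ => Or.inl ?_
      have h1 : (0 : ℝ) < τ := τ.2
      have h2 : (0 : ℝ) < s := s.2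
      positivity
    exact (((continuous_rpow_Ioi q).mul (by fun_prop)).mul
      ((continuous_rpow_Ioi _).sub hc)).mul continuous_const

/-- Every `b > 0` is admissible, whereas the main part needs `b > x0 ^ m`: this gain lets the other
terms cross the boundary. In the class of `j` the factor `τ ^ ((m - 1) / m)` meets `τ ^ ((j + 1) / m
- 1)`, with total exponent `j / m` between `0` and `1`. -/
theorem uniformlyAnalyticAt_mittagRem (hm : 1 ≤ m) {b x0 : ℝ} (hb : 0 < b) (hx0 : 0 < x0) :
    UniformlyAnalyticAt ℝ (fun (x : ℝ) (τ : Ioi (0 : ℝ)) =>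
      mittagRem m (x * (τ : ℝ) ^ (1 / (m : ℝ))) * exp (-(b * τ))) x0 := by
  have hm0 : (0 : ℝ) < m := by exact_mod_cast hm
  have hm1 : (1 : ℝ) ≤ m := by exact_mod_cast hm
  have h1 : UniformlyAnalyticAt ℝ (fun (x : ℝ) (τ : Ioi (0 : ℝ)) =>
      ∑ j ∈ Finset.range m, (x ^ (m - 1) * (x ^ (j + 1) / Gamma ((j + 1) / m))) *
        ((τ : ℝ) ^ ((m - 1) / m : ℝ) * exp (-(b * τ)) * ∫ s in Ioi 0, exp (-(x ^ m * s)) *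
          ((τ : ℝ) ^ ((j + 1) / m - 1 : ℝ) - (τ + s) ^ ((j + 1) / m - 1 : ℝ)))) x0 := by
    refine UniformlyAnalyticAt.sum _ fun j hj => ?_
    refine UniformlyAnalyticAt.mul (UniformlyAnalyticAt.of_analyticAt
      ((analyticAt_id.pow _).mul ((analyticAt_id.pow _).div_const)))
      (uniformlyAnalyticAt_laplace (succ_div_le_one (Finset.mem_range.1 hj)) ?_ ?_ hb hx0)
    · rw [show ((m : ℝ) - 1) / m + ((j + 1) / m - 1) = j / m by field_simp; ring]
      positivity
    · have := succ_div_le_one (Finset.mem_range.1 hj)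
      have h2 : ((m : ℝ) - 1) / m ≤ 1 := div_le_one_of_le₀ (by linarith) hm0.le
      linarith
  refine h1.congr ?_
  filter_upwards [lt_mem_nhds hx0] with x hx τ
  have hτ : (0 : ℝ) < τ := τ.2
  rw [mittagRem, mittag_eq hm hx hτ, add_sub_cancel_left, Finset.mul_sum, Finset.sum_mul]
  refine Finset.sum_congr rfl fun j _ => ?_
  have e : ((τ : ℝ) ^ ((m - 1) / m : ℝ)) = ((τ : ℝ) ^ (1 / (m : ℝ))) ^ (m - 1) := by
    rw [← rpow_natCast, ← rpow_mul hτ.le, Nat.cast_sub hm]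
    congr 1
    push_cast
    ring
  rw [e, mul_pow]
  ring

/-- The remainder vanishes for `m = 1`. -/
theorem mittagRem_one {u : ℝ} (hu : 0 ≤ u) : mittagRem 1 u = 0 := by
  have h := hasSum_mittag le_rfl hu
  have h2 := NormedSpace.expSeries_div_hasSum_exp u
  rw [← Real.exp_eq_exp_ℝ] at h2
  have h3 := h.unique (h2.congr_fun fun k => by simp [Gamma_nat_eq_factorial])
  rw [mittagRem, h3, mittagMain]
  simp

/-- Analyticity of a Laplace type integral of a product of families of exponential growth. -/
theorem analyticAt_integral_prod {ι : Type*} {V : Type*} [NormedAddCommGroup V]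
    [NormedSpace ℝ V] (t : Finset ι) {G : ι → V → ℝ → ℝ} {b : ι → ℝ} {σ : ℝ} {v0 : V} (hσ : 0 < σ)
    (hb : ∑ j ∈ t, b j < 1)
    (hG : ∀ j ∈ t, UniformlyAnalyticAt ℝ
      (fun v (τ : Ioi (0 : ℝ)) => G j v τ * exp (-(b j * τ))) v0) :
    AnalyticAt ℝ (fun v => ∫ τ in Ioi 0, (∏ j ∈ t, G j v τ) * (exp (-τ) * τ ^ (σ - 1))) v0 ∧
      IntegrableOn (fun τ => (∏ j ∈ t, G j v0 τ) * (exp (-τ) * τ ^ (σ - 1))) (Ioi 0) := by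
  -- Each factor borrows `b j` from the decay `exp (-τ)`; what remains is positive and keeps the
  -- weight integrable at infinity.
  have hd : 0 < 1 - ∑ j ∈ t, b j := by linarith
  have hw : Integrable (fun τ : Ioi (0 : ℝ) =>
      (τ : ℝ) ^ (σ - 1) * exp (-(1 - ∑ j ∈ t, b j) * τ)) (Measure.comap Subtype.val volume) := by
    have h0 := integrableOn_rpow_mul_exp_neg_mul_rpow (s := σ - 1) (p := 1) (by linarith) one_pos hd
    simp only [rpow_one] at h0
    exact (integrableOn_iff_comap_subtypeVal measurableSet_Ioi).1 h0
  have hU := UniformlyAnalyticAt.prod t hG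
  have e : ∀ v (τ : ℝ), (∏ j ∈ t, G j v τ * exp (-(b j * τ))) *
      (τ ^ (σ - 1) * exp (-(1 - ∑ j ∈ t, b j) * τ))
      = (∏ j ∈ t, G j v τ) * (exp (-τ) * τ ^ (σ - 1)) := by
    intro v τ
    rw [Finset.prod_mul_distrib, ← exp_sum, Finset.sum_neg_distrib, ← Finset.sum_mul,
      show -τ = -((∑ j ∈ t, b j) * τ) + -(1 - ∑ j ∈ t, b j) * τ by ring, exp_add]
    ring
  constructor
  · refine (hU.analyticAt_integral hw).congr (Eventually.of_forall fun v => ?_)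
    simp only [e]
    exact integral_subtype_comap measurableSet_Ioi
      fun τ => (∏ j ∈ t, G j v τ) * (exp (-τ) * τ ^ (σ - 1))
  · have := hU.integrable hw
    simp only [e] at this
    exact (integrableOn_iff_comap_subtypeVal measurableSet_Ioi).2 this

end Families

end ComplexEllipsoid

namespace ComplexEllipsoid

/-! ### Homogeneity of the ellipsoid and the layer-cake formula -/

section Moments

open Real Set

variable {n : ℕ} {m : Fin n → ℕ}

theorem continuous_psi : Continuous (psi m) := by
  unfold psi
  fun_prop

theorem measurable_psi : Measurable (psi m) := continuous_psi.measurable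

theorem isOpen_domain : IsOpen (domain m) := isOpen_lt continuous_psi continuous_const

theorem psi_nonneg (z : Fin n → ℂ) : 0 ≤ psi m z :=
  Finset.sum_nonneg fun _ _ => by positivity

theorem norm_pow_le_psi (z : Fin n → ℂ) (j : Fin n) : ‖z j‖ ^ (2 * m j) ≤ psi m z :=
  Finset.single_le_sum (f := fun j => ‖z j‖ ^ (2 * m j)) (fun _ _ => by positivity)
    (Finset.mem_univ j)

theorem norm_coord_le_one {z : Fin n → ℂ} (hz : psi m z ≤ 1) (hm : ∀ j, 1 ≤ m j) (j : Fin n) :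
    ‖z j‖ ≤ 1 := by
  have h := (norm_pow_le_psi (m := m) z j).trans hz
  have := hm j
  rwa [pow_le_one_iff_of_nonneg (norm_nonneg _) (by omega)] at h

theorem psi_pos {z : Fin n → ℂ} (hz : z ≠ 0) : 0 < psi m z := by
  obtain ⟨j, hj⟩ := Function.ne_iff.1 hz
  have hj' : 0 < ‖z j‖ := norm_pos_iff.2 hj
  exact lt_of_lt_of_le (by positivity) (norm_pow_le_psi z j)

theorem psi_zero (hm : ∀ j, 1 ≤ m j) : psi m 0 = 0 :=
  Finset.sum_eq_zero fun j _ => by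
    have := hm j
    simp only [Pi.zero_apply, norm_zero]
    exact zero_pow (by omega)

/-- The anisotropic dilation with positive real coordinates. -/
noncomputable def dilation (c : Fin n → ℝ) (z : Fin n → ℂ) : Fin n → ℂ := fun j => c j • z j

theorem map_dilation {c : Fin n → ℝ} (hc : ∀ j, 0 < c j) :
    (volume : Measure (Fin n → ℂ)).map (dilation c)
      = ENNReal.ofReal (∏ j, (c j) ^ 2)⁻¹ • volume := by
  set f : (Fin n → ℂ) →ₗ[ℝ] (Fin n → ℂ) :=
    LinearMap.pi (fun j => (c j • (LinearMap.id : ℂ →ₗ[ℝ] ℂ)).comp (LinearMap.proj j)) with hf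
  have hdet : LinearMap.det f = ∏ j, (c j) ^ 2 := by
    rw [hf, LinearMap.det_pi]
    refine Finset.prod_congr rfl fun j _ => ?_
    rw [LinearMap.det_smul, LinearMap.det_id, Complex.finrank_real_complex, mul_one]
  have hpos : 0 < ∏ j, (c j) ^ 2 := Finset.prod_pos fun j _ => pow_pos (hc j) 2
  have h := Measure.map_linearMap_addHaar_eq_smul_addHaar (volume : Measure (Fin n → ℂ))
    (f := f) (by rw [hdet]; exact hpos.ne')
  rw [hdet, abs_of_pos (inv_pos.2 hpos)] at h
  exact h

theorem measurable_dilation (c : Fin n → ℝ) : Measurable (dilation c) := by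
  unfold dilation
  fun_prop

/-- The weight `∏ |zⱼ| ^ (2 αⱼ)`. -/
noncomputable def weight (α : Fin n → ℕ) (z : Fin n → ℂ) : ℝ := ∏ j, ‖z j‖ ^ (2 * α j)

theorem continuous_weight (α : Fin n → ℕ) : Continuous (weight α) := by
  unfold weight
  fun_prop

theorem weight_nonneg (α : Fin n → ℕ) (z : Fin n → ℂ) : 0 ≤ weight α z :=
  Finset.prod_nonneg fun _ _ => by positivity

/-- The homogeneity degree `∑ (αⱼ + 1) / mⱼ` of the measure `∏ |zⱼ| ^ (2 αⱼ) dV(z)`. -/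
noncomputable def degree (m : Fin n → ℕ) (α : Fin n → ℕ) : ℝ := ∑ j, ((α j : ℝ) + 1) / m j

theorem degree_pos (hn : 1 ≤ n) (hm : ∀ j, 1 ≤ m j) (α : Fin n → ℕ) : 0 < degree m α := by
  refine Finset.sum_pos (fun j _ => ?_) ⟨⟨0, hn⟩, Finset.mem_univ _⟩
  have := hm j
  positivity

/-- The moment of the weight over the ellipsoid. -/
noncomputable def solidMoment (m α : Fin n → ℕ) : ℝ≥0∞ :=
  ∫⁻ z in domain m, ENNReal.ofReal (weight α z)

/-- The dilation with coefficients `t ^ (1 / (2 m_j))` multiplies `psi` by `t`, hence maps the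
ellipsoid onto the sublevel set; Jacobian and weight together scale by `t ^ degree m α`. -/
theorem lintegral_weight_sublevel (hm : ∀ j, 1 ≤ m j) (α : Fin n → ℕ) {t : ℝ} (ht : 0 < t) :
    ∫⁻ z in {z | psi m z < t}, ENNReal.ofReal (weight α z)
      = ENNReal.ofReal (t ^ degree m α) * solidMoment m α := by
  set c : Fin n → ℝ := fun j => t ^ (1 / (2 * (m j : ℝ))) with hc
  have hc0 : ∀ j, 0 < c j := fun j => rpow_pos_of_pos ht _
  have hm0 : ∀ j, (0 : ℝ) < m j := fun j => by exact_mod_cast hm j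
  have hpsi : ∀ z, psi m (dilation c z) = t * psi m z := by
    intro z
    simp only [psi, dilation, norm_smul, mul_pow, Finset.mul_sum]
    refine Finset.sum_congr rfl fun j _ => ?_
    congr 1
    rw [Real.norm_of_nonneg (hc0 j).le, hc, ← rpow_natCast, ← rpow_mul ht.le]
    have := (hm0 j).ne'
    push_cast
    rw [one_div_mul_cancel (by positivity), rpow_one]
  have hwt : ∀ z, weight α (dilation c z) = (∏ j, c j ^ (2 * α j)) * weight α z := by
    intro z
    simp only [weight, dilation, norm_smul, mul_pow, Finset.prod_mul_distrib]
    congr 1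
    exact Finset.prod_congr rfl fun j _ => by rw [Real.norm_of_nonneg (hc0 j).le]
  have hdeg : (∏ j, c j ^ 2) * (∏ j, c j ^ (2 * α j)) = t ^ degree m α := by
    rw [← Finset.prod_mul_distrib, degree, rpow_sum_of_pos ht]
    refine Finset.prod_congr rfl fun j _ => ?_
    have := (hm0 j).ne'
    rw [← pow_add, hc, ← rpow_natCast, ← rpow_mul ht.le]
    congr 1
    push_cast
    field_simp
    ring
  set P := ∏ j, c j ^ 2 with hP
  have hP0 : 0 < P := Finset.prod_pos fun j _ => pow_pos (hc0 j) 2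
  have hmeas : Measurable fun z : Fin n → ℂ =>
      ({z | psi m z < t}.indicator (fun z => ENNReal.ofReal (weight α z))) z :=
    ((continuous_weight α).measurable.ennreal_ofReal).indicator
      (measurableSet_lt measurable_psi measurable_const)
  have h1 := lintegral_map (μ := volume) hmeas (measurable_dilation c)
  rw [map_dilation hc0, lintegral_smul_measure] at h1
  have h2 : ∀ z, ({z | psi m z < t}.indicator (fun z => ENNReal.ofReal (weight α z)))
      (dilation c z) = ENNReal.ofReal (∏ j, c j ^ (2 * α j)) *
        ((domain m).indicator (fun z => ENNReal.ofReal (weight α z))) z := by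
    intro z
    have hiff : dilation c z ∈ {z | psi m z < t} ↔ z ∈ domain m := by
      simp only [mem_ofPred_eq, domain, hpsi]
      exact ⟨fun h => by nlinarith, fun h => by nlinarith⟩
    by_cases hz : z ∈ domain m
    · rw [indicator_of_mem hz, indicator_of_mem (hiff.2 hz), hwt,
        ENNReal.ofReal_mul (Finset.prod_nonneg fun j _ => by have := hc0 j; positivity)]
    · rw [indicator_of_notMem hz, indicator_of_notMem (fun h => hz (hiff.1 h)), mul_zero]
  simp only [h2] at h1
  rw [lintegral_const_mul' _ _ ENNReal.ofReal_ne_top,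
    lintegral_indicator (isOpen_domain.measurableSet),
    lintegral_indicator (measurableSet_lt measurable_psi measurable_const), smul_eq_mul] at h1
  have h3 : ENNReal.ofReal P * ENNReal.ofReal P⁻¹ = 1 := by
    rw [← ENNReal.ofReal_mul hP0.le, mul_inv_cancel₀ hP0.ne', ENNReal.ofReal_one]
  calc _ = ENNReal.ofReal P * (ENNReal.ofReal P⁻¹ *
        ∫⁻ z in {z | psi m z < t}, ENNReal.ofReal (weight α z)) := by
        rw [← mul_assoc, h3, one_mul]
    _ = _ := by
        rw [h1, ← mul_assoc, ← ENNReal.ofReal_mul hP0.le, hdeg]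
        rfl

/-- A layer cake formula for the function `psi`. -/
theorem lintegral_weight_mul (hm : ∀ j, 1 ≤ m j) (α : Fin n → ℕ) {k : ℝ → ℝ≥0∞}
    (hk : Measurable k) :
    ∫⁻ z, ENNReal.ofReal (weight α z) * ∫⁻ t in Ioi (psi m z), k t
      = (∫⁻ t in Ioi 0, k t * ENNReal.ofReal (t ^ degree m α)) * solidMoment m α := by
  have hmeas : Measurable fun p : (Fin n → ℂ) × ℝ =>
      ENNReal.ofReal (weight α p.1) * ({p : (Fin n → ℂ) × ℝ | psi m p.1 < p.2}.indicator
        (fun p => k p.2)) p := by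
    refine ((continuous_weight α).measurable.comp measurable_fst).ennreal_ofReal.mul
      ((hk.comp measurable_snd).indicator ?_)
    exact measurableSet_lt (measurable_psi.comp measurable_fst) measurable_snd
  have e1 : ∀ z, ENNReal.ofReal (weight α z) * ∫⁻ t in Ioi (psi m z), k t
      = ∫⁻ t, ENNReal.ofReal (weight α z) * ({p : (Fin n → ℂ) × ℝ | psi m p.1 < p.2}.indicator
        (fun p => k p.2)) (z, t) := by
    intro z
    rw [lintegral_const_mul' _ _ ENNReal.ofReal_ne_top, ← lintegral_indicator measurableSet_Ioi]
    rfl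
  simp only [e1]
  rw [lintegral_lintegral_swap hmeas.aemeasurable, ← lintegral_mul_const' _ _ ?_,
    ← lintegral_indicator measurableSet_Ioi]
  · congr 1 with t
    have e2 : ∀ z, ENNReal.ofReal (weight α z) *
        ({p : (Fin n → ℂ) × ℝ | psi m p.1 < p.2}.indicator (fun p => k p.2)) (z, t)
        = k t * ({z | psi m z < t}.indicator fun z => ENNReal.ofReal (weight α z)) z := by
      intro z
      by_cases h : psi m z < t
      · simp [indicator, h, mul_comm]
      · simp [indicator, h]
    simp only [e2]
    rw [lintegral_const_mul _ (((continuous_weight α).measurable.ennreal_ofReal).indicator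
      (measurableSet_lt measurable_psi measurable_const)),
      lintegral_indicator (measurableSet_lt measurable_psi measurable_const)]
    by_cases ht : 0 < t
    · rw [lintegral_weight_sublevel hm α ht, indicator_of_mem (mem_Ioi.2 ht), mul_assoc]
    · have : {z | psi m z < t} = ∅ := by
        ext z
        simp only [mem_ofPred_eq, mem_empty_iff_false, iff_false, not_lt]
        exact (not_lt.1 ht).trans (psi_nonneg z)
      rw [this, indicator_of_notMem (by simpa using ht)]
      simp
  · have hsub : domain m ⊆ Metric.closedBall 0 1 := by
      intro z hz
      rw [mem_closedBall_zero_iff, pi_norm_le_iff_of_nonneg zero_le_one]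
      exact norm_coord_le_one (le_of_lt hz) hm
    have hvol : volume (domain m) ≠ ∞ :=
      ((measure_mono hsub).trans_lt measure_closedBall_lt_top).ne
    refine (lt_of_le_of_lt (setLIntegral_mono (g := fun _ => 1) measurable_const ?_) ?_).ne
    · intro z hz
      rw [ENNReal.ofReal_le_one]
      exact Finset.prod_le_one (fun j _ => by positivity) fun j _ =>
        pow_le_one₀ (norm_nonneg _) (norm_coord_le_one (le_of_lt hz) hm j)
    · simpa using hvol.lt_top

end Moments

end ComplexEllipsoid

namespace ComplexEllipsoid

/-! ### Moments of the monomials on the boundary -/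

section SurfaceMoments

open Real Set

variable {n : ℕ} {m : Fin n → ℕ}

/-- With `exp (-psi)` in place of the indicator of the ellipsoid the integrand is a product over the
coordinates, and each factor is a Gamma integral over `ℂ`. -/
theorem lintegral_weight_mul_exp (hm : ∀ j, 1 ≤ m j) (α : Fin n → ℕ) :
    ∫⁻ z, ENNReal.ofReal (weight α z) * ENNReal.ofReal (exp (-psi m z))
      = ENNReal.ofReal (∏ j, (π / m j * Gamma ((α j + 1) / m j))) := by
  have hm0 : ∀ j, (0 : ℝ) < m j := fun j => by exact_mod_cast hm j
  have h1 : ∀ j, ∫ x : ℂ, ‖x‖ ^ (2 * α j) * exp (-‖x‖ ^ (2 * m j))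
      = π / m j * Gamma ((α j + 1) / m j) := by
    intro j
    have h := Complex.integral_rpow_mul_exp_neg_rpow (p := ((2 * m j : ℕ) : ℝ))
      (q := ((2 * α j : ℕ) : ℝ)) (by have := hm j; exact_mod_cast (by omega : 1 ≤ 2 * m j))
      (by have : (0 : ℝ) ≤ ((2 * α j : ℕ) : ℝ) := by positivity
          linarith)
    simp only [rpow_natCast] at h
    rw [h]
    have := (hm0 j).ne'
    congr 1
    · push_cast
      field_simp
    · congr 1
      push_cast
      field_simp
  have hpos : ∀ j, 0 < π / m j * Gamma ((α j + 1) / m j) := fun j =>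
    mul_pos (div_pos pi_pos (hm0 j)) (Gamma_arg_pos (hm j) (α j))
  have hint : ∀ j, Integrable fun x : ℂ => ‖x‖ ^ (2 * α j) * exp (-‖x‖ ^ (2 * m j)) := fun j =>
    Integrable.of_integral_ne_zero (by rw [h1]; exact (hpos j).ne')
  have hprod : ∀ z : Fin n → ℂ, weight α z * exp (-psi m z)
      = ∏ j, ‖z j‖ ^ (2 * α j) * exp (-‖z j‖ ^ (2 * m j)) := by
    intro z
    rw [Finset.prod_mul_distrib, ← exp_sum, Finset.sum_neg_distrib]
    rfl
  have hI : Integrable fun z : Fin n → ℂ => weight α z * exp (-psi m z) := by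
    simp only [hprod]
    exact Integrable.fintype_prod hint
  have h2 : ∫ z : Fin n → ℂ, weight α z * exp (-psi m z)
      = ∏ j, (π / m j * Gamma ((α j + 1) / m j)) := by
    simp only [hprod]
    rw [integral_fintype_prod_volume_eq_prod
      (f := fun j (x : ℂ) => ‖x‖ ^ (2 * α j) * exp (-‖x‖ ^ (2 * m j)))]
    exact Finset.prod_congr rfl fun j _ => h1 j
  rw [← h2, ofReal_integral_eq_lintegral_ofReal hI
    (Eventually.of_forall fun z => mul_nonneg (weight_nonneg α z) (exp_pos _).le)]
  congr 1 with z
  rw [ENNReal.ofReal_mul (weight_nonneg α z)]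

theorem lintegral_exp_neg_Ioi (c : ℝ) :
    ∫⁻ t in Ioi c, ENNReal.ofReal (exp (-t)) = ENNReal.ofReal (exp (-c)) := by
  have hi : IntegrableOn (fun t : ℝ => exp (-t)) (Ioi c) := by
    simpa using exp_neg_integrableOn_Ioi c one_pos
  rw [← ofReal_integral_eq_lintegral_ofReal hi (Eventually.of_forall fun t => (exp_pos _).le),
    integral_exp_neg_Ioi]

theorem lintegral_exp_neg_mul_rpow {s : ℝ} (hs : 0 < s) :
    ∫⁻ t in Ioi 0, ENNReal.ofReal (exp (-t)) * ENNReal.ofReal (t ^ (s - 1))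
      = ENNReal.ofReal (Gamma s) := by
  rw [Gamma_eq_integral hs, ofReal_integral_eq_lintegral_ofReal (GammaIntegral_convergent hs)]
  · congr 1 with t
    rw [ENNReal.ofReal_mul (exp_pos _).le]
  · filter_upwards [ae_restrict_mem measurableSet_Ioi] with t ht
    have : (0 : ℝ) < t := ht
    positivity

/-- The layer-cake formula with `k t = exp (-t)` has the tail `exp (-psi)`: the explicit exponential
moment is `Γ(degree + 1)` times the moment sought. -/
theorem solidMoment_eq (hn : 1 ≤ n) (hm : ∀ j, 1 ≤ m j) (α : Fin n → ℕ) :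
    solidMoment m α = ENNReal.ofReal
      ((∏ j, (π / m j * Gamma ((α j + 1) / m j))) / Gamma (degree m α + 1)) := by
  have hs := degree_pos hn hm α
  have hG : 0 < Gamma (degree m α + 1) := Gamma_pos_of_pos (by linarith)
  have h := lintegral_weight_mul hm α (k := fun t => ENNReal.ofReal (exp (-t))) (by fun_prop)
  simp only [lintegral_exp_neg_Ioi, lintegral_weight_mul_exp hm] at h
  have h2 := lintegral_exp_neg_mul_rpow (s := degree m α + 1) (by linarith)
  simp only [add_sub_cancel_right] at h2
  rw [h2] at h
  rw [ENNReal.ofReal_div_of_pos hG, h, mul_comm]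
  exact (ENNReal.mul_div_cancel_right (by simpa using hG) ENNReal.ofReal_ne_top).symm

theorem lintegral_rpow_Ioc {p : ℝ} (hp : 0 < p) :
    ∫⁻ t in Ioo (0 : ℝ) 1, ENNReal.ofReal (t ^ (p - 1)) = ENNReal.ofReal (1 / p) := by
  have hi : IntervalIntegrable (fun t : ℝ => t ^ (p - 1)) volume 0 1 :=
    intervalIntegral.intervalIntegrable_rpow' (by linarith)
  have h := integral_rpow (a := 0) (b := 1) (r := p - 1) (Or.inl (by linarith))
  rw [intervalIntegral.integral_of_le zero_le_one, integral_Ioc_eq_integral_Ioo] at h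
  rw [intervalIntegrable_iff_integrableOn_Ioo_of_le zero_le_one] at hi
  rw [← ofReal_integral_eq_lintegral_ofReal hi, h]
  · rw [one_rpow, sub_add_cancel, zero_rpow hp.ne', sub_zero]
  · filter_upwards [ae_restrict_mem measurableSet_Ioo] with t ht
    have : (0 : ℝ) < t := ht.1
    positivity

theorem lintegral_rpow_neg_Ioo {q c : ℝ} (hq : 0 < q) (hc : 0 < c) (hc1 : c ≤ 1) :
    ∫⁻ t in Ioo c 1, ENNReal.ofReal (q * t ^ (-q - 1)) = ENNReal.ofReal (c ^ (-q) - 1) := by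
  have h0 : (0 : ℝ) ∉ uIcc c 1 := by
    rw [uIcc_of_le hc1]
    exact fun h => absurd h.1 (not_le.2 hc)
  have hi : IntervalIntegrable (fun t : ℝ => q * t ^ (-q - 1)) volume c 1 :=
    (intervalIntegral.intervalIntegrable_rpow (Or.inr h0)).const_mul q
  have h := integral_rpow (a := c) (b := 1) (r := -q - 1)
    (Or.inr ⟨by linarith, h0⟩)
  have h2 : ∫ t in c..1, q * t ^ (-q - 1) = c ^ (-q) - 1 := by
    rw [intervalIntegral.integral_const_mul, h, one_rpow, sub_add_cancel]
    field_simp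
    ring
  rw [intervalIntegral.integral_of_le hc1, integral_Ioc_eq_integral_Ioo] at h2
  rw [intervalIntegrable_iff_integrableOn_Ioo_of_le hc1] at hi
  rw [← ofReal_integral_eq_lintegral_ofReal hi, h2]
  filter_upwards [ae_restrict_mem measurableSet_Ioo] with t ht
  have : (0 : ℝ) < t := hc.trans ht.1
  positivity

theorem ae_psi_pos (hn : 1 ≤ n) :
    ∀ᵐ z : Fin n → ℂ, 0 < psi m z := by
  have : Nonempty (Fin n) := ⟨⟨0, hn⟩⟩
  have h0 : ∀ᵐ z : Fin n → ℂ, z ≠ 0 := by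
    rw [ae_iff]
    simp
  filter_upwards [h0] with z hz
  exact psi_pos hz

/-- The moment of the `0`-homogeneous function `∏ |zⱼ| ^ (2 αⱼ) / ψ(z) ^ (∑ αⱼ / mⱼ)`. -/
theorem lintegral_weight_mul_rpow (hn : 1 ≤ n) (hm : ∀ j, 1 ≤ m j) (α : Fin n → ℕ) {q : ℝ}
    (hq : 0 ≤ q) (hqs : q < degree m α) :
    ∫⁻ z in domain m, ENNReal.ofReal (weight α z) * ENNReal.ofReal (psi m z ^ (-q))
      = ENNReal.ofReal (degree m α / (degree m α - q)) * solidMoment m α := by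
  have hd : 0 < degree m α - q := by linarith
  rcases hq.eq_or_lt with rfl | hq
  · rw [sub_zero, div_self (by linarith), ENNReal.ofReal_one, one_mul]
    simp [solidMoment]
  -- Chosen so that its integral beyond `psi m z` is `psi m z ^ (-q) - 1` inside the ellipsoid and
  -- `0` outside; the subtracted `1` is restored at the end as `solidMoment m α`.
  set k : ℝ → ℝ≥0∞ := (Iio (1 : ℝ)).indicator fun t => ENNReal.ofReal (q * t ^ (-q - 1)) with hk
  have hkm : Measurable k := Measurable.indicator (by fun_prop) measurableSet_Iio
  have h := lintegral_weight_mul hm α hkm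
  have e1 : ∀ c : ℝ, ∫⁻ t in Ioi c, k t = ∫⁻ t in Ioo c 1, ENNReal.ofReal (q * t ^ (-q - 1)) := by
    intro c
    rw [hk, setLIntegral_indicator measurableSet_Iio, inter_comm, Ioi_inter_Iio]
  have e2 : ∫⁻ t in Ioi 0, k t * ENNReal.ofReal (t ^ degree m α)
      = ENNReal.ofReal (q / (degree m α - q)) := by
    have : ∀ t, k t * ENNReal.ofReal (t ^ degree m α) = (Iio (1 : ℝ)).indicator (fun t =>
        ENNReal.ofReal (q * t ^ (-q - 1)) * ENNReal.ofReal (t ^ degree m α)) t := by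
      intro t
      by_cases ht : t < 1 <;> simp [hk, indicator, ht]
    simp only [this]
    rw [setLIntegral_indicator measurableSet_Iio, inter_comm, Ioi_inter_Iio,
      div_eq_mul_one_div, ENNReal.ofReal_mul hq.le, ← lintegral_rpow_Ioc hd,
      ← lintegral_const_mul' _ _ ENNReal.ofReal_ne_top]
    refine setLIntegral_congr_fun measurableSet_Ioo fun t ht => ?_
    have ht0 : (0 : ℝ) < t := ht.1
    rw [← ENNReal.ofReal_mul (by positivity), ← ENNReal.ofReal_mul hq.le, mul_assoc,
      ← rpow_add ht0]
    ring_nf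
  have e3 : ∫⁻ z, ENNReal.ofReal (weight α z) * ∫⁻ t in Ioi (psi m z), k t
      = ∫⁻ z in domain m, ENNReal.ofReal (weight α z) * ENNReal.ofReal (psi m z ^ (-q) - 1) := by
    rw [← lintegral_indicator isOpen_domain.measurableSet]
    refine lintegral_congr_ae ?_
    filter_upwards [ae_psi_pos hn] with z hz
    rw [e1]
    by_cases h1 : psi m z < 1
    · rw [indicator_of_mem (show z ∈ domain m from h1), lintegral_rpow_neg_Ioo hq hz h1.le]
    · rw [indicator_of_notMem (show z ∉ domain m from h1), Ioo_eq_empty h1]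
      simp
  rw [e2, e3] at h
  have e4 : ∫⁻ z in domain m, ENNReal.ofReal (weight α z) * ENNReal.ofReal (psi m z ^ (-q))
      = (∫⁻ z in domain m, ENNReal.ofReal (weight α z) * ENNReal.ofReal (psi m z ^ (-q) - 1))
        + solidMoment m α := by
    rw [solidMoment, ← lintegral_add_right _ (continuous_weight α).measurable.ennreal_ofReal]
    refine lintegral_congr_ae ?_
    filter_upwards [ae_restrict_of_ae (ae_psi_pos hn),
      ae_restrict_mem isOpen_domain.measurableSet] with z hz hz1
    have h1 : 1 ≤ psi m z ^ (-q) := one_le_rpow_of_pos_of_le_one_of_nonpos hz (le_of_lt hz1)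
      (by linarith)
    rw [← mul_add_one, ← ENNReal.ofReal_one, ← ENNReal.ofReal_add (by linarith) zero_le_one,
      sub_add_cancel]
  rw [e4, h, ← add_one_mul, ← ENNReal.ofReal_one, ← ENNReal.ofReal_add (by positivity) zero_le_one]
  congr 2
  field_simp
  ring

/-- The squared norm of the monomial of exponent `α` on the boundary of the ellipsoid. -/
noncomputable def moment (m α : Fin n → ℕ) : ℝ :=
  2 * (∏ j, (π / m j * Gamma ((α j + 1) / m j))) / Gamma (degree m α)

theorem moment_pos (hn : 1 ≤ n) (hm : ∀ j, 1 ≤ m j) (α : Fin n → ℕ) : 0 < moment m α := by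
  have h1 := Gamma_pos_of_pos (degree_pos hn hm α)
  have h2 : 0 < ∏ j, (π / m j * Gamma ((α j + 1) / m j)) := Finset.prod_pos fun j _ =>
    mul_pos (div_pos pi_pos (by exact_mod_cast hm j)) (Gamma_arg_pos (hm j) (α j))
  unfold moment
  positivity

theorem measurable_radialProj : Measurable (radialProj m) := by
  unfold radialProj
  have := measurable_psi (m := m)
  fun_prop

theorem psi_radialProj (hm : ∀ j, 1 ≤ m j) {z : Fin n → ℂ} (hz : 0 < psi m z) :
    psi m (radialProj m z) = 1 := by
  have h : ∀ j, ‖radialProj m z j‖ ^ (2 * m j) = (psi m z)⁻¹ * ‖z j‖ ^ (2 * m j) := by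
    intro j
    have hm0 : (m j : ℝ) ≠ 0 := by have := hm j; positivity
    rw [radialProj, norm_smul, mul_pow, Real.norm_of_nonneg (by positivity), ← rpow_natCast,
      ← rpow_mul hz.le]
    congr 1
    rw [← rpow_neg_one]
    congr 1
    push_cast
    field_simp
  rw [psi, Finset.sum_congr rfl fun j _ => h j, ← Finset.mul_sum]
  exact inv_mul_cancel₀ hz.ne'

theorem weight_radialProj (hm : ∀ j, 1 ≤ m j) (α : Fin n → ℕ) {z : Fin n → ℂ}
    (hz : 0 < psi m z) :
    weight α (radialProj m z) = weight α z * psi m z ^ (-∑ j, (α j : ℝ) / m j) := by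
  have h : ∀ j, ‖radialProj m z j‖ ^ (2 * α j)
      = ‖z j‖ ^ (2 * α j) * psi m z ^ (-((α j : ℝ) / m j)) := by
    intro j
    have hm0 : (m j : ℝ) ≠ 0 := by have := hm j; positivity
    rw [radialProj, norm_smul, mul_pow, Real.norm_of_nonneg (by positivity), ← rpow_natCast,
      ← rpow_mul hz.le, mul_comm]
    congr 2
    push_cast
    field_simp
  rw [weight, Finset.prod_congr rfl fun j _ => h j, Finset.prod_mul_distrib,
    ← rpow_sum_of_pos hz, Finset.sum_neg_distrib]
  rfl

theorem ae_surfaceMeasure (hn : 1 ≤ n) (hm : ∀ j, 1 ≤ m j) :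
    ∀ᵐ w ∂(surfaceMeasure m), psi m w = 1 := by
  refine Measure.ae_smul_measure ?_ _
  rw [ae_map_iff measurable_radialProj.aemeasurable
    (measurableSet_eq_fun measurable_psi measurable_const)]
  filter_upwards [ae_restrict_of_ae (ae_psi_pos hn)] with z hz
  exact psi_radialProj hm hz

theorem lintegral_surfaceMeasure {F : (Fin n → ℂ) → ℝ≥0∞} (hF : Measurable F) :
    ∫⁻ w, F w ∂(surfaceMeasure m) = ENNReal.ofReal (2 * ∑ j, 1 / (m j : ℝ)) *
      ∫⁻ z in domain m, F (radialProj m z) := by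
  rw [surfaceMeasure, lintegral_smul_measure, lintegral_map hF measurable_radialProj, smul_eq_mul]

/-- Pulling the weight back by the radial projection divides it by `psi ^ q`, `q = ∑ α_j / m_j`.
Since `degree m α - q = ∑ 1 / m_j`, the normalization of the measure cancels, and `degree m α`
lowers `Γ(degree + 1)` to `Γ(degree)`. -/
theorem lintegral_weight_surfaceMeasure (hn : 1 ≤ n) (hm : ∀ j, 1 ≤ m j) (α : Fin n → ℕ) :
    ∫⁻ w, ENNReal.ofReal (weight α w) ∂(surfaceMeasure m) = ENNReal.ofReal (moment m α) := by
  have hm0 : ∀ j, (0 : ℝ) < m j := fun j => by exact_mod_cast hm j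
  set q := ∑ j, (α j : ℝ) / m j with hq
  have hq0 : 0 ≤ q := Finset.sum_nonneg fun j _ => by positivity
  have hs : degree m α = q + ∑ j, 1 / (m j : ℝ) := by
    rw [degree, hq, ← Finset.sum_add_distrib]
    exact Finset.sum_congr rfl fun j _ => add_div _ _ _
  have hone : 0 < ∑ j, 1 / (m j : ℝ) :=
    Finset.sum_pos (fun j _ => by have := hm0 j; positivity) ⟨⟨0, hn⟩, Finset.mem_univ _⟩
  rw [lintegral_surfaceMeasure (continuous_weight α).measurable.ennreal_ofReal]
  have e : ∫⁻ z in domain m, ENNReal.ofReal (weight α (radialProj m z))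
      = ∫⁻ z in domain m, ENNReal.ofReal (weight α z) * ENNReal.ofReal (psi m z ^ (-q)) := by
    refine lintegral_congr_ae ?_
    filter_upwards [ae_restrict_of_ae (ae_psi_pos hn)] with z hz
    rw [weight_radialProj hm α hz, ENNReal.ofReal_mul (weight_nonneg α z)]
  have hdeg := degree_pos hn hm α
  have hGs := Gamma_pos_of_pos hdeg
  rw [e, lintegral_weight_mul_rpow hn hm α hq0 (by linarith), solidMoment_eq hn hm,
    ← ENNReal.ofReal_mul (div_nonneg hdeg.le (by linarith)),
    ← ENNReal.ofReal_mul (by positivity), hs, add_sub_cancel_left, ← hs, moment,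
    Gamma_add_one hdeg.ne']
  congr 1
  field_simp

end SurfaceMoments

end ComplexEllipsoid

namespace ComplexEllipsoid

/-! ### Rotation invariance and orthonormality of the monomials -/

section Orthogonality

variable {n : ℕ} {m : Fin n → ℕ}

/-- The monomial `z ^ α`. -/
noncomputable def mono (α : Fin n → ℕ) (z : Fin n → ℂ) : ℂ := ∏ j, z j ^ α j

theorem continuous_mono (α : Fin n → ℕ) : Continuous (mono α) := by
  unfold mono
  fun_prop

theorem norm_mono_sq (α : Fin n → ℕ) (z : Fin n → ℂ) : ‖mono α z‖ ^ 2 = weight α z := by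
  rw [mono, norm_prod, ← Finset.prod_pow]
  exact Finset.prod_congr rfl fun j _ => by rw [norm_pow, ← pow_mul, mul_comm]

theorem norm_mono_le_one (hm : ∀ j, 1 ≤ m j) (α : Fin n → ℕ) {z : Fin n → ℂ}
    (hz : psi m z ≤ 1) : ‖mono α z‖ ≤ 1 := by
  rw [mono, norm_prod]
  refine Finset.prod_le_one (fun j _ => norm_nonneg _) fun j _ => ?_
  rw [norm_pow]
  exact pow_le_one₀ (norm_nonneg _) (norm_coord_le_one hz hm j)

theorem isFiniteMeasure_surfaceMeasure (hn : 1 ≤ n) (hm : ∀ j, 1 ≤ m j) :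
    IsFiniteMeasure (surfaceMeasure m) := by
  refine ⟨?_⟩
  have h := lintegral_weight_surfaceMeasure hn hm 0
  simp only [weight, Pi.zero_apply, mul_zero, pow_zero, Finset.prod_const_one,
    ENNReal.ofReal_one, lintegral_one] at h
  rw [h]
  exact ENNReal.ofReal_lt_top

/-- The rotation of the coordinates. -/
noncomputable def rotate (u : Fin n → Circle) (z : Fin n → ℂ) : Fin n → ℂ := fun j => u j * z j

theorem continuous_rotate (u : Fin n → Circle) : Continuous (rotate u) := by
  unfold rotate
  fun_prop

theorem psi_rotate (u : Fin n → Circle) (z : Fin n → ℂ) : psi m (rotate u z) = psi m z := by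
  simp [psi, rotate, Circle.norm_coe]

theorem radialProj_rotate (u : Fin n → Circle) (z : Fin n → ℂ) :
    radialProj m (rotate u z) = rotate u (radialProj m z) := by
  ext j
  simp only [radialProj, psi_rotate, rotate]
  exact mul_smul_comm _ _ _ |>.symm

/-- Rotations preserve Lebesgue measure and the ellipsoid, and commute with the radial projection.
-/
theorem measurePreserving_rotate (u : Fin n → Circle) :
    MeasurePreserving (rotate u) (surfaceMeasure m) (surfaceMeasure m) := by
  have h1 : MeasurePreserving (rotate u) (volume : Measure (Fin n → ℂ)) volume :=
    volume_preserving_pi fun j => (rotation (u j)).measurePreserving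
  have h2 := h1.restrict_preimage (isOpen_domain (m := m)).measurableSet
  have h3 : rotate u ⁻¹' domain m = domain m := by
    ext z
    simp [domain, psi_rotate]
  rw [h3] at h2
  have hmeas := (continuous_rotate u).measurable
  refine ⟨hmeas, ?_⟩
  rw [surfaceMeasure, Measure.map_smul, Measure.map_map hmeas measurable_radialProj]
  congr 1
  have : rotate u ∘ radialProj m = radialProj m ∘ rotate u :=
    funext fun z => (radialProj_rotate u z).symm
  rw [this, ← Measure.map_map measurable_radialProj hmeas, h2.map_eq]

theorem mono_rotate (u : Fin n → Circle) (α : Fin n → ℕ) (z : Fin n → ℂ) :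
    mono α (rotate u z) = (∏ j, (u j : ℂ) ^ α j) * mono α z := by
  rw [mono, mono, ← Finset.prod_mul_distrib]
  exact Finset.prod_congr rfl fun j _ => mul_pow _ _ _

theorem integral_conj_mono_mul_mono {α β : Fin n → ℕ} (h : α ≠ β) :
    ∫ w, (starRingEnd ℂ) (mono α w) * mono β w ∂(surfaceMeasure m) = 0 := by
  obtain ⟨j, hj⟩ := Function.ne_iff.1 h
  have hd : (β j : ℝ) - α j ≠ 0 := by
    rw [sub_ne_zero]
    exact_mod_cast hj.symm
  -- Rotating the coordinate `j` by this angle multiplies the integrand by `exp (i (β_j - α_j) θ) =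
  -- -1`, so that the integral equals its opposite.
  set θ : ℝ := Real.pi / (β j - α j) with hθ
  set u : Fin n → Circle := fun i => if i = j then Circle.exp θ else 1 with hu
  have hprod : ∀ γ : Fin n → ℕ, ∏ i, (u i : ℂ) ^ γ i = Complex.exp (γ j * (θ * Complex.I)) := by
    intro γ
    rw [Finset.prod_eq_single j]
    · simp [hu, ← Complex.exp_nat_mul]
    · intro i _ hij
      simp [hu, hij]
    · simp
  have hcont : Continuous fun w : Fin n → ℂ => (starRingEnd ℂ) (mono α w) * mono β w :=
    (Complex.continuous_conj.comp (continuous_mono α)).mul (continuous_mono β)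
  have hinv : ∫ w, (starRingEnd ℂ) (mono α w) * mono β w ∂(surfaceMeasure m)
      = ∫ w, (starRingEnd ℂ) (mono α (rotate u w)) * mono β (rotate u w) ∂(surfaceMeasure m) := by
    have hmp := measurePreserving_rotate (m := m) u
    conv_lhs => rw [← hmp.map_eq]
    rw [integral_map hmp.aemeasurable hcont.aestronglyMeasurable]
  have hfac : ∀ w, (starRingEnd ℂ) (mono α (rotate u w)) * mono β (rotate u w)
      = -((starRingEnd ℂ) (mono α w) * mono β w) := by
    intro w
    have hexp : (starRingEnd ℂ) (Complex.exp (α j * (θ * Complex.I)))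
        * Complex.exp (β j * (θ * Complex.I)) = -1 := by
      rw [← Complex.exp_conj, ← Complex.exp_add, ← Complex.exp_pi_mul_I]
      congr 1
      simp only [map_mul, map_natCast, Complex.conj_ofReal, Complex.conj_I]
      have : ((β j : ℂ) - α j) * θ = Real.pi := by
        rw [hθ]
        push_cast
        rw [mul_div_cancel₀]
        exact_mod_cast hd
      linear_combination Complex.I * this
    rw [mono_rotate, mono_rotate, hprod, hprod, map_mul]
    linear_combination ((starRingEnd ℂ) (mono α w) * mono β w) * hexp
  simp only [hfac, integral_neg] at hinv
  exact self_eq_neg.1 hinv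

/-- The normalized monomial. -/
noncomputable def nmono (m α : Fin n → ℕ) (z : Fin n → ℂ) : ℂ :=
  ((√(moment m α))⁻¹ : ℝ) * mono α z

theorem continuous_nmono (α : Fin n → ℕ) : Continuous (nmono m α) :=
  continuous_const.mul (continuous_mono α)

theorem memLp_of_continuous (hn : 1 ≤ n) (hm : ∀ j, 1 ≤ m j) {F : (Fin n → ℂ) → ℂ}
    (hF : AEStronglyMeasurable F (surfaceMeasure m)) {C : ℝ} (hC : ∀ z, psi m z = 1 → ‖F z‖ ≤ C) :
    MemLp F 2 (surfaceMeasure m) := by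
  have := isFiniteMeasure_surfaceMeasure hn hm
  refine MemLp.of_bound hF C ?_
  filter_upwards [ae_surfaceMeasure hn hm] with w hw using hC w hw

theorem memLp_nmono (hn : 1 ≤ n) (hm : ∀ j, 1 ≤ m j) (α : Fin n → ℕ) :
    MemLp (nmono m α) 2 (surfaceMeasure m) := by
  have := isFiniteMeasure_surfaceMeasure hn hm
  refine memLp_of_continuous hn hm (continuous_nmono α).aestronglyMeasurable
    (C := ‖(((√(moment m α))⁻¹ : ℝ) : ℂ)‖) fun w hw => ?_
  rw [nmono, norm_mul]
  exact mul_le_of_le_one_right (norm_nonneg _) (norm_mono_le_one hm α hw.le)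

/-- The normalized monomials in `L²` of the boundary. -/
noncomputable def monoLp (hn : 1 ≤ n) (hm : ∀ j, 1 ≤ m j) (α : Fin n → ℕ) :
    Lp ℂ 2 (surfaceMeasure m) := (memLp_nmono hn hm α).toLp

theorem orthonormal_monoLp (hn : 1 ≤ n) (hm : ∀ j, 1 ≤ m j) :
    Orthonormal ℂ (monoLp hn hm) := by
  have hinner : ∀ α β, inner ℂ (monoLp hn hm α) (monoLp hn hm β)
      = ((√(moment m α))⁻¹ * (√(moment m β))⁻¹ : ℝ) *
        ∫ w, (starRingEnd ℂ) (mono α w) * mono β w ∂(surfaceMeasure m) := by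
    intro α β
    rw [L2.inner_def, ← integral_const_mul]
    refine integral_congr_ae ?_
    filter_upwards [(memLp_nmono hn hm α).coeFn_toLp, (memLp_nmono hn hm β).coeFn_toLp]
      with w h1 h2
    rw [monoLp, monoLp, h1, h2, RCLike.inner_apply', nmono, nmono, map_mul, Complex.conj_ofReal]
    push_cast
    ring
  rw [orthonormal_iff_ite]
  intro α β
  rw [hinner]
  split_ifs with h
  · subst h
    have h1 : ∀ w, (starRingEnd ℂ) (mono α w) * mono α w = ((weight α w : ℝ) : ℂ) := by
      intro w
      rw [← norm_mono_sq, mul_comm, Complex.mul_conj, Complex.normSq_eq_norm_sq]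
    have h2 : ∫ w, weight α w ∂(surfaceMeasure m) = moment m α := by
      rw [integral_eq_lintegral_of_nonneg_ae (Eventually.of_forall (weight_nonneg α))
        (continuous_weight α).aestronglyMeasurable, lintegral_weight_surfaceMeasure hn hm,
        ENNReal.toReal_ofReal (moment_pos hn hm α).le]
    simp only [h1]
    rw [integral_complex_ofReal, h2]
    have h3 := moment_pos hn hm α
    have h4 : (√(moment m α))⁻¹ * (√(moment m α))⁻¹ * moment m α = 1 := by
      rw [← mul_inv, Real.mul_self_sqrt h3.le, inv_mul_cancel₀ h3.ne']
    exact_mod_cast h4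
  · rw [integral_conj_mono_mul_mono h, mul_zero]

end Orthogonality

end ComplexEllipsoid

namespace ComplexEllipsoid

/-! ### Uniform polynomial approximation of dilates -/

section Polynomials

variable {n : ℕ} {m : Fin n → ℕ}

/-- The space of polynomial functions. -/
def monoSpan (n : ℕ) : Submodule ℂ ((Fin n → ℂ) → ℂ) := Submodule.span ℂ (Set.range mono)

/-- Expand the form on the standard basis: a choice `r` of basis indices contributes the monomial
whose exponents are the sizes of the fibres of `r`. -/
theorem multilinear_diag_mem_monoSpan {k : ℕ}
    (p : ContinuousMultilinearMap ℂ (fun _ : Fin k => (Fin n → ℂ)) ℂ) :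
    (fun w => p fun _ => w) ∈ monoSpan n := by
  classical
  have h : (fun w : Fin n → ℂ => p fun _ => w) = ∑ r : Fin k → Fin n,
      (p fun i => Pi.single (r i) (1 : ℂ)) •
        mono (fun j => (Finset.univ.filter fun i => r i = j).card) := by
    ext w
    have hw : (fun _ : Fin k => w)
        = fun _ => ∑ j : Fin n, w j • (Pi.single j (1 : ℂ) : Fin n → ℂ) := by
      ext i j
      simp [Finset.sum_apply, Pi.single_apply]
    conv_lhs => rw [hw]
    rw [ContinuousMultilinearMap.map_sum, Finset.sum_apply]
    refine Finset.sum_congr rfl fun r _ => ?_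
    rw [ContinuousMultilinearMap.map_smul_univ, Pi.smul_apply, smul_eq_mul, smul_eq_mul, mul_comm]
    congr 1
    rw [mono, ← Finset.prod_fiberwise' Finset.univ r]
    exact Finset.prod_congr rfl fun j _ => by rw [Finset.prod_const]
  rw [h]
  exact Submodule.sum_mem _ fun r _ => Submodule.smul_mem _ _ (Submodule.subset_span ⟨_, rfl⟩)

theorem psi_smul_le (hm : ∀ j, 1 ≤ m j) {c : ℂ} (hc : ‖c‖ ≤ 1) (w : Fin n → ℂ) :
    psi m (c • w) ≤ ‖c‖ ^ 2 * psi m w := by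
  rw [psi, psi, Finset.mul_sum]
  refine Finset.sum_le_sum fun j _ => ?_
  rw [Pi.smul_apply, norm_smul, mul_pow]
  refine mul_le_mul_of_nonneg_right ?_ (by positivity)
  exact pow_le_pow_of_le_one (norm_nonneg _) hc (by have := hm j; omega)

theorem smul_mem_domain (hm : ∀ j, 1 ≤ m j) {c : ℂ} (hc : ‖c‖ < 1) {w : Fin n → ℂ}
    (hw : psi m w ≤ 1) : c • w ∈ domain m := by
  have h := psi_smul_le hm hc.le w
  have h1 : ‖c‖ ^ 2 < 1 := by nlinarith [norm_nonneg c]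
  have h2 := psi_nonneg (m := m) w
  exact lt_of_le_of_lt h (by nlinarith [sq_nonneg ‖c‖])

theorem isCompact_psi_le_one (hm : ∀ j, 1 ≤ m j) : IsCompact {w : Fin n → ℂ | psi m w ≤ 1} := by
  refine Metric.isCompact_of_isClosed_isBounded (isClosed_le continuous_psi continuous_const) ?_
  refine Metric.isBounded_closedBall.subset (s := _) (t := Metric.closedBall 0 1) ?_
  intro z hz
  rw [mem_closedBall_zero_iff, pi_norm_le_iff_of_nonneg zero_le_one]
  exact norm_coord_le_one hz hm

/-- The dilates of a holomorphic function on the ellipsoid are uniformly approximated by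
polynomials. -/
theorem exists_monoSpan_approx (hm : ∀ j, 1 ≤ m j) {f : (Fin n → ℂ) → ℂ}
    (hf : DifferentiableOn ℂ f (domain m)) {ρ : ℝ} (hρ0 : 0 < ρ) (hρ1 : ρ < 1) {ε : ℝ}
    (hε : 0 < ε) :
    ∃ q ∈ monoSpan n, ∀ w, psi m w ≤ 1 → ‖f (ρ • w) - q w‖ ≤ ε := by
  have h0 : (0 : Fin n → ℂ) ∈ domain m := by
    change psi m 0 < 1
    rw [psi_zero hm]
    exact one_pos
  obtain ⟨p, hp⟩ := analyticAt_of_differentiableOn isOpen_domain hf h0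
  obtain ⟨r, hr, hr1⟩ := exists_between hρ1
  have hr0 : 0 < r := hρ0.trans hr
  lift r to NNReal using hr0.le
  obtain ⟨M, hM⟩ : ∃ M, ∀ w, psi m w ≤ 1 → ∀ c : ℂ, ‖c‖ ≤ r → ‖f (c • w)‖ ≤ M := by
    have hK : IsCompact ((fun p : ℂ × (Fin n → ℂ) => p.1 • p.2) ''
        (Metric.closedBall 0 r ×ˢ {w | psi m w ≤ 1})) :=
      ((isCompact_closedBall 0 r).prod (isCompact_psi_le_one hm)).image (by fun_prop)
    have hsub : ((fun p : ℂ × (Fin n → ℂ) => p.1 • p.2) ''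
        (Metric.closedBall 0 r ×ˢ {w | psi m w ≤ 1})) ⊆ domain m := by
      rintro _ ⟨⟨c, w⟩, ⟨hc, hw⟩, rfl⟩
      exact smul_mem_domain hm (lt_of_le_of_lt (by simpa using hc) hr1) hw
    obtain ⟨M, hM⟩ := hK.exists_bound_of_continuousOn (hf.continuousOn.mono hsub)
    exact ⟨M, fun w hw c hc => hM _ ⟨(c, w), ⟨by simpa using hc, hw⟩, rfl⟩⟩
  have hM0 : 0 ≤ M := (norm_nonneg _).trans (hM 0 (by rw [psi_zero hm]; exact zero_le_one) 0
    (by simp))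
  have hq : 0 ≤ ρ / r := by positivity
  have hq1 : ρ / r < 1 := (div_lt_one hr0).2 hr
  -- The Taylor series at `0` is only known to converge near `0`. Restricted to the complex line
  -- through `w` it is a one-variable Cauchy series, valid up to radius `r`; the bound `M` is common
  -- to all `w`, so the geometric ratio `ρ / r` is uniform.
  have key : ∀ w, psi m w ≤ 1 →
      HasSum (fun k => (ρ : ℂ) ^ k * p k fun _ => w) (f (ρ • w)) ∧
        ∀ k, ‖(ρ : ℂ) ^ k * p k fun _ => w‖ ≤ M * (ρ / r) ^ k := by
    intro w hw
    set L : ℂ →L[ℂ] (Fin n → ℂ) := (ContinuousLinearMap.id ℂ ℂ).smulRight w with hL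
    have hLapp : ∀ c, L c = c • w := fun c => by simp [hL]
    have hdiff : DifferentiableOn ℂ (f ∘ L) (Metric.closedBall 0 r) := by
      intro c hc
      have hmem : L c ∈ domain m := by
        rw [hLapp]
        exact smul_mem_domain hm (lt_of_le_of_lt (by simpa using hc) hr1) hw
      exact ((hf.differentiableAt (isOpen_domain.mem_nhds hmem)).comp c
        L.differentiableAt).differentiableWithinAt
    have hc := DifferentiableOn.hasFPowerSeriesOnBall hdiff (by exact_mod_cast hr0)
    have hp' : HasFPowerSeriesAt f p (L 0) := by rwa [map_zero]
    have hpL := hp'.compContinuousLinearMap (u := L)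
    -- Uniqueness of power series in one variable identifies the Cauchy coefficients with the
    -- homogeneous parts of `p`.
    have heq := hc.hasFPowerSeriesAt.eq_formalMultilinearSeries hpL
    have hval : ∀ k, cauchyPowerSeries (f ∘ L) 0 r k (fun _ => (ρ : ℂ))
        = (ρ : ℂ) ^ k * p k fun _ => w := by
      intro k
      have : cauchyPowerSeries (f ∘ L) 0 r = p.compContinuousLinearMap L := heq
      rw [this, FormalMultilinearSeries.compContinuousLinearMap_apply]
      have : (L ∘ fun _ : Fin k => (ρ : ℂ)) = fun _ => (ρ : ℂ) • w := funext fun _ => hLapp _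
      rw [this, ContinuousMultilinearMap.map_smul_univ (p k) (fun _ => (ρ : ℂ)) fun _ => w]
      simp
    constructor
    · have hρmem : (ρ : ℂ) ∈ Metric.eball (0 : ℂ) (r : ENNReal) := by
        rw [Metric.eball_coe, mem_ball_zero_iff, Complex.norm_real, Real.norm_of_nonneg hρ0.le]
        exact hr
      have h := hc.hasSum hρmem
      simp only [zero_add, Function.comp, hLapp] at h
      exact h.congr_fun fun k => (hval k).symm
    · intro k
      rw [← hval]
      have h1 : ‖cauchyPowerSeries (f ∘ L) 0 r k‖ ≤ M * ((r : ℝ)⁻¹) ^ k := by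
        refine (norm_cauchyPowerSeries_le _ _ _ _).trans ?_
        rw [abs_of_pos hr0]
        gcongr
        rw [inv_mul_le_iff₀ Real.two_pi_pos]
        have h2 : ∀ θ ∈ Set.Icc 0 (2 * Real.pi), ‖(f ∘ L) (circleMap 0 r θ)‖ ≤ M := by
          intro θ _
          simp only [Function.comp, hLapp]
          exact hM w hw _ (by simp [abs_of_pos hr0])
        have h3 : ContinuousOn (fun θ => ‖(f ∘ L) (circleMap 0 r θ)‖)
            (Set.uIcc 0 (2 * Real.pi)) := by
          refine (Continuous.norm ?_).continuousOn
          exact hdiff.continuousOn.comp_continuous (continuous_circleMap 0 r) fun θ => by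
            simp [abs_of_pos hr0]
        have h4 := intervalIntegral.integral_mono_on Real.two_pi_pos.le
          (h3.intervalIntegrable (μ := volume))
          intervalIntegrable_const h2
        simpa using h4
      calc _ ≤ ‖cauchyPowerSeries (f ∘ L) 0 r k‖ * ∏ _i : Fin k, ‖(ρ : ℂ)‖ :=
            ContinuousMultilinearMap.le_opNorm _ _
        _ ≤ (M * ((r : ℝ)⁻¹) ^ k) * ρ ^ k := by
            rw [Finset.prod_const, Finset.card_univ, Fintype.card_fin, Complex.norm_real,
              Real.norm_of_nonneg hρ0.le]
            gcongr
        _ = _ := by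
            rw [div_eq_mul_inv, mul_pow]
            ring
  obtain ⟨N, hN⟩ : ∃ N, M * (ρ / r) ^ N * (1 - ρ / r)⁻¹ ≤ ε := by
    have h1 : Tendsto (fun N => M * (ρ / r) ^ N * (1 - ρ / r)⁻¹) atTop
        (𝓝 (M * 0 * (1 - ρ / r)⁻¹)) :=
      ((tendsto_pow_atTop_nhds_zero_of_lt_one hq hq1).const_mul M).mul_const _
    rw [mul_zero, zero_mul] at h1
    exact (h1.eventually_le_const hε).exists
  refine ⟨∑ k ∈ Finset.range N, (ρ : ℂ) ^ k • fun w => p k fun _ => w,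
    Submodule.sum_mem _ fun k _ => Submodule.smul_mem _ _ (multilinear_diag_mem_monoSpan _), ?_⟩
  intro w hw
  obtain ⟨h1, h2⟩ := key w hw
  have h3 := (hasSum_nat_add_iff' N).2 h1
  have h4 : HasSum (fun k => M * (ρ / r) ^ N * (ρ / r) ^ k) (M * (ρ / r) ^ N * (1 - ρ / r)⁻¹) :=
    (hasSum_geometric_of_lt_one hq hq1).mul_left _
  have h5 := h3.norm_le_of_bounded h4 fun k => by
    refine (h2 (k + N)).trans (le_of_eq ?_)
    rw [pow_add]
    ring
  refine le_trans (le_of_eq ?_) (h5.trans hN)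
  rw [Finset.sum_apply]
  rfl

end Polynomials

end ComplexEllipsoid

namespace ComplexEllipsoid

/-! ### Summation of the monomial series as a Laplace integral -/

section KernelSum

open Real Set

theorem hasSum_pi_prod {n : ℕ} {a : Fin n → ℕ → ℝ} (ha : ∀ j k, 0 ≤ a j k) {S : Fin n → ℝ}
    (hS : ∀ j, HasSum (a j) (S j)) :
    HasSum (fun α : Fin n → ℕ => ∏ j, a j (α j)) (∏ j, S j) := by
  induction n with
  | zero =>
    simp
  | succ n ih =>
    have h := ih (a := fun j => a j.succ) (fun j k => ha _ _) fun j => hS j.succ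
    have h0 : 0 ≤ fun α : Fin n → ℕ => ∏ j : Fin n, a j.succ (α j) := fun α =>
      Finset.prod_nonneg fun j _ => ha _ _
    have h2 := Summable.mul_of_nonneg (hS 0).summable h.summable (ha 0) h0
    have h3 := (hS 0).mul h h2
    rw [Fin.prod_univ_succ]
    refine ((Fin.consEquiv fun _ => ℕ).hasSum_iff).1 (h3.congr_fun fun p => ?_)
    simp [Fin.prod_univ_succ, Fin.consEquiv]

variable {n : ℕ} {m : Fin n → ℕ}

/-- The Laplace integral of a product of Mittag-Leffler functions. -/
noncomputable def laplaceKernel (m : Fin n → ℕ) (x : Fin n → ℝ) : ℝ :=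
  ∫ τ in Ioi 0, (∏ j, mittag (m j) (x j * τ ^ (1 / (m j : ℝ)))) *
    (exp (-τ) * τ ^ (∑ j, 1 / (m j : ℝ) - 1))

/-- The Szegő kernel as a Laplace integral. -/
noncomputable def szegoFun (m : Fin n → ℕ) (z : Fin n → ℂ) : ℝ :=
  (∏ j, (m j : ℝ)) / (2 * π ^ n) * laplaceKernel m fun j => ‖z j‖ ^ 2

/-- The slack is divided into `card + 1` equal shares: one remains unused, which keeps the
inequality strict, and the empty set is covered. -/
theorem exists_lt_sum_lt {ι : Type*} (t : Finset ι) {a : ι → ℝ} {c : ℝ}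
    (h : ∑ j ∈ t, a j < c) : ∃ b : ι → ℝ, (∀ j, a j < b j) ∧ ∑ j ∈ t, b j < c := by
  refine ⟨fun j => a j + (c - ∑ j ∈ t, a j) / (t.card + 1), fun j => ?_, ?_⟩
  · have : 0 < (c - ∑ j ∈ t, a j) / (t.card + 1) := div_pos (by linarith) (by positivity)
    linarith
  · rw [Finset.sum_add_distrib, Finset.sum_const, nsmul_eq_mul]
    have h1 : (t.card : ℝ) * ((c - ∑ j ∈ t, a j) / (t.card + 1)) < c - ∑ j ∈ t, a j := by
      rw [mul_div_assoc', div_lt_iff₀ (by positivity)]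
      nlinarith
    linarith

theorem sum_inv_pos (hn : 1 ≤ n) (hm : ∀ j, 1 ≤ m j) : 0 < ∑ j, 1 / (m j : ℝ) :=
  Finset.sum_pos (fun j _ => by have := hm j; positivity) ⟨⟨0, hn⟩, Finset.mem_univ _⟩

/-- The hypothesis says precisely that the exponential rates of the factors add up to less than the
rate `1` of `exp (-τ)`. -/
theorem laplaceKernel_regular (hn : 1 ≤ n) (hm : ∀ j, 1 ≤ m j) {x : Fin n → ℝ}
    (hx : ∑ j, |x j| ^ m j < 1) :
    AnalyticAt ℝ (laplaceKernel m) x ∧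
      IntegrableOn (fun τ => (∏ j, mittag (m j) (x j * τ ^ (1 / (m j : ℝ)))) *
        (exp (-τ) * τ ^ (∑ j, 1 / (m j : ℝ) - 1))) (Ioi 0) := by
  obtain ⟨b, hb, hb1⟩ := exists_lt_sum_lt _ hx
  exact analyticAt_integral_prod Finset.univ
    (G := fun j (x : Fin n → ℝ) τ => mittag (m j) (x j * τ ^ (1 / (m j : ℝ))))
    (sum_inv_pos hn hm) hb1 fun j _ =>
    (uniformlyAnalyticAt_mittag (hm j) (hb j)).comp_analyticAt (φ := fun x : Fin n → ℝ => x j)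
      ((ContinuousLinearMap.proj (R := ℝ) (φ := fun _ : Fin n => ℝ) j).analyticAt x)

theorem analyticAt_norm_coord_sq (j : Fin n) (z : Fin n → ℂ) :
    AnalyticAt ℝ (fun z : Fin n → ℂ => ‖z j‖ ^ 2) z := by
  have hp : AnalyticAt ℝ (fun z : Fin n → ℂ => z j) z :=
    (ContinuousLinearMap.proj (R := ℝ) (φ := fun _ : Fin n => ℂ) j).analyticAt z
  have hre : AnalyticAt ℝ (fun z : Fin n → ℂ => (z j).re) z :=
    (Complex.reCLM.analyticAt _).comp hp
  have him : AnalyticAt ℝ (fun z : Fin n → ℂ => (z j).im) z :=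
    (Complex.imCLM.analyticAt _).comp hp
  refine ((hre.mul hre).add (him.mul him)).congr (Eventually.of_forall fun w => ?_)
  exact ((Complex.sq_norm (w j)).trans (Complex.normSq_apply (w j))).symm

theorem analyticAt_norm_sq (z : Fin n → ℂ) :
    AnalyticAt ℝ (fun (z : Fin n → ℂ) (j : Fin n) => ‖z j‖ ^ 2) z :=
  analyticAt_pi_iff.2 fun j => analyticAt_norm_coord_sq j z

theorem sum_abs_norm_sq (z : Fin n → ℂ) : ∑ j, |‖z j‖ ^ 2| ^ m j = psi m z :=
  Finset.sum_congr rfl fun j _ => by rw [abs_of_nonneg (by positivity), ← pow_mul]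

theorem continuousOn_szegoFun (hn : 1 ≤ n) (hm : ∀ j, 1 ≤ m j) :
    ContinuousOn (szegoFun m) (domain m) := by
  intro z hz
  have h := (laplaceKernel_regular hn hm (x := fun j => ‖z j‖ ^ 2)
    (by rw [sum_abs_norm_sq]; exact hz)).1
  have h2 : AnalyticAt ℝ (szegoFun m) z :=
    analyticAt_const.mul
      (h.comp (f := fun (z : Fin n → ℂ) (j : Fin n) => ‖z j‖ ^ 2) (analyticAt_norm_sq z))
  exact h2.continuousAt.continuousWithinAt

theorem norm_nmono_sq (hn : 1 ≤ n) (hm : ∀ j, 1 ≤ m j) (α : Fin n → ℕ) (z : Fin n → ℂ) :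
    ‖nmono m α z‖ ^ 2 = (∏ j, (m j : ℝ)) / (2 * π ^ n) *
      ((∏ j, (‖z j‖ ^ 2) ^ α j / Gamma ((α j + 1) / m j)) * Gamma (degree m α)) := by
  have h3 := moment_pos hn hm α
  rw [nmono, norm_mul, mul_pow, norm_mono_sq, Complex.norm_real, Real.norm_of_nonneg
    (by positivity), inv_pow, Real.sq_sqrt h3.le, moment, weight]
  have hG : ∀ j, Gamma (((α j : ℝ) + 1) / m j) ≠ 0 := fun j => (Gamma_arg_pos (hm j) (α j)).ne'
  have hm0 : ∀ j, (m j : ℝ) ≠ 0 := fun j => by have := hm j; positivity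
  have hP : ∏ j, Gamma (((α j : ℝ) + 1) / m j) ≠ 0 := Finset.prod_ne_zero_iff.2 fun j _ => hG j
  have hM : ∏ j, (m j : ℝ) ≠ 0 := Finset.prod_ne_zero_iff.2 fun j _ => hm0 j
  have hD := (Gamma_pos_of_pos (degree_pos hn hm α)).ne'
  simp only [Finset.prod_mul_distrib, Finset.prod_div_distrib, Finset.prod_const, Finset.card_univ,
    Fintype.card_fin, ← pow_mul]
  field_simp

/-- Write `Γ(degree m α)` as an integral; its power of `τ` distributes over the coordinates, so that
the sum over multi-indices becomes a product of Mittag-Leffler series. All terms are nonnegative and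
the Laplace integral bounds the partial sums, which allows the interchange. -/
theorem hasSum_nmono_sq (hn : 1 ≤ n) (hm : ∀ j, 1 ≤ m j) {z : Fin n → ℂ} (hz : z ∈ domain m) :
    HasSum (fun α : Fin n → ℕ => ‖nmono m α z‖ ^ 2) (szegoFun m z) := by
  simp only [norm_nmono_sq hn hm]
  refine HasSum.mul_left _ ?_
  set x : Fin n → ℝ := fun j => ‖z j‖ ^ 2 with hx
  have hx0 : ∀ j, 0 ≤ x j := fun j => by positivity
  have hint := (laplaceKernel_regular hn hm (x := x) (by rw [sum_abs_norm_sq]; exact hz)).2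
  set F : (Fin n → ℕ) → ℝ → ℝ := fun α τ =>
    (∏ j, (x j * τ ^ (1 / (m j : ℝ))) ^ α j / Gamma ((α j + 1) / m j)) *
      (exp (-τ) * τ ^ (∑ j, 1 / (m j : ℝ) - 1)) with hF
  have hG : ∀ (α : Fin n → ℕ) j, 0 ≤ Gamma (((α j : ℝ) + 1) / m j) := fun α j =>
    (Gamma_arg_pos (hm j) (α j)).le
  have hF0 : ∀ α, ∀ τ ∈ Ioi (0 : ℝ), 0 ≤ F α τ := fun α τ hτ => by
    have hτ : 0 < τ := hτ
    have h1 : 0 ≤ ∏ j, (x j * τ ^ (1 / (m j : ℝ))) ^ α j / Gamma ((α j + 1) / m j) :=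
      Finset.prod_nonneg fun j _ => by
        have := hG α j
        have := hx0 j
        positivity
    simp only [hF]
    positivity
  have hFe : ∀ α, ∀ τ ∈ Ioi (0 : ℝ), F α τ = (∏ j, x j ^ α j / Gamma ((α j + 1) / m j)) *
      (exp (-τ) * τ ^ (degree m α - 1)) := by
    intro α τ hτ
    have hτ : 0 < τ := hτ
    have h1 : ∏ j, (x j * τ ^ (1 / (m j : ℝ))) ^ α j / Gamma ((α j + 1) / m j)
        = (∏ j, x j ^ α j / Gamma ((α j + 1) / m j)) * τ ^ (∑ j, (α j : ℝ) / m j) := by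
      rw [rpow_sum_of_pos hτ, ← Finset.prod_mul_distrib]
      refine Finset.prod_congr rfl fun j _ => ?_
      rw [mul_pow, ← rpow_natCast (τ ^ (1 / (m j : ℝ))), ← rpow_mul hτ.le, one_div_mul_eq_div]
      ring
    have h2 : degree m α - 1 = ∑ j, (α j : ℝ) / m j + (∑ j, 1 / (m j : ℝ) - 1) := by
      rw [degree, ← add_sub_assoc, ← Finset.sum_add_distrib]
      congr 1
      exact Finset.sum_congr rfl fun j _ => add_div _ _ _
    simp only [hF]
    rw [h1, h2, rpow_add hτ]
    ring
  have hFi : ∀ α, IntegrableOn (F α) (Ioi 0) := fun α => by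
    have := (GammaIntegral_convergent (degree_pos hn hm α)).const_mul
      (∏ j, x j ^ α j / Gamma ((α j + 1) / m j))
    exact IntegrableOn.congr_fun this (fun τ hτ => (hFe α τ hτ).symm) measurableSet_Ioi
  have hFI : ∀ α, ∫ τ in Ioi 0, F α τ = (∏ j, x j ^ α j / Gamma ((α j + 1) / m j)) *
      Gamma (degree m α) := fun α => by
    rw [setIntegral_congr_fun measurableSet_Ioi (hFe α), integral_const_mul,
      ← Gamma_eq_integral (degree_pos hn hm α)]
  have hsum : ∀ τ ∈ Ioi (0 : ℝ), HasSum (fun α => F α τ)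
      ((∏ j, mittag (m j) (x j * τ ^ (1 / (m j : ℝ)))) *
        (exp (-τ) * τ ^ (∑ j, 1 / (m j : ℝ) - 1))) := by
    intro τ hτ
    have hτ : 0 < τ := hτ
    refine HasSum.mul_right _ ?_
    refine hasSum_pi_prod (a := fun j k => (x j * τ ^ (1 / (m j : ℝ))) ^ k / Gamma ((k + 1) / m j))
      (fun j k => ?_) fun j => hasSum_mittag (hm j) ?_
    · have := (Gamma_arg_pos (hm j) k).le
      have := hx0 j
      positivity
    · have := hx0 j
      positivity
  have hS : Summable fun α => ∫ τ in Ioi 0, ‖F α τ‖ := by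
    have hnorm : ∀ α, ∫ τ in Ioi 0, ‖F α τ‖ = ∫ τ in Ioi 0, F α τ := fun α =>
      setIntegral_congr_fun measurableSet_Ioi fun τ hτ => Real.norm_of_nonneg (hF0 α τ hτ)
    simp only [hnorm]
    refine summable_of_sum_le (c := laplaceKernel m x)
      (fun α => setIntegral_nonneg measurableSet_Ioi (hF0 α)) fun u => ?_
    rw [← integral_finsetSum _ fun α _ => hFi α]
    refine setIntegral_mono_on (integrable_finsetSum _ fun α _ => hFi α) hint measurableSet_Ioi ?_
    intro τ hτ
    exact sum_le_hasSum _ (fun α _ => hF0 α τ hτ) (hsum τ hτ)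
  have h := hasSum_integral_of_summable_integral_norm hFi hS
  simp only [hFI] at h
  rw [setIntegral_congr_fun measurableSet_Ioi fun τ hτ => (hsum τ hτ).tsum_eq] at h
  exact h

end KernelSum

end ComplexEllipsoid

namespace ComplexEllipsoid

/-! ### Orthonormal expansions in a closed subspace -/

section Parseval

variable {E : Type*} [NormedAddCommGroup E] [InnerProductSpace ℂ E]
  {ι : Type*} {v : ι → E}

theorem summable_smul_orthonormal [CompleteSpace E] (hv : Orthonormal ℂ v) {c : ι → ℂ}
    (hc : Summable fun i => ‖c i‖ ^ 2) : Summable fun i => c i • v i := by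
  have := (hv.orthogonalFamily.summable_iff_norm_sq_summable c).2 hc
  simpa using this

theorem inner_left_hasSum_smul (hv : Orthonormal ℂ v) {c : ι → ℂ} {x : E}
    (hx : HasSum (fun i => c i • v i) x) (i : ι) : inner ℂ (v i) x = c i := by
  classical
  have h := hx.mapL (innerSL ℂ (v i))
  simp only [innerSL_apply_apply, inner_smul_right, orthonormal_iff_ite.1 hv] at h
  refine h.unique ?_
  have := hasSum_ite_eq i (c i)
  refine this.congr_fun fun j => ?_
  by_cases hj : j = i
  · simp [hj]
  · simp [hj, Ne.symm hj]

/-- The expansion of a vector of a closed subspace along an orthonormal family which is complete in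
that subspace. -/
theorem hasSum_inner_smul [CompleteSpace E] (hv : Orthonormal ℂ v)
    {W : Submodule ℂ E} (hW : IsClosed (W : Set E))
    (hvW : ∀ i, v i ∈ W) (hcompl : ∀ g ∈ W, (∀ i, inner ℂ (v i) g = 0) → g = 0) {x : E}
    (hx : x ∈ W) : HasSum (fun i => inner ℂ (v i) x • v i) x := by
  have hs := (summable_smul_orthonormal hv (c := fun i => inner ℂ (v i) x)
    (hv.inner_products_summable x)).hasSum
  set y := ∑' i, inner ℂ (v i) x • v i
  have hy : y ∈ W := hW.mem_of_tendsto hs (Eventually.of_forall fun s =>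
    Submodule.sum_mem _ fun i _ => W.smul_mem _ (hvW i))
  have h0 : x - y = 0 := hcompl _ (W.sub_mem hx hy) fun i => by
    rw [inner_sub_right, inner_left_hasSum_smul hv hs, sub_self]
  rwa [← sub_eq_zero.1 h0] at hs

theorem hasSum_norm_inner_sq {x : E} (h : HasSum (fun i => inner ℂ (v i) x • v i) x) :
    HasSum (fun i => ‖inner ℂ (v i) x‖ ^ 2) (‖x‖ ^ 2) := by
  have h1 := h.mapL (innerSL ℂ x)
  simp only [innerSL_apply_apply, inner_smul_right, inner_self_eq_norm_sq_to_K] at h1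
  have h2 : ∀ i, inner ℂ (v i) x * inner ℂ x (v i) = ((‖inner ℂ (v i) x‖ ^ 2 : ℝ) : ℂ) := by
    intro i
    rw [← inner_conj_symm x (v i), Complex.mul_conj, Complex.normSq_eq_norm_sq]
  have h3 : HasSum (fun i => ((‖inner ℂ (v i) x‖ ^ 2 : ℝ) : ℂ)) ((‖x‖ ^ 2 : ℝ) : ℂ) := by
    refine (h1.congr_fun fun i => (h2 i).symm).trans_eq ?_
    push_cast
    rfl
  exact Complex.hasSum_ofReal.1 h3

end Parseval

/-! ### Boundary values lie in the closed span of the monomials -/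

section Hardy

variable {n : ℕ} {m : Fin n → ℕ}

/-- The closed span of the monomials in `L²` of the boundary. -/
noncomputable def hardySpace (hn : 1 ≤ n) (hm : ∀ j, 1 ≤ m j) :
    Submodule ℂ (Lp ℂ 2 (surfaceMeasure m)) :=
  (Submodule.span ℂ (Set.range (monoLp hn hm))).topologicalClosure

theorem isClosed_hardySpace (hn : 1 ≤ n) (hm : ∀ j, 1 ≤ m j) :
    IsClosed (hardySpace hn hm : Set (Lp ℂ 2 (surfaceMeasure m))) :=
  Submodule.isClosed_topologicalClosure _

theorem monoLp_mem (hn : 1 ≤ n) (hm : ∀ j, 1 ≤ m j) (α : Fin n → ℕ) :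
    monoLp hn hm α ∈ hardySpace hn hm :=
  Submodule.le_topologicalClosure _ (Submodule.subset_span ⟨α, rfl⟩)

theorem eq_zero_of_inner_monoLp (hn : 1 ≤ n) (hm : ∀ j, 1 ≤ m j)
    (g : Lp ℂ 2 (surfaceMeasure m)) (hg : g ∈ hardySpace hn hm)
    (h : ∀ α, inner ℂ (monoLp hn hm α) g = 0) : g = 0 := by
  have h1 : g ∈ (Submodule.span ℂ (Set.range (monoLp hn hm)))ᗮ := by
    rw [Submodule.mem_orthogonal]
    intro u hu
    induction hu using Submodule.span_induction with
    | mem x hx =>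
      obtain ⟨α, rfl⟩ := hx
      exact h α
    | zero => exact inner_zero_left _
    | add x y _ _ hx hy => rw [inner_add_left, hx, hy, add_zero]
    | smul a x _ hx => rw [inner_smul_left, hx, mul_zero]
  rw [← Submodule.orthogonal_closure] at h1
  exact inner_self_eq_zero.1 ((Submodule.mem_orthogonal _ _).1 h1 g hg)

/-- The vector which represents the evaluation at `z`. -/
noncomputable def evalVec (hn : 1 ≤ n) (hm : ∀ j, 1 ≤ m j) (z : Fin n → ℂ) :
    Lp ℂ 2 (surfaceMeasure m) :=
  ∑' α, (starRingEnd ℂ) (nmono m α z) • monoLp hn hm α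

theorem hasSum_evalVec (hn : 1 ≤ n) (hm : ∀ j, 1 ≤ m j) {z : Fin n → ℂ} (hz : z ∈ domain m) :
    HasSum (fun α => (starRingEnd ℂ) (nmono m α z) • monoLp hn hm α) (evalVec hn hm z) := by
  refine (summable_smul_orthonormal (orthonormal_monoLp hn hm) ?_).hasSum
  refine (hasSum_nmono_sq hn hm hz).summable.congr fun α => ?_
  rw [RCLike.norm_conj]

theorem evalVec_mem (hn : 1 ≤ n) (hm : ∀ j, 1 ≤ m j) {z : Fin n → ℂ} (hz : z ∈ domain m) :
    evalVec hn hm z ∈ hardySpace hn hm :=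
  (isClosed_hardySpace hn hm).mem_of_tendsto (hasSum_evalVec hn hm hz)
    (Eventually.of_forall fun _ => Submodule.sum_mem _ fun α _ =>
      Submodule.smul_mem _ _ (monoLp_mem hn hm α))

theorem inner_evalVec_monoLp (hn : 1 ≤ n) (hm : ∀ j, 1 ≤ m j)
    {z : Fin n → ℂ} (hz : z ∈ domain m) (α : Fin n → ℕ) :
    inner ℂ (evalVec hn hm z) (monoLp hn hm α) = nmono m α z := by
  rw [← inner_conj_symm, inner_left_hasSum_smul (orthonormal_monoLp hn hm)
    (hasSum_evalVec hn hm hz), Complex.conj_conj]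

theorem hasSum_monoLp (hn : 1 ≤ n) (hm : ∀ j, 1 ≤ m j)
    {g : Lp ℂ 2 (surfaceMeasure m)} (hg : g ∈ hardySpace hn hm) :
    HasSum (fun α => inner ℂ (monoLp hn hm α) g • monoLp hn hm α) g :=
  hasSum_inner_smul (orthonormal_monoLp hn hm) (isClosed_hardySpace hn hm) (monoLp_mem hn hm)
    (eq_zero_of_inner_monoLp hn hm) hg

/-- Parseval along the monomials. The left side involves no competing basis, which is the source of
the independence of the kernel from the basis. -/
theorem norm_evalVec_sq (hn : 1 ≤ n) (hm : ∀ j, 1 ≤ m j) {z : Fin n → ℂ} (hz : z ∈ domain m) :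
    ‖evalVec hn hm z‖ ^ 2 = szegoFun m z := by
  have h := hasSum_norm_inner_sq (hasSum_monoLp hn hm (evalVec_mem hn hm hz))
  refine h.unique ((hasSum_nmono_sq hn hm hz).congr_fun fun α => ?_)
  rw [← inner_evalVec_monoLp hn hm hz, norm_inner_symm]

theorem norm_evalVec (hn : 1 ≤ n) (hm : ∀ j, 1 ≤ m j) {z : Fin n → ℂ} (hz : z ∈ domain m) :
    ‖evalVec hn hm z‖ = √(szegoFun m z) := by
  rw [← norm_evalVec_sq hn hm hz, Real.sqrt_sq (norm_nonneg _)]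

/-- Links the two roles of a polynomial, a class in `L²` and a function inside, through the
reproducing property; both are linear, so monomials suffice. -/
theorem exists_hardySpace_of_monoSpan (hn : 1 ≤ n) (hm : ∀ j, 1 ≤ m j)
    {q : (Fin n → ℂ) → ℂ} (hq : q ∈ monoSpan n) :
    ∃ G ∈ hardySpace hn hm, G =ᵐ[surfaceMeasure m] q ∧
      ∀ z ∈ domain m, inner ℂ (evalVec hn hm z) G = q z := by
  induction hq using Submodule.span_induction with
  | mem q hq =>
    obtain ⟨α, rfl⟩ := hq
    have h0 := Real.sqrt_pos.2 (moment_pos hn hm α)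
    have hmono : ∀ z, ((√(moment m α) : ℝ) : ℂ) * nmono m α z = mono α z := by
      intro z
      rw [nmono, ← mul_assoc, ← Complex.ofReal_mul, mul_inv_cancel₀ h0.ne', Complex.ofReal_one,
        one_mul]
    refine ⟨((√(moment m α) : ℝ) : ℂ) • monoLp hn hm α,
      Submodule.smul_mem _ _ (monoLp_mem hn hm α), ?_, fun z hz => ?_⟩
    · filter_upwards [Lp.coeFn_smul ((√(moment m α) : ℝ) : ℂ) (monoLp hn hm α),
        (memLp_nmono hn hm α).coeFn_toLp] with w h1 h2
      rw [h1, Pi.smul_apply, monoLp, h2, smul_eq_mul, hmono]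
    · rw [inner_smul_right, inner_evalVec_monoLp hn hm hz, hmono]
  | zero =>
    exact ⟨0, Submodule.zero_mem _, Lp.coeFn_zero _ _ _, fun z _ => by simp⟩
  | add q q' _ _ hq hq' =>
    obtain ⟨G, hG, h1, h2⟩ := hq
    obtain ⟨G', hG', h1', h2'⟩ := hq'
    refine ⟨G + G', Submodule.add_mem _ hG hG', ?_, fun z hz => ?_⟩
    · exact (Lp.coeFn_add G G').trans (h1.add h1')
    · rw [inner_add_right, h2 z hz, h2' z hz]
      rfl
  | smul a q _ hq =>
    obtain ⟨G, hG, h1, h2⟩ := hq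
    refine ⟨a • G, Submodule.smul_mem _ _ hG, ?_, fun z hz => ?_⟩
    · exact (Lp.coeFn_smul a G).trans (h1.const_smul a)
    · rw [inner_smul_right, h2 z hz]
      rfl

theorem real_smul_mem_domain (hm : ∀ j, 1 ≤ m j) {ρ : ℝ} (h0 : 0 < ρ) (h1 : ρ < 1)
    {w : Fin n → ℂ} (hw : psi m w ≤ 1) : ρ • w ∈ domain m := by
  have := smul_mem_domain hm (c := (ρ : ℂ)) (by simpa [abs_of_pos h0] using h1) hw
  simpa using this

theorem aestronglyMeasurable_dilate (hn : 1 ≤ n) (hm : ∀ j, 1 ≤ m j)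
    {f : (Fin n → ℂ) → ℂ} (hf : ContinuousOn f (domain m)) {ρ : ℝ}
    (h0 : 0 < ρ) (h1 : ρ < 1) :
    AEStronglyMeasurable (fun w => f (ρ • w)) (surfaceMeasure m) := by
  have hmeas : MeasurableSet {w : Fin n → ℂ | psi m w ≤ 1} :=
    measurableSet_le measurable_psi measurable_const
  have h : ContinuousOn (fun w => f (ρ • w)) {w | psi m w ≤ 1} :=
    hf.comp (by fun_prop) fun w hw => real_smul_mem_domain hm h0 h1 hw
  have h2 := h.aestronglyMeasurable (μ := surfaceMeasure m) hmeas
  rwa [Measure.restrict_eq_self_of_ae_mem] at h2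
  filter_upwards [ae_surfaceMeasure hn hm] with w hw using le_of_eq hw

theorem eLpNorm_le_of_bound_boundary (hn : 1 ≤ n) (hm : ∀ j, 1 ≤ m j)
    {F : (Fin n → ℂ) → ℂ} {C : ℝ}
    (hC : ∀ w, psi m w = 1 → ‖F w‖ ≤ C) :
    eLpNorm F 2 (surfaceMeasure m)
      ≤ surfaceMeasure m Set.univ ^ (2 : ℝ≥0∞).toReal⁻¹ * ENNReal.ofReal C := by
  refine eLpNorm_le_of_ae_bound ?_
  filter_upwards [ae_surfaceMeasure hn hm] with w hw using hC w hw

theorem Ioo_mem_nhdsLT_one : ∀ᶠ ρ : ℝ in 𝓝[<] 1, 0 < ρ ∧ ρ < 1 := by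
  filter_upwards [Ioo_mem_nhdsLT (zero_lt_one (α := ℝ))] with ρ hρ using hρ

/-- Boundary values lie in the closed span of the monomials, and the function is recovered from
its boundary value. -/
theorem HasBoundaryValue.mem_and_eq (hn : 1 ≤ n) (hm : ∀ j, 1 ≤ m j)
    {f : (Fin n → ℂ) → ℂ} {g : Lp ℂ 2 (surfaceMeasure m)}
    (hf : HasBoundaryValue m f g) :
    g ∈ hardySpace hn hm ∧ ∀ z ∈ domain m, inner ℂ (evalVec hn hm z) g = f z := by
  have := isFiniteMeasure_surfaceMeasure hn hm
  -- The tolerance `1 - ρ` tends to `0` with the dilation, so these polynomials converge to `g` on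
  -- the boundary and to `f` inside. Outside `0 < ρ < 1` the value `0` is a dummy.
  have hq : ∀ ρ : ℝ, ∃ q ∈ monoSpan n, 0 < ρ → ρ < 1 → ∀ w, psi m w ≤ 1 →
      ‖f (ρ • w) - q w‖ ≤ 1 - ρ := by
    intro ρ
    by_cases h : 0 < ρ ∧ ρ < 1
    · obtain ⟨q, hq, h1⟩ := exists_monoSpan_approx hm hf.holomorphic h.1 h.2
        (sub_pos.2 h.2)
      exact ⟨q, hq, fun _ _ => h1⟩
    · exact ⟨0, Submodule.zero_mem _, fun h1 h2 => absurd ⟨h1, h2⟩ h⟩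
  choose q hqm hqa using hq
  choose G hGm hGe hGi using fun ρ => exists_hardySpace_of_monoSpan hn hm (hqm ρ)
  have hsmall : Tendsto (fun ρ : ℝ => 1 - ρ) (𝓝[<] 1) (𝓝 0) := by
    have : Tendsto (fun ρ : ℝ => 1 - ρ) (𝓝 1) (𝓝 (1 - 1)) := (continuous_const.sub
      continuous_id).tendsto 1
    rw [sub_self] at this
    exact this.mono_left nhdsWithin_le_nhds
  have hlim : Tendsto G (𝓝[<] 1) (𝓝 g) := by
    rw [Lp.tendsto_Lp_iff_tendsto_eLpNorm']
    have hC : surfaceMeasure m Set.univ ^ (2 : ℝ≥0∞).toReal⁻¹ ≠ ∞ :=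
      (ENNReal.rpow_lt_top_of_nonneg (by simp) (measure_ne_top _ _)).ne
    have h1 : Tendsto (fun ρ : ℝ => surfaceMeasure m Set.univ ^ (2 : ℝ≥0∞).toReal⁻¹ *
        ENNReal.ofReal (1 - ρ) + eLpNorm (fun w => f (ρ • w) - g w) 2 (surfaceMeasure m))
        (𝓝[<] 1) (𝓝 0) := by
      have h2 := ENNReal.tendsto_ofReal hsmall
      rw [ENNReal.ofReal_zero] at h2
      have h3 := (ENNReal.Tendsto.const_mul h2 (Or.inr hC)).add hf.tendsto
      simpa using h3
    refine tendsto_of_tendsto_of_tendsto_of_le_of_le' tendsto_const_nhds h1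
      (Eventually.of_forall fun _ => bot_le) ?_
    filter_upwards [Ioo_mem_nhdsLT_one] with ρ hρ
    have hfm := aestronglyMeasurable_dilate hn hm hf.holomorphic.continuousOn hρ.1 hρ.2
    have e : eLpNorm (⇑(G ρ) - ⇑g) 2 (surfaceMeasure m)
        = eLpNorm ((⇑(G ρ) - fun w => f (ρ • w)) + ((fun w => f (ρ • w)) - ⇑g)) 2
          (surfaceMeasure m) := by
      rw [sub_add_sub_cancel]
    rw [e]
    refine (eLpNorm_add_le ((Lp.aestronglyMeasurable _).sub hfm)
      (hfm.sub (Lp.aestronglyMeasurable _)) one_le_two).trans (add_le_add ?_ le_rfl)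
    have e2 : eLpNorm (⇑(G ρ) - fun w => f (ρ • w)) 2 (surfaceMeasure m)
        = eLpNorm (fun w => q ρ w - f (ρ • w)) 2 (surfaceMeasure m) := by
      refine eLpNorm_congr_ae ?_
      filter_upwards [hGe ρ] with w hw
      rw [Pi.sub_apply, hw]
    rw [e2]
    refine eLpNorm_le_of_bound_boundary hn hm fun w hw => ?_
    rw [norm_sub_rev]
    exact hqa ρ hρ.1 hρ.2 w hw.le
  refine ⟨(isClosed_hardySpace hn hm).mem_of_tendsto hlim (Eventually.of_forall hGm),
    fun z hz => ?_⟩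
  have h1 : Tendsto (fun ρ => inner ℂ (evalVec hn hm z) (G ρ)) (𝓝[<] 1)
      (𝓝 (inner ℂ (evalVec hn hm z) g)) := tendsto_const_nhds.inner hlim
  refine tendsto_nhds_unique h1 ?_
  have h2 : Tendsto (fun ρ : ℝ => f (ρ • z)) (𝓝[<] 1) (𝓝 (f z)) := by
    have hcz := hf.holomorphic.continuousOn.continuousAt (isOpen_domain.mem_nhds hz)
    have hsm : Tendsto (fun ρ : ℝ => ρ • z) (𝓝[<] 1) (𝓝 z) := by
      have : Tendsto (fun ρ : ℝ => ρ • z) (𝓝 1) (𝓝 ((1 : ℝ) • z)) :=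
        (Continuous.tendsto (by fun_prop) 1)
      rw [one_smul] at this
      exact this.mono_left nhdsWithin_le_nhds
    exact hcz.tendsto.comp hsm
  have h3 : Tendsto (fun ρ : ℝ => f (ρ • z) - q ρ z) (𝓝[<] 1) (𝓝 0) := by
    refine squeeze_zero_norm' ?_ hsmall
    filter_upwards [Ioo_mem_nhdsLT_one] with ρ hρ
    exact hqa ρ hρ.1 hρ.2 z (le_of_lt hz)
  have h4 := h2.sub h3
  simp only [sub_sub_cancel, sub_zero] at h4
  exact h4.congr fun ρ => (hGi ρ z hz).symm

end Hardy

end ComplexEllipsoid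

/-! ### Conversely, the closed span consists of boundary values; the Szegő kernel -/

namespace ComplexEllipsoid

theorem hasSum_norm_sq_of_hasSum_smul {E : Type*} [NormedAddCommGroup E] [InnerProductSpace ℂ E]
    {ι : Type*} {v : ι → E} (hv : Orthonormal ℂ v) {c : ι → ℂ} {x : E}
    (hx : HasSum (fun i => c i • v i) x) : HasSum (fun i => ‖c i‖ ^ 2) (‖x‖ ^ 2) := by
  have h : ∀ i, inner ℂ (v i) x = c i := inner_left_hasSum_smul hv hx
  have := hasSum_norm_inner_sq (v := v) (x := x) (by simpa only [h] using hx)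
  simpa only [h] using this

variable {n : ℕ} {m : Fin n → ℕ}

theorem differentiable_nmono (α : Fin n → ℕ) : Differentiable ℂ (nmono m α) := by
  unfold nmono mono
  fun_prop

theorem nmono_smul (α : Fin n → ℕ) (c : ℝ) (w : Fin n → ℂ) :
    nmono m α (c • w) = (c : ℂ) ^ (∑ j, α j) * nmono m α w := by
  simp only [nmono, mono, Pi.smul_apply, Complex.real_smul, mul_pow, Finset.prod_mul_distrib,
    Finset.prod_pow_eq_pow_sum]
  ring

/-- The error of the partial sums of the expansion along the monomials. -/
theorem norm_inner_evalVec_sub_le (hn : 1 ≤ n) (hm : ∀ j, 1 ≤ m j)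
    (g : Lp ℂ 2 (surfaceMeasure m)) (F : Finset (Fin n → ℕ)) {z : Fin n → ℂ} (hz : z ∈ domain m) :
    ‖inner ℂ (evalVec hn hm z) g - ∑ α ∈ F, inner ℂ (monoLp hn hm α) g * nmono m α z‖
      ≤ √(szegoFun m z) * ‖g - ∑ α ∈ F, inner ℂ (monoLp hn hm α) g • monoLp hn hm α‖ := by
  have e : ∑ α ∈ F, inner ℂ (monoLp hn hm α) g * nmono m α z
      = inner ℂ (evalVec hn hm z) (∑ α ∈ F, inner ℂ (monoLp hn hm α) g • monoLp hn hm α) := by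
    rw [inner_sum]
    refine Finset.sum_congr rfl fun α _ => ?_
    rw [inner_smul_right, inner_evalVec_monoLp hn hm hz]
  rw [e, ← inner_sub_right, ← norm_evalVec hn hm hz]
  exact norm_inner_le_norm _ _

theorem tendsto_norm_sub_partial (hn : 1 ≤ n) (hm : ∀ j, 1 ≤ m j)
    {g : Lp ℂ 2 (surfaceMeasure m)} (hg : g ∈ hardySpace hn hm) :
    Tendsto (fun F : Finset (Fin n → ℕ) =>
      ‖g - ∑ α ∈ F, inner ℂ (monoLp hn hm α) g • monoLp hn hm α‖) atTop (𝓝 0) := by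
  have h : Tendsto (fun F : Finset (Fin n → ℕ) =>
      ∑ α ∈ F, inner ℂ (monoLp hn hm α) g • monoLp hn hm α) atTop (𝓝 g) := hasSum_monoLp hn hm hg
  have := (tendsto_const_nhds (x := g)).sub h
  rw [sub_self] at this
  simpa using this.norm

/-- By Cauchy–Schwarz the error at `z` is at most `√(szegoFun m z)` times the `L²` tail, and
`szegoFun` is continuous, hence locally bounded. -/
theorem tendstoLocallyUniformlyOn_partial (hn : 1 ≤ n) (hm : ∀ j, 1 ≤ m j)
    {g : Lp ℂ 2 (surfaceMeasure m)} (hg : g ∈ hardySpace hn hm) :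
    TendstoLocallyUniformlyOn (fun (F : Finset (Fin n → ℕ)) z =>
        ∑ α ∈ F, inner ℂ (monoLp hn hm α) g * nmono m α z)
      (fun z => inner ℂ (evalVec hn hm z) g) atTop (domain m) := by
  rw [Metric.tendstoLocallyUniformlyOn_iff]
  intro ε hε x hx
  set C := √(szegoFun m x) + 1
  have hC : 0 < C := by positivity
  have hcont : ContinuousOn (fun z => √(szegoFun m z)) (domain m) :=
    (continuousOn_szegoFun hn hm).sqrt
  refine ⟨{z | √(szegoFun m z) < C} ∩ domain m, Filter.inter_mem
    ((hcont x hx).eventually (gt_mem_nhds (lt_add_one _))) self_mem_nhdsWithin, ?_⟩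
  filter_upwards [(tendsto_norm_sub_partial hn hm hg).eventually (gt_mem_nhds (div_pos hε hC))]
    with F hF z hz
  rw [dist_eq_norm]
  refine (norm_inner_evalVec_sub_le hn hm g F hz.2).trans_lt ?_
  calc _ ≤ C * ‖g - ∑ α ∈ F, inner ℂ (monoLp hn hm α) g • monoLp hn hm α‖ :=
        mul_le_mul_of_nonneg_right (le_of_lt hz.1) (norm_nonneg _)
    _ < C * (ε / C) := mul_lt_mul_of_pos_left hF hC
    _ = ε := mul_div_cancel₀ _ hC.ne'

/-- A locally uniform limit of polynomials is continuous, and holomorphic in each variable by the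
theorem of Weierstrass; Osgood's lemma gives joint holomorphy. -/
theorem differentiableOn_inner_evalVec (hn : 1 ≤ n) (hm : ∀ j, 1 ≤ m j)
    {g : Lp ℂ 2 (surfaceMeasure m)} (hg : g ∈ hardySpace hn hm) :
    DifferentiableOn ℂ (fun z => inner ℂ (evalVec hn hm z) g) (domain m) := by
  have hlim := tendstoLocallyUniformlyOn_partial hn hm hg
  have hdiff : ∀ F : Finset (Fin n → ℕ), Differentiable ℂ fun z =>
      ∑ α ∈ F, inner ℂ (monoLp hn hm α) g * nmono m α z := fun F =>
    Differentiable.fun_sum fun α _ => (differentiable_nmono α).const_mul _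
  have hc : ContinuousOn (fun z => inner ℂ (evalVec hn hm z) g) (domain m) :=
    hlim.continuousOn (Eventually.of_forall fun F => (hdiff F).continuous.continuousOn).frequently
  intro z hz
  refine (analyticAt_of_continuousOn_of_separately isOpen_domain hc (fun z hz i => ?_)
    hz).differentiableAt.differentiableWithinAt
  have hup : Differentiable ℂ fun x : ℂ => Function.update z i x :=
    fun x => (hasFDerivAt_update z x).differentiableAt
  set V : Set ℂ := (fun x : ℂ => Function.update z i x) ⁻¹' domain m
  have hV : IsOpen V := isOpen_domain.preimage hup.continuous
  have h2 := hlim.comp (t := V) (fun x : ℂ => Function.update z i x) (fun x hx => hx)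
    hup.continuous.continuousOn
  refine (h2.differentiableOn (Eventually.of_forall fun F => ?_) hV).differentiableAt
    (hV.mem_nhds ?_)
  · exact ((hdiff F).comp hup).differentiableOn
  · simpa [V] using hz

theorem exists_sqrt_szegoFun_smul_le (hn : 1 ≤ n) (hm : ∀ j, 1 ≤ m j) {ρ : ℝ} (h0 : 0 < ρ)
    (h1 : ρ < 1) : ∃ M : ℝ, 0 ≤ M ∧ ∀ w, psi m w ≤ 1 → √(szegoFun m (ρ • w)) ≤ M := by
  have hc : ContinuousOn (fun w : Fin n → ℂ => √(szegoFun m (ρ • w))) {w | psi m w ≤ 1} :=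
    ((continuousOn_szegoFun hn hm).comp (by fun_prop)
      fun w hw => real_smul_mem_domain hm h0 h1 hw).sqrt
  obtain ⟨M, hM⟩ := (isCompact_psi_le_one hm).bddAbove_image hc
  refine ⟨max M 0, le_max_right _ _, fun w hw => (hM ⟨w, hw, rfl⟩).trans (le_max_left _ _)⟩

/-- The dilates have the dilated expansion along the monomials. -/
theorem exists_dilate_hasSum (hn : 1 ≤ n) (hm : ∀ j, 1 ≤ m j)
    {g : Lp ℂ 2 (surfaceMeasure m)} (hg : g ∈ hardySpace hn hm) {ρ : ℝ} (h0 : 0 < ρ)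
    (h1 : ρ < 1) : ∃ G : Lp ℂ 2 (surfaceMeasure m),
      (G =ᵐ[surfaceMeasure m] fun w => inner ℂ (evalVec hn hm (ρ • w)) g) ∧
      HasSum (fun α => ((ρ : ℂ) ^ (∑ j, α j) * inner ℂ (monoLp hn hm α) g) • monoLp hn hm α) G := by
  have := isFiniteMeasure_surfaceMeasure hn hm
  obtain ⟨M, hM0, hM⟩ := exists_sqrt_szegoFun_smul_le hn hm h0 h1
  have hmeas := aestronglyMeasurable_dilate hn hm
    (differentiableOn_inner_evalVec hn hm hg).continuousOn h0 h1
  have hmem : MemLp (fun w => inner ℂ (evalVec hn hm (ρ • w)) g) 2 (surfaceMeasure m) := by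
    refine memLp_of_continuous hn hm hmeas (C := M * ‖g‖) fun w hw => ?_
    refine (norm_inner_le_norm _ _).trans (mul_le_mul_of_nonneg_right ?_ (norm_nonneg _))
    rw [norm_evalVec hn hm (real_smul_mem_domain hm h0 h1 hw.le)]
    exact hM w hw.le
  refine ⟨hmem.toLp, hmem.coeFn_toLp, ?_⟩
  rw [HasSum, SummationFilter.unconditional_filter, Lp.tendsto_Lp_iff_tendsto_eLpNorm']
  have hC : surfaceMeasure m Set.univ ^ (2 : ℝ≥0∞).toReal⁻¹ ≠ ∞ :=
    (ENNReal.rpow_lt_top_of_nonneg (by simp) (measure_ne_top _ _)).ne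
  have hlim : Tendsto (fun F : Finset (Fin n → ℕ) =>
      surfaceMeasure m Set.univ ^ (2 : ℝ≥0∞).toReal⁻¹ * ENNReal.ofReal
        (M * ‖g - ∑ α ∈ F, inner ℂ (monoLp hn hm α) g • monoLp hn hm α‖)) atTop (𝓝 0) := by
    have h2 := (tendsto_norm_sub_partial hn hm hg).const_mul M
    rw [mul_zero] at h2
    have h3 := ENNReal.tendsto_ofReal h2
    rw [ENNReal.ofReal_zero] at h3
    have h4 := ENNReal.Tendsto.const_mul h3 (Or.inr hC)
    simpa using h4
  refine tendsto_of_tendsto_of_tendsto_of_le_of_le tendsto_const_nhds hlim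
    (fun _ => bot_le) fun F => ?_
  have e : (⇑(∑ α ∈ F, ((ρ : ℂ) ^ (∑ j, α j) * inner ℂ (monoLp hn hm α) g) • monoLp hn hm α) -
      ⇑(hmem.toLp)) =ᵐ[surfaceMeasure m] fun w =>
        (∑ α ∈ F, inner ℂ (monoLp hn hm α) g * nmono m α (ρ • w)) -
          inner ℂ (evalVec hn hm (ρ • w)) g := by
    have h5 : ∀ᵐ w ∂(surfaceMeasure m), ∀ α ∈ F, monoLp hn hm α w = nmono m α w :=
      (ae_ball_iff F.countable_toSet).2 fun α _ => (memLp_nmono hn hm α).coeFn_toLp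
    have h6 : ∀ᵐ w ∂(surfaceMeasure m), ∀ α ∈ F,
        (((ρ : ℂ) ^ (∑ j, α j) * inner ℂ (monoLp hn hm α) g) • monoLp hn hm α :
          Lp ℂ 2 (surfaceMeasure m)) w
        = ((ρ : ℂ) ^ (∑ j, α j) * inner ℂ (monoLp hn hm α) g) • monoLp hn hm α w :=
      (ae_ball_iff F.countable_toSet).2 fun α _ => Lp.coeFn_smul _ _
    filter_upwards [h5, h6, hmem.coeFn_toLp, Lp.coeFn_finsetSum (p := 2) F fun α =>
      ((ρ : ℂ) ^ (∑ j, α j) * inner ℂ (monoLp hn hm α) g) • monoLp hn hm α] with w h5 h6 h7 h8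
    rw [Pi.sub_apply, h7, h8, Finset.sum_apply]
    congr 1
    refine Finset.sum_congr rfl fun α hα => ?_
    rw [h6 α hα, h5 α hα, nmono_smul, smul_eq_mul]
    ring
  rw [eLpNorm_congr_ae e]
  refine eLpNorm_le_of_bound_boundary hn hm fun w hw => ?_
  rw [norm_sub_rev]
  refine (norm_inner_evalVec_sub_le hn hm g F (real_smul_mem_domain hm h0 h1 hw.le)).trans ?_
  exact mul_le_mul_of_nonneg_right (hM w hw.le) (norm_nonneg _)

/-- Every vector of the Hardy space is a boundary value. -/
theorem hasBoundaryValue_inner_evalVec (hn : 1 ≤ n) (hm : ∀ j, 1 ≤ m j)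
    {g : Lp ℂ 2 (surfaceMeasure m)} (hg : g ∈ hardySpace hn hm) :
    HasBoundaryValue m (fun z => inner ℂ (evalVec hn hm z) g) g := by
  refine ⟨differentiableOn_inner_evalVec hn hm hg, ?_⟩
  have hsum := hasSum_norm_sq_of_hasSum_smul (orthonormal_monoLp hn hm) (hasSum_monoLp hn hm hg)
  -- Dilation by `ρ` multiplies the coefficient of `α` by `ρ ^ |α|`, so this is the squared `L²`
  -- distance from the dilate to `g`; the squared coefficients of `g` dominate it.
  have key : Tendsto (fun ρ : ℝ => ∑' α : Fin n → ℕ,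
      ‖((ρ : ℂ) ^ (∑ j, α j) - 1) * inner ℂ (monoLp hn hm α) g‖ ^ 2) (𝓝[<] 1)
      (𝓝 (∑' _ : Fin n → ℕ, (0 : ℝ))) := by
    refine tendsto_tsum_of_dominated_convergence hsum.summable (fun α => ?_) ?_
    · have h : Continuous fun ρ : ℝ =>
          ‖((ρ : ℂ) ^ (∑ j, α j) - 1) * inner ℂ (monoLp hn hm α) g‖ ^ 2 := by fun_prop
      have h2 := h.tendsto 1
      simp only [Complex.ofReal_one, one_pow, sub_self, zero_mul, norm_zero, ne_eq,
        OfNat.ofNat_ne_zero, not_false_eq_true, zero_pow] at h2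
      exact h2.mono_left nhdsWithin_le_nhds
    · filter_upwards [Ioo_mem_nhdsLT_one] with ρ hρ α
      rw [Real.norm_of_nonneg (by positivity), norm_mul, mul_pow]
      refine mul_le_of_le_one_left (by positivity) (pow_le_one₀ (norm_nonneg _) ?_)
      have h1 : ρ ^ (∑ j, α j) ≤ 1 := pow_le_one₀ hρ.1.le hρ.2.le
      have h2 : 0 ≤ ρ ^ (∑ j, α j) := pow_nonneg hρ.1.le _
      have e : (ρ : ℂ) ^ (∑ j, α j) - 1 = ((ρ ^ (∑ j, α j) - 1 : ℝ) : ℂ) := by push_cast; rfl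
      rw [e, Complex.norm_real, Real.norm_eq_abs, abs_le]
      constructor <;> linarith
  rw [tsum_zero] at key
  have key2 := ENNReal.tendsto_ofReal key.sqrt
  rw [Real.sqrt_zero, ENNReal.ofReal_zero] at key2
  refine key2.congr' ?_
  filter_upwards [Ioo_mem_nhdsLT_one] with ρ hρ
  obtain ⟨G, hG, hGs⟩ := exists_dilate_hasSum hn hm hg hρ.1 hρ.2
  have h3 := hGs.sub (hasSum_monoLp hn hm hg)
  simp only [← sub_smul, ← sub_one_mul] at h3
  rw [(hasSum_norm_sq_of_hasSum_smul (orthonormal_monoLp hn hm) h3).tsum_eq,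
    Real.sqrt_sq (norm_nonneg _), ofReal_norm, Lp.enorm_def]
  refine eLpNorm_congr_ae ?_
  filter_upwards [hG, Lp.coeFn_sub G g] with w h4 h5
  rw [h5, Pi.sub_apply, h4]

theorem isSzegoKernel_szegoFun (hn : 1 ≤ n) (hm : ∀ j, 1 ≤ m j) :
    IsSzegoKernel m (szegoFun m) := by
  constructor
  · refine ⟨Fin n → ℕ, fun α z => inner ℂ (evalVec hn hm z) (monoLp hn hm α), monoLp hn hm,
      fun α => hasBoundaryValue_inner_evalVec hn hm (monoLp_mem hn hm α),
      orthonormal_monoLp hn hm, fun f g hf hg => ?_⟩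
    exact eq_zero_of_inner_monoLp hn hm g (HasBoundaryValue.mem_and_eq hn hm hf).1 hg
  · rintro ι φ ⟨b, hb, hbo, hbc⟩ z hz
    -- Completeness of `φ` is a statement about functions with boundary values. It applies to every
    -- vector of `hardySpace` because each one is such a boundary value; Parseval for `evalVec` in
    -- the basis `b` then gives the sum.
    have h := hasSum_norm_inner_sq (hasSum_inner_smul hbo (isClosed_hardySpace hn hm)
      (fun i => (HasBoundaryValue.mem_and_eq hn hm (hb i)).1)
      (fun g hg => hbc _ g (hasBoundaryValue_inner_evalVec hn hm hg)) (evalVec_mem hn hm hz))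
    rw [norm_evalVec_sq hn hm hz] at h
    refine h.congr_fun fun i => ?_
    rw [← (HasBoundaryValue.mem_and_eq hn hm (hb i)).2 z hz, norm_inner_symm]

end ComplexEllipsoid

namespace ComplexEllipsoid

/-! ### Boundary points and the index sets -/

section BoundaryGeometry

variable {n : ℕ} {m : Fin n → ℕ} {z0 : Fin n → ℂ}

theorem psi_eq_one_of_mem_frontier {z : Fin n → ℂ} (hz : z ∈ frontier (domain m)) :
    psi m z = 1 := by
  rw [isOpen_domain.frontier_eq] at hz
  refine le_antisymm ?_ (not_lt.1 hz.2)
  exact closure_minimal (t := {z : Fin n → ℂ | psi m z ≤ 1}) (s := domain m)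
    (fun z (hz : psi m z < 1) => hz.le)
    (isClosed_le continuous_psi continuous_const) hz.1

theorem mem_setQ_iff {j : Fin n} : j ∈ setQ m z0 ↔ j ∉ setP m z0 := by
  simp only [setQ, setP, Finset.mem_filter, Finset.mem_univ, true_and]
  tauto

theorem setQ_eq_compl : setQ m z0 = (setP m z0)ᶜ := by
  ext j
  rw [mem_setQ_iff, Finset.mem_compl]

theorem exponent_pos (hn : 1 ≤ n) (hm : ∀ j, 1 ≤ m j) : 0 < exponent m z0 := by
  have h : ∀ j : Fin n, 0 < 1 / (m j : ℝ) := fun j => by have := hm j; positivity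
  have h1 : 0 ≤ ∑ j ∈ setP m z0, 1 / (m j : ℝ) := Finset.sum_nonneg fun j _ => (h j).le
  have h2 : (0 : ℝ) ≤ (setQ m z0).card := Nat.cast_nonneg _
  rw [exponent]
  by_cases hP : (⟨0, hn⟩ : Fin n) ∈ setP m z0
  · have := Finset.sum_pos (fun j _ => h j) ⟨_, hP⟩
    linarith
  · have h3 : 0 < (setQ m z0).card := Finset.card_pos.2 ⟨_, mem_setQ_iff.2 hP⟩
    have : (0 : ℝ) < (setQ m z0).card := by exact_mod_cast h3
    linarith

end BoundaryGeometry

/-! ### The angular factor: analyticity, positivity and blow-up -/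

section SimplexFunction

open Real Set

variable {n : ℕ} {m : Fin n → ℕ} {z0 : Fin n → ℂ}

/-- The Laplace integral in the angular variables. -/
noncomputable def angularIntegral (m : Fin n → ℕ) (z0 : Fin n → ℂ) (t : setP m z0 → ℝ) : ℝ :=
  ∫ σ in Ioi 0, (∏ j : setP m z0, mittag (m j) (t j ^ 2 * σ ^ (1 / (m j : ℝ)))) *
    (exp (-σ) * σ ^ (exponent m z0 - 1))

/-- The factor of the singular term which depends on the angular variables. -/
noncomputable def simplexFun (m : Fin n → ℕ) (z0 : Fin n → ℂ) (t : setP m z0 → ℝ) : ℝ :=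
  (∏ j ∈ setP m z0, (m j : ℝ)) / ((n - 1).factorial : ℝ) *
    ((1 - ∑ j, t j ^ (2 * m j)) ^ exponent m z0 * angularIntegral m z0 t)

/-- The bound on `∑ t_j ^ (2 m_j)` is the convergence condition. The variables enter through `t_j ^
2`, in which the factors are analytic at `0` too, so analyticity extends across the faces `t_j = 0`.
-/
theorem angularIntegral_regular (hn : 1 ≤ n) (hm : ∀ j, 1 ≤ m j) {t : setP m z0 → ℝ}
    (ht : t ∈ simplex m z0) : AnalyticAt ℝ (angularIntegral m z0) t ∧
      IntegrableOn (fun σ => (∏ j : setP m z0, mittag (m j) (t j ^ 2 * σ ^ (1 / (m j : ℝ)))) *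
        (exp (-σ) * σ ^ (exponent m z0 - 1))) (Ioi 0) := by
  obtain ⟨b, hb, hb1⟩ := exists_lt_sum_lt _ ht.2
  refine analyticAt_integral_prod (Finset.univ : Finset (setP m z0))
    (G := fun j (t : setP m z0 → ℝ) σ => mittag (m j) (t j ^ 2 * σ ^ (1 / (m j : ℝ))))
    (exponent_pos hn hm) hb1 fun j _ => ?_
  refine (uniformlyAnalyticAt_mittag (hm j) (x0 := t j ^ 2) ?_).comp_analyticAt
    (φ := fun t : setP m z0 → ℝ => t j ^ 2)
    (((ContinuousLinearMap.proj (R := ℝ) (φ := fun _ : setP m z0 => ℝ) j).analyticAt t).pow 2)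
  rw [abs_of_nonneg (sq_nonneg _), ← pow_mul]
  exact hb j

theorem analyticAt_rpow_const {x : ℝ} (hx : 0 < x) (e : ℝ) :
    AnalyticAt ℝ (fun y : ℝ => y ^ e) x := by
  refine ((analyticAt_log hx).mul (analyticAt_const (v := e))).rexp.congr ?_
  filter_upwards [lt_mem_nhds hx] with y hy
  exact (rpow_def_of_pos hy e).symm

theorem analyticOnNhd_simplexFun (hn : 1 ≤ n) (hm : ∀ j, 1 ≤ m j) :
    AnalyticOnNhd ℝ (simplexFun m z0) (simplex m z0) := by
  intro t ht
  have hs : AnalyticAt ℝ (fun t : setP m z0 → ℝ => 1 - ∑ j, t j ^ (2 * m j)) t := by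
    refine analyticAt_const.sub (Finset.analyticAt_fun_sum _ fun j _ => ?_)
    exact ((ContinuousLinearMap.proj (R := ℝ) (φ := fun _ : setP m z0 => ℝ) j).analyticAt t).pow _
  have hpos : 0 < 1 - ∑ j, t j ^ (2 * m j) := sub_pos.2 ht.2
  refine analyticAt_const.mul (AnalyticAt.mul ?_ (angularIntegral_regular hn hm ht).1)
  exact (analyticAt_rpow_const hpos _).comp
    (f := fun t : setP m z0 → ℝ => 1 - ∑ j, t j ^ (2 * m j)) hs

/-- A lower bound of the angular integral from lower bounds of the factors. -/
theorem le_angularIntegral (hn : 1 ≤ n) (hm : ∀ j, 1 ≤ m j) {t : setP m z0 → ℝ}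
    (ht : t ∈ simplex m z0) {c γ : setP m z0 → ℝ} (hc : ∀ j, 0 ≤ c j) (hγ : ∀ j, 0 ≤ γ j)
    (h : ∀ j, ∀ σ : ℝ, 0 < σ → c j * σ ^ γ j * exp (t j ^ (2 * m j) * σ)
      ≤ mittag (m j) (t j ^ 2 * σ ^ (1 / (m j : ℝ)))) :
    (∏ j, c j) * (Gamma (exponent m z0 + ∑ j, γ j) *
      (1 - ∑ j, t j ^ (2 * m j)) ^ (-(exponent m z0 + ∑ j, γ j))) ≤ angularIntegral m z0 t := by
  have hD : 0 < 1 - ∑ j, t j ^ (2 * m j) := sub_pos.2 ht.2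
  set D := 1 - ∑ j, t j ^ (2 * m j) with hDdef
  have hp : 0 < exponent m z0 + ∑ j, γ j :=
    add_pos_of_pos_of_nonneg (exponent_pos hn hm) (Finset.sum_nonneg fun j _ => hγ j)
  -- The exponentials of the lower bounds combine with `exp (-σ)` to the rate `D`, leaving a pure
  -- Gamma integral.
  have e := integral_rpow_mul_exp_neg_mul_Ioi hp hD
  rw [one_div, inv_rpow hD.le, ← rpow_neg hD.le, mul_comm] at e
  rw [← e, ← integral_const_mul]
  refine integral_mono_of_nonneg ?_ (angularIntegral_regular hn hm ht).2 ?_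
  · filter_upwards [ae_restrict_mem measurableSet_Ioi] with σ hσ
    have hσ : 0 < σ := hσ
    exact mul_nonneg (Finset.prod_nonneg fun j _ => hc j) (by positivity)
  · filter_upwards [ae_restrict_mem measurableSet_Ioi] with σ hσ
    have hσ : 0 < σ := hσ
    have e2 : (∏ j, c j) * (σ ^ (exponent m z0 + ∑ j, γ j - 1) * exp (-(D * σ)))
        = (∏ j, c j * σ ^ γ j * exp (t j ^ (2 * m j) * σ)) *
          (exp (-σ) * σ ^ (exponent m z0 - 1)) := by
      rw [Finset.prod_mul_distrib, Finset.prod_mul_distrib, ← rpow_sum_of_pos hσ, ← exp_sum,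
        ← Finset.sum_mul, show exponent m z0 + ∑ j, γ j - 1
          = ∑ j, γ j + (exponent m z0 - 1) by ring, rpow_add hσ,
        show -(D * σ) = (∑ j, t j ^ (2 * m j)) * σ + -σ by rw [hDdef]; ring, exp_add]
      ring
    rw [e2]
    refine mul_le_mul_of_nonneg_right (Finset.prod_le_prod (fun j _ => ?_) fun j _ => h j σ hσ)
      (by positivity)
    have := hc j
    positivity

theorem exp_le_mittag_factor {k : ℕ} (hk : 1 ≤ k) {c : ℝ}
    (hc : ∀ u, 0 ≤ u → c * exp (u ^ k) ≤ mittag k u) {t σ : ℝ} (hσ : 0 < σ) :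
    c * σ ^ (0 : ℝ) * exp (t ^ (2 * k) * σ) ≤ mittag k (t ^ 2 * σ ^ (1 / (k : ℝ))) := by
  have := hc (t ^ 2 * σ ^ (1 / (k : ℝ))) (by positivity)
  rw [mul_pow, rpow_inv_pow hk hσ.le, ← pow_mul] at this
  rwa [rpow_zero, mul_one]

theorem mittagMain_mul_rpow {k : ℕ} (hk : 1 ≤ k) {x τ : ℝ} (hτ : 0 < τ) :
    mittagMain k (x * τ ^ (1 / (k : ℝ)))
      = k * x ^ (k - 1) * τ ^ (1 - 1 / (k : ℝ)) * exp (x ^ k * τ) := by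
  have hk0 : (k : ℝ) ≠ 0 := by positivity
  rw [mittagMain, mul_pow, mul_pow, rpow_inv_pow hk hτ.le, ← rpow_natCast (τ ^ (1 / (k : ℝ))),
    ← rpow_mul hτ.le, Nat.cast_sub hk, Nat.cast_one,
    show 1 / (k : ℝ) * (k - 1) = 1 - 1 / (k : ℝ) by field_simp]
  ring

theorem simplexFun_pos (hn : 1 ≤ n) (hm : ∀ j, 1 ≤ m j) {t : setP m z0 → ℝ}
    (ht : t ∈ simplex m z0) : 0 < simplexFun m z0 t := by
  have hD : 0 < 1 - ∑ j, t j ^ (2 * m j) := sub_pos.2 ht.2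
  choose c hc0 hc using fun j : setP m z0 => exists_mul_exp_le_mittag (hm j)
  have h := le_angularIntegral hn hm ht (c := c) (γ := fun _ => 0) (fun j => (hc0 j).le)
    (fun _ => le_rfl) fun j σ hσ => exp_le_mittag_factor (hm j) (hc j) hσ
  simp only [Finset.sum_const_zero, add_zero] at h
  have h1 : 0 < angularIntegral m z0 t := lt_of_lt_of_le (mul_pos
    (Finset.prod_pos fun j _ => hc0 j)
    (mul_pos (Gamma_pos_of_pos (exponent_pos hn hm)) (rpow_pos_of_pos hD _))) h
  have h2 : 0 < ∏ j ∈ setP m z0, (m j : ℝ) := Finset.prod_pos fun j _ => by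
    have := hm j
    positivity
  exact mul_pos (div_pos h2 (by positivity)) (mul_pos (rpow_pos_of_pos hD _) h1)

theorem simplexFun_eq_one (hn : 1 ≤ n) (hP : setP m z0 = ∅) (t : setP m z0 → ℝ) :
    simplexFun m z0 t = 1 := by
  have hE : IsEmpty (setP m z0) := by
    rw [hP]
    infer_instance
  have he : exponent m z0 = n := by
    rw [exponent, setQ_eq_compl, hP, Finset.sum_empty, add_zero, Finset.compl_empty,
      Finset.card_univ, Fintype.card_fin]
  have hG : angularIntegral m z0 t = ((n - 1).factorial : ℝ) := by
    have : angularIntegral m z0 t = ∫ σ in Ioi 0, exp (-σ) * σ ^ ((n : ℝ) - 1) := by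
      rw [angularIntegral, he]
      simp only [Finset.univ_eq_empty, Finset.prod_empty, one_mul]
    rw [this, ← Gamma_eq_integral (by exact_mod_cast hn), ← Gamma_nat_eq_factorial]
    congr 1
    push_cast [Nat.cast_sub hn]
    ring
  have hf : ((n - 1).factorial : ℝ) ≠ 0 := by positivity
  have hprod : ∏ j ∈ setP m z0, (m j : ℝ) = 1 := by rw [hP, Finset.prod_empty]
  rw [simplexFun, hG, hprod]
  simp only [Finset.univ_eq_empty, Finset.sum_empty, sub_zero, one_rpow, one_mul]
  exact one_div_mul_cancel hf

/-- Near the limit point some `t i` stays positive. The main part of that factor is used as lower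
bound, the plain exponential for the others: the angular integral is at least a multiple of `D ^
(-(e + 1 - 1 / m i))`, while `simplexFun` multiplies it only by `D ^ e`, `D = 1 - ∑ t_j ^ (2 m_j)`.
-/
theorem tendsto_simplexFun (hn : 1 ≤ n) (hm : ∀ j, 1 ≤ m j) {t0 : setP m z0 → ℝ}
    (ht0 : t0 ∈ closure (simplex m z0) \ simplex m z0) :
    Tendsto (simplexFun m z0) (𝓝[simplex m z0] t0) atTop := by
  have hcont : Continuous fun t : setP m z0 → ℝ => ∑ j, t j ^ (2 * m j) := by fun_prop
  have hnn : ∀ j, 0 ≤ t0 j := fun j =>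
    closure_minimal (t := {t : setP m z0 → ℝ | 0 ≤ t j}) (fun t ht => ht.1 j)
      (isClosed_le continuous_const (continuous_apply j)) ht0.1
  have hsum : ∑ j, t0 j ^ (2 * m j) = 1 := by
    refine le_antisymm ?_ (not_lt.1 fun h => ht0.2 ⟨hnn, h⟩)
    exact closure_minimal (t := {t : setP m z0 → ℝ | ∑ j, t j ^ (2 * m j) ≤ 1})
      (fun t ht => le_of_lt ht.2) (isClosed_le hcont continuous_const) ht0.1
  obtain ⟨i, hi⟩ : ∃ i, 0 < t0 i := by
    by_contra! h
    have : ∑ j, t0 j ^ (2 * m j) = 0 := Finset.sum_eq_zero fun j _ => by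
      rw [le_antisymm (h j) (hnn j)]
      exact zero_pow (by have := hm j; omega)
    rw [hsum] at this
    exact one_ne_zero this
  have hmi : 2 ≤ m i := by
    have h1 := (Finset.mem_filter.1 i.2).2.2
    have h2 := hm i
    omega
  have hmi' : (2 : ℝ) ≤ m i := by exact_mod_cast hmi
  have hγ : 0 < 1 - 1 / (m i : ℝ) := by
    rw [sub_pos, div_lt_one (by linarith)]
    linarith
  choose c hc0 hc using fun j : setP m z0 => exists_mul_exp_le_mittag (hm j)
  -- Only the factor `i` contributes a power of `σ`, of exponent `1 - 1 / m i`; it is positive since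
  -- indices of `P` have `m i ≠ 1`.
  set γ : setP m z0 → ℝ := Pi.single i (1 - 1 / (m i : ℝ)) with hγdef
  have hγsum : ∑ j, γ j = 1 - 1 / (m i : ℝ) := Finset.sum_pi_single' i _ _ |>.trans (by simp)
  have hγ0 : ∀ j, 0 ≤ γ j := fun j => by
    by_cases h : j = i
    · subst h
      simp only [hγdef, Pi.single_eq_same]
      exact hγ.le
    · simp [hγdef, h]
  set e := exponent m z0
  set A : ℝ := (∏ j ∈ setP m z0, (m j : ℝ)) / ((n - 1).factorial : ℝ) with hA
  have hApos : 0 < A := div_pos (Finset.prod_pos fun j _ => by have := hm j; positivity)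
    (by positivity)
  set B : (setP m z0 → ℝ) → ℝ := fun t =>
    A * ((∏ j, Function.update c i (m i * (t i ^ 2) ^ (m i - 1)) j) *
      Gamma (e + (1 - 1 / (m i : ℝ))))
  have hBcont : Continuous B := by
    have h : ∀ j, Continuous fun t : setP m z0 → ℝ =>
        Function.update c i (m i * (t i ^ 2) ^ (m i - 1)) j := by
      intro j
      by_cases h : j = i
      · subst h
        simp only [Function.update_self]
        fun_prop
      · simp only [Function.update_of_ne h]
        exact continuous_const
    exact continuous_const.mul ((continuous_finsetProd _ fun j _ => h j).mul continuous_const)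
  have hBpos : 0 < B t0 := by
    refine mul_pos hApos (mul_pos (Finset.prod_pos fun j _ => ?_)
      (Gamma_pos_of_pos (add_pos (exponent_pos hn hm) hγ)))
    by_cases h : j = i
    · subst h
      rw [Function.update_self]
      positivity
    · rw [Function.update_of_ne h]
      exact hc0 j
  have hDlim : Tendsto (fun t : setP m z0 → ℝ => 1 - ∑ j, t j ^ (2 * m j))
      (𝓝[simplex m z0] t0) (𝓝[>] 0) := by
    refine tendsto_nhdsWithin_iff.2 ⟨?_, ?_⟩
    · have : Tendsto (fun t : setP m z0 → ℝ => 1 - ∑ j, t j ^ (2 * m j)) (𝓝 t0)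
          (𝓝 (1 - ∑ j, t0 j ^ (2 * m j))) := (continuous_const.sub hcont).tendsto t0
      rw [hsum, sub_self] at this
      exact this.mono_left nhdsWithin_le_nhds
    · filter_upwards [self_mem_nhdsWithin] with t ht using sub_pos.2 ht.2
  have hlim := Filter.Tendsto.pos_mul_atTop hBpos
    ((hBcont.tendsto t0).mono_left nhdsWithin_le_nhds)
    ((tendsto_rpow_neg_nhdsGT_zero (neg_lt_zero.2 hγ)).comp hDlim)
  refine tendsto_atTop_mono' _ ?_ hlim
  have hti : ∀ᶠ t in 𝓝[simplex m z0] t0, 0 < t i :=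
    (((continuous_apply i).tendsto t0).mono_left nhdsWithin_le_nhds).eventually (lt_mem_nhds hi)
  filter_upwards [self_mem_nhdsWithin, hti] with t ht hti
  have hD : 0 < 1 - ∑ j, t j ^ (2 * m j) := sub_pos.2 ht.2
  have h := le_angularIntegral hn hm ht
    (c := Function.update c i (m i * (t i ^ 2) ^ (m i - 1))) (γ := γ) (fun j => ?_) hγ0 ?_
  · rw [hγsum] at h
    rw [simplexFun, ← hA]
    have h2 := mul_le_mul_of_nonneg_left h (rpow_pos_of_pos hD e).le
    refine le_trans (le_of_eq ?_) (mul_le_mul_of_nonneg_left h2 hApos.le)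
    simp only [B, Function.comp_apply]
    rw [neg_add, rpow_add hD, rpow_neg hD.le e]
    have := mul_inv_cancel₀ (rpow_pos_of_pos hD e).ne'
    linear_combination (-(A * (∏ j, Function.update c i (m i * (t i ^ 2) ^ (m i - 1)) j) *
      Gamma (e + (1 - 1 / (m i : ℝ))) *
      (1 - ∑ j, t j ^ (2 * m j)) ^ (-(1 - 1 / (m i : ℝ))))) * this
  · by_cases h : j = i
    · subst h
      rw [Function.update_self]
      positivity
    · rw [Function.update_of_ne h]
      exact (hc0 j).le
  · intro j σ hσ
    by_cases h : j = i
    · subst h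
      simp only [hγdef, Pi.single_eq_same, Function.update_self]
      refine le_trans (le_of_eq ?_) (mittagMain_le_mittag (hm j) (by positivity))
      rw [mittagMain_mul_rpow (hm j) hσ, ← pow_mul (t j) 2 (m j)]
    · simp only [hγdef, Pi.single_eq_of_ne h, Function.update_of_ne h]
      exact exp_le_mittag_factor (hm j) (hc j) hσ

end SimplexFunction

end ComplexEllipsoid

namespace ComplexEllipsoid

/-! ### Splitting the kernel into a singular and an analytic part -/

section Decomposition

open Real Set

variable {n : ℕ} {m : Fin n → ℕ} {z0 : Fin n → ℂ}

/-- A crude bound by the growth of both parts, valid also at `x0 = 0`: inside the ellipsoid it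
suffices to know that the mixed integrals converge. -/
theorem uniformlyAnalyticAt_mittagRem_of_lt {k : ℕ} (hk : 1 ≤ k) {b x0 : ℝ} (h : |x0| ^ k < b) :
    UniformlyAnalyticAt ℝ (fun (x : ℝ) (τ : Ioi (0 : ℝ)) =>
      mittagRem k (x * (τ : ℝ) ^ (1 / (k : ℝ))) * exp (-(b * τ))) x0 := by
  refine ((uniformlyAnalyticAt_mittag hk h).add ((UniformlyAnalyticAt.of_analyticAt
    (analyticAt_const (v := (-1 : ℝ)))).mul (uniformlyAnalyticAt_mittagMain hk h))).congr
    (Eventually.of_forall fun x τ => ?_)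
  rw [mittagRem]
  ring

/-- The part of a Mittag-Leffler factor which contributes to the singular term. -/
noncomputable def mainFactor (m : Fin n → ℕ) (z0 : Fin n → ℂ) (j : Fin n) (u : ℝ) : ℝ :=
  if j ∈ setP m z0 then mittag (m j) u else mittagMain (m j) u

/-- The part of a Mittag-Leffler factor which contributes to the analytic remainder. -/
noncomputable def remFactor (m : Fin n → ℕ) (z0 : Fin n → ℂ) (j : Fin n) (u : ℝ) : ℝ :=
  if j ∈ setP m z0 then 0 else mittagRem (m j) u

theorem mainFactor_add_remFactor (j : Fin n) (u : ℝ) :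
    mainFactor m z0 j u + remFactor m z0 j u = mittag (m j) u := by
  by_cases h : j ∈ setP m z0 <;> simp [mainFactor, remFactor, mittagRem, h]

theorem uniformlyAnalyticAt_mainFactor (hm : ∀ j, 1 ≤ m j) (j : Fin n) {b x0 : ℝ}
    (h : |x0| ^ m j < b) :
    UniformlyAnalyticAt ℝ (fun (x : ℝ) (τ : Ioi (0 : ℝ)) =>
      mainFactor m z0 j (x * (τ : ℝ) ^ (1 / (m j : ℝ))) * exp (-(b * τ))) x0 := by
  by_cases hj : j ∈ setP m z0
  · simpa only [mainFactor, if_pos hj] using uniformlyAnalyticAt_mittag (hm j) h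
  · simpa only [mainFactor, if_neg hj] using uniformlyAnalyticAt_mittagMain (hm j) h

theorem uniformlyAnalyticAt_remFactor (hm : ∀ j, 1 ≤ m j) (j : Fin n) {b x0 : ℝ}
    (h : |x0| ^ m j < b) :
    UniformlyAnalyticAt ℝ (fun (x : ℝ) (τ : Ioi (0 : ℝ)) =>
      remFactor m z0 j (x * (τ : ℝ) ^ (1 / (m j : ℝ))) * exp (-(b * τ))) x0 := by
  by_cases hj : j ∈ setP m z0
  · simp only [remFactor, if_pos hj, zero_mul]
    exact UniformlyAnalyticAt.of_analyticAt analyticAt_const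
  · simpa only [remFactor, if_neg hj] using uniformlyAnalyticAt_mittagRem_of_lt (hm j) h

/-- The main factor for the indices in `s`, and the remainder for the others. -/
noncomputable def mixedFactor (m : Fin n → ℕ) (z0 : Fin n → ℂ) (s : Finset (Fin n)) (j : Fin n)
    (u : ℝ) : ℝ :=
  if j ∈ s then mainFactor m z0 j u else remFactor m z0 j u

/-- The Laplace integral of a product of main and remainder factors. -/
noncomputable def mixedKernel (m : Fin n → ℕ) (z0 : Fin n → ℂ) (s : Finset (Fin n))
    (x : Fin n → ℝ) : ℝ :=
  ∫ τ in Ioi 0, (∏ j, mixedFactor m z0 s j (x j * τ ^ (1 / (m j : ℝ)))) *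
    (exp (-τ) * τ ^ (∑ j, 1 / (m j : ℝ) - 1))

theorem prod_mittag_eq_sum (u : Fin n → ℝ) :
    ∏ j, mittag (m j) (u j) = ∑ s : Finset (Fin n), ∏ j, mixedFactor m z0 s j (u j) := by
  simp only [← mainFactor_add_remFactor (m := m) (z0 := z0)]
  rw [Finset.prod_add, Finset.powerset_univ]
  refine Finset.sum_congr rfl fun s _ => ?_
  have := Finset.prod_piecewise Finset.univ s (fun j => mainFactor m z0 j (u j))
    (fun j => remFactor m z0 j (u j))
  rw [Finset.univ_inter] at this
  rw [← this]
  rfl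

theorem laplaceKernel_eq_sum (hn : 1 ≤ n) (hm : ∀ j, 1 ≤ m j) {x : Fin n → ℝ}
    (hx : ∑ j, |x j| ^ m j < 1) :
    laplaceKernel m x = ∑ s : Finset (Fin n), mixedKernel m z0 s x := by
  simp only [laplaceKernel, mixedKernel]
  obtain ⟨b, hb, hb1⟩ := exists_lt_sum_lt _ hx
  rw [← integral_finsetSum]
  · refine integral_congr_ae (Eventually.of_forall fun τ => ?_)
    simp only [prod_mittag_eq_sum (m := m) (z0 := z0), Finset.sum_mul]
  · intro s _
    refine (analyticAt_integral_prod Finset.univ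
      (G := fun j (x : Fin n → ℝ) τ => mixedFactor m z0 s j (x j * τ ^ (1 / (m j : ℝ))))
      (sum_inv_pos hn hm) hb1 fun j _ => ?_).2
    have hpr : AnalyticAt ℝ (fun x : Fin n → ℝ => x j) x :=
      (ContinuousLinearMap.proj (R := ℝ) (φ := fun _ : Fin n => ℝ) j).analyticAt x
    by_cases hj : j ∈ s
    · simp only [mixedFactor, if_pos hj]
      exact (uniformlyAnalyticAt_mainFactor hm j (hb j)).comp_analyticAt
        (φ := fun x : Fin n → ℝ => x j) hpr
    · simp only [mixedFactor, if_neg hj]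
      exact (uniformlyAnalyticAt_remFactor hm j (hb j)).comp_analyticAt
        (φ := fun x : Fin n → ℝ => x j) hpr

/-- At a boundary point, all the mixed kernels but the main one are analytic. -/
theorem analyticAt_mixedKernel (hn : 1 ≤ n) (hm : ∀ j, 1 ≤ m j) (hz0 : psi m z0 = 1)
    {s : Finset (Fin n)} (hs : s ≠ Finset.univ) :
    AnalyticAt ℝ (fun z : Fin n → ℂ => mixedKernel m z0 s fun j => ‖z j‖ ^ 2) z0 := by
  -- For such an index the remainder factor is identically zero, and so is the kernel. Otherwise
  -- every index outside `s` has a nonzero coordinate at `z0`.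
  by_cases hcase : ∃ i, i ∉ s ∧ (i ∈ setP m z0 ∨ m i = 1)
  · obtain ⟨i, his, hi⟩ := hcase
    refine (analyticAt_const (v := (0 : ℝ))).congr (Eventually.of_forall fun z => ?_)
    have h0 : ∀ τ ∈ Ioi (0 : ℝ), (∏ j, mixedFactor m z0 s j (‖z j‖ ^ 2 * τ ^ (1 / (m j : ℝ)))) *
        (exp (-τ) * τ ^ (∑ j, 1 / (m j : ℝ) - 1)) = 0 := by
      intro τ hτ
      have hτ : 0 < τ := hτ
      rw [Finset.prod_eq_zero (Finset.mem_univ i), zero_mul]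
      rw [mixedFactor, if_neg his, remFactor]
      by_cases hP : i ∈ setP m z0
      · rw [if_pos hP]
      · rw [if_neg hP, hi.resolve_left hP, mittagRem_one (by positivity)]
    exact (setIntegral_eq_zero_of_forall_eq_zero h0).symm
  · push Not at hcase
    have hne : ∀ i, i ∉ s → z0 i ≠ 0 := fun i hi h0 =>
      (hcase i hi).1 (Finset.mem_filter.2 ⟨Finset.mem_univ _, h0, (hcase i hi).2⟩)
    obtain ⟨i, hi⟩ : ∃ i, i ∉ s := by
      by_contra! h
      exact hs (Finset.eq_univ_iff_forall.2 h)
    -- Remainder factors cost no exponential rate, so the rate at `z0` falls strictly below `psi m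
    -- z0 = 1`.
    have hlt : ∑ j, (if j ∈ s then ‖z0 j‖ ^ (2 * m j) else 0) < 1 := by
      rw [← hz0, psi]
      refine Finset.sum_lt_sum (fun j _ => ?_) ⟨i, Finset.mem_univ _, ?_⟩
      · split_ifs
        · exact le_rfl
        · positivity
      · rw [if_neg hi]
        have := norm_pos_iff.2 (hne i hi)
        positivity
    obtain ⟨b, hb, hb1⟩ := exists_lt_sum_lt _ hlt
    refine (analyticAt_integral_prod Finset.univ
      (G := fun j (z : Fin n → ℂ) τ => mixedFactor m z0 s j (‖z j‖ ^ 2 * τ ^ (1 / (m j : ℝ))))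
      (sum_inv_pos hn hm) hb1 fun j _ => ?_).1
    have hpr := analyticAt_norm_coord_sq j z0
    have hbj := hb j
    by_cases hj : j ∈ s
    · rw [if_pos hj] at hbj
      simp only [mixedFactor, if_pos hj]
      refine (uniformlyAnalyticAt_mainFactor (x0 := ‖z0 j‖ ^ 2) hm j ?_).comp_analyticAt
        (φ := fun z : Fin n → ℂ => ‖z j‖ ^ 2) hpr
      rwa [abs_of_nonneg (sq_nonneg _), ← pow_mul]
    · rw [if_neg hj] at hbj
      simp only [mixedFactor, if_neg hj, remFactor, if_neg (hcase j hj).1]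
      have := norm_pos_iff.2 (hne j hj)
      exact (uniformlyAnalyticAt_mittagRem (x0 := ‖z0 j‖ ^ 2) (hm j) hbj
        (by positivity)).comp_analyticAt (φ := fun z : Fin n → ℂ => ‖z j‖ ^ 2) hpr

theorem sum_setQ_add_sum_setP (z : Fin n → ℂ) :
    (∑ j ∈ setQ m z0, ‖z j‖ ^ (2 * m j)) + ∑ j ∈ setP m z0, ‖z j‖ ^ (2 * m j) = psi m z := by
  rw [setQ_eq_compl, Finset.sum_compl_add_sum, psi]

theorem transverse_pos {z : Fin n → ℂ} (hz : z ∈ domain m) :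
    0 < 1 - ∑ i ∈ setQ m z0, ‖z i‖ ^ (2 * m i) := by
  have h1 := sum_setQ_add_sum_setP (m := m) (z0 := z0) z
  have h2 : 0 ≤ ∑ j ∈ setP m z0, ‖z j‖ ^ (2 * m j) :=
    Finset.sum_nonneg fun j _ => by positivity
  have h3 : psi m z < 1 := hz
  linarith

theorem angular_pow (hm : ∀ j, 1 ≤ m j) {z : Fin n → ℂ} (hz : z ∈ domain m) (j : setP m z0) :
    angular m z0 z j ^ (2 * m j)
      = ‖z j‖ ^ (2 * m j) / (1 - ∑ i ∈ setQ m z0, ‖z i‖ ^ (2 * m i)) := by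
  have h := rpow_inv_pow (m := 2 * m j) (by have := hm j; omega)
    (div_nonneg (by positivity) (transverse_pos (z0 := z0) hz).le : 0 ≤ ‖z j‖ ^ (2 * m j) /
      (1 - ∑ i ∈ setQ m z0, ‖z i‖ ^ (2 * m i)))
  rw [← h, angular]
  push_cast
  rfl

theorem angular_sq (hm : ∀ j, 1 ≤ m j) {z : Fin n → ℂ} (hz : z ∈ domain m) (j : setP m z0) :
    angular m z0 z j ^ 2
      = ‖z j‖ ^ 2 / (1 - ∑ i ∈ setQ m z0, ‖z i‖ ^ (2 * m i)) ^ (1 / (m j : ℝ)) := by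
  have hA := transverse_pos (z0 := z0) hz
  have hmj : m j ≠ 0 := by have := hm j; omega
  have h0 : 0 ≤ angular m z0 z j := rpow_nonneg (div_nonneg (by positivity) hA.le) _
  refine (pow_left_inj₀ (by positivity) (by positivity) hmj).1 ?_
  rw [← pow_mul, angular_pow hm hz, div_pow, rpow_inv_pow (hm j) hA.le, ← pow_mul]

theorem radial_eq (hm : ∀ j, 1 ≤ m j) {z : Fin n → ℂ} (hz : z ∈ domain m) :
    radial m z = (1 - ∑ i ∈ setQ m z0, ‖z i‖ ^ (2 * m i)) *
      (1 - ∑ j, angular m z0 z j ^ (2 * m j)) := by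
  have hA := transverse_pos (z0 := z0) hz
  simp only [angular_pow hm hz, ← Finset.sum_div]
  rw [Finset.sum_coe_sort (setP m z0) fun j => ‖z j‖ ^ (2 * m j), mul_sub, mul_one,
    mul_div_cancel₀ _ hA.ne', radial, ← sum_setQ_add_sum_setP (z0 := z0)]
  ring

/-- Each main part with `j ∈ Q` brings `τ ^ (1 - 1 / m_j)`; these powers lift the original exponent
to that of the singularity. -/
theorem exponent_eq : exponent m z0
    = ∑ j, 1 / (m j : ℝ) + ∑ j ∈ setQ m z0, (1 - 1 / (m j : ℝ)) := by
  rw [exponent, Finset.sum_sub_distrib, Finset.sum_const, nsmul_eq_mul, mul_one, setQ_eq_compl,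
    ← Finset.sum_compl_add_sum (setP m z0)]
  ring

/-- Substitute `σ = A τ`, with `A` the transverse quantity `1 - ∑_Q |z_i|^(2 m_i)`. The main parts
change `exp (-τ)` into `exp (-(A * τ))`, and `angular_sq` matches the arguments: `|z_j|² τ^(1/m_j) =
t_j² σ^(1/m_j)` for `j ∈ P`. -/
theorem mixedKernel_univ (hm : ∀ j, 1 ≤ m j) {z : Fin n → ℂ} (hz : z ∈ domain m) :
    mixedKernel m z0 Finset.univ (fun j => ‖z j‖ ^ 2)
      = (∏ j ∈ setQ m z0, (m j : ℝ) * (‖z j‖ ^ 2) ^ (m j - 1)) *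
        ((1 - ∑ i ∈ setQ m z0, ‖z i‖ ^ (2 * m i)) ^ (-exponent m z0) *
          angularIntegral m z0 (angular m z0 z)) := by
  have hA := transverse_pos (z0 := z0) hz
  set A := 1 - ∑ i ∈ setQ m z0, ‖z i‖ ^ (2 * m i) with hAdef
  set e := exponent m z0 with he
  set g : ℝ → ℝ := fun σ =>
    (∏ j : setP m z0, mittag (m j) (angular m z0 z j ^ 2 * σ ^ (1 / (m j : ℝ)))) *
      (exp (-σ) * σ ^ (e - 1))
  have hg := integral_comp_mul_left_Ioi g 0 hA
  rw [mul_zero, smul_eq_mul] at hg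
  have hint : angularIntegral m z0 (angular m z0 z) = ∫ σ in Ioi 0, g σ := rfl
  have hAe : A ^ (-e) = A ^ (1 - e) * A⁻¹ := by
    rw [← rpow_neg_one, ← rpow_add hA]
    congr 1
    ring
  rw [hint, hAe, mul_assoc, ← hg, ← integral_const_mul, ← integral_const_mul, mixedKernel]
  refine setIntegral_congr_fun measurableSet_Ioi fun τ hτ => ?_
  have hτ : 0 < τ := hτ
  simp only [mixedFactor, Finset.mem_univ, if_true]
  have e1 : ∏ j, mainFactor m z0 j (‖z j‖ ^ 2 * τ ^ (1 / (m j : ℝ)))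
      = (∏ j ∈ setQ m z0, (m j : ℝ) * (‖z j‖ ^ 2) ^ (m j - 1)) *
        (τ ^ (∑ j ∈ setQ m z0, (1 - 1 / (m j : ℝ))) *
          exp ((∑ j ∈ setQ m z0, ‖z j‖ ^ (2 * m j)) * τ)) *
        ∏ j ∈ setP m z0, mittag (m j) (‖z j‖ ^ 2 * τ ^ (1 / (m j : ℝ))) := by
    rw [← Finset.prod_compl_mul_prod (setP m z0), ← setQ_eq_compl, rpow_sum_of_pos hτ,
      Finset.sum_mul, exp_sum, ← Finset.prod_mul_distrib, ← Finset.prod_mul_distrib]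
    congr 1
    · refine Finset.prod_congr rfl fun j hj => ?_
      rw [mainFactor, if_neg (mem_setQ_iff.1 hj), mittagMain_mul_rpow (hm j) hτ,
        ← pow_mul _ 2 (m j)]
      ring
    · exact Finset.prod_congr rfl fun j hj => by rw [mainFactor, if_pos hj]
  have e2 : ∏ j : setP m z0, mittag (m j) (angular m z0 z j ^ 2 * (A * τ) ^ (1 / (m j : ℝ)))
      = ∏ j ∈ setP m z0, mittag (m j) (‖z j‖ ^ 2 * τ ^ (1 / (m j : ℝ))) := by
    rw [← Finset.prod_coe_sort (setP m z0)]
    refine Finset.prod_congr rfl fun j _ => ?_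
    rw [angular_sq hm hz, mul_rpow hA.le hτ.le, ← hAdef, ← mul_assoc,
      div_mul_cancel₀ _ (rpow_pos_of_pos hA _).ne']
  have e3 : τ ^ (e - 1)
      = τ ^ (∑ j ∈ setQ m z0, (1 - 1 / (m j : ℝ))) * τ ^ (∑ j, 1 / (m j : ℝ) - 1) := by
    rw [← rpow_add hτ, he, exponent_eq]
    congr 1
    ring
  have e4 : exp (-(A * τ)) = exp ((∑ j ∈ setQ m z0, ‖z j‖ ^ (2 * m j)) * τ) * exp (-τ) := by
    rw [← exp_add, hAdef]
    congr 1
    ring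
  have e5 : A ^ (1 - e) * A ^ (e - 1) = 1 := by
    rw [← rpow_add hA, sub_add_sub_cancel, sub_self, rpow_zero]
  simp only [g]
  rw [e1, e2, e4, mul_rpow hA.le hτ.le, e3]
  linear_combination (-((∏ j ∈ setQ m z0, (m j : ℝ) * (‖z j‖ ^ 2) ^ (m j - 1)) *
    (τ ^ (∑ j ∈ setQ m z0, (1 - 1 / (m j : ℝ))) *
      exp ((∑ j ∈ setQ m z0, ‖z j‖ ^ (2 * m j)) * τ)) *
    (∏ j ∈ setP m z0, mittag (m j) (‖z j‖ ^ 2 * τ ^ (1 / (m j : ℝ)))) *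
    (exp (-τ) * τ ^ (∑ j, 1 / (m j : ℝ) - 1)))) * e5

/-- By `radial_eq`, `r` is `A` times `1 - ∑ t_j ^ (2 m_j)`. The power built into `simplexFun`
cancels the second factor of `r ^ exponent`, leaving the power of `A` in `mixedKernel_univ`. -/
theorem singularTerm_eq (hm : ∀ j, 1 ≤ m j) {z : Fin n → ℂ} (hz : z ∈ domain m) :
    singularTerm m z0 (simplexFun m z0) z = (∏ j, (m j : ℝ)) / (2 * π ^ n) *
      mixedKernel m z0 Finset.univ (fun j => ‖z j‖ ^ 2) := by
  have hA := transverse_pos (z0 := z0) hz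
  have hr := radial_eq (z0 := z0) hm hz
  have hr0 : 0 < radial m z := sub_pos.2 hz
  have hD : 0 < 1 - ∑ j, angular m z0 z j ^ (2 * m j) := by
    rw [hr] at hr0
    exact pos_of_mul_pos_right hr0 hA.le
  rw [mixedKernel_univ hm hz, singularTerm, simplexFun, hr, mul_rpow hA.le hD.le,
    rpow_neg hA.le, ← Finset.prod_compl_mul_prod (setP m z0) fun j => (m j : ℝ), ← setQ_eq_compl]
  have e1 : ∏ j ∈ setQ m z0, (m j : ℝ) ^ 2 * ‖z j‖ ^ (2 * m j - 2)
      = (∏ j ∈ setQ m z0, (m j : ℝ)) *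
        ∏ j ∈ setQ m z0, (m j : ℝ) * (‖z j‖ ^ 2) ^ (m j - 1) := by
    rw [← Finset.prod_mul_distrib]
    refine Finset.prod_congr rfl fun j _ => ?_
    rw [← pow_mul, Nat.mul_sub]
    ring
  rw [e1]
  have h1 := (rpow_pos_of_pos hA (exponent m z0)).ne'
  have h2 := (rpow_pos_of_pos hD (exponent m z0)).ne'
  generalize (1 - ∑ i ∈ setQ m z0, ‖z i‖ ^ (2 * m i)) ^ exponent m z0 = a at *
  generalize (1 - ∑ j, angular m z0 z j ^ (2 * m j)) ^ exponent m z0 = d at *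
  have h3 : ((n - 1).factorial : ℝ) ≠ 0 := by positivity
  have h4 := pi_ne_zero
  field_simp

/-- The remainder `h` collects the mixed kernels with at least one remainder factor. The identity
holds throughout the ellipsoid; only the analyticity of `h` is local. -/
theorem exists_analyticAt_szegoFun_eq (hn : 1 ≤ n) (hm : ∀ j, 1 ≤ m j) (hz0 : psi m z0 = 1) :
    ∃ h : (Fin n → ℂ) → ℝ, AnalyticAt ℝ h z0 ∧
      ∀ z ∈ domain m, szegoFun m z = singularTerm m z0 (simplexFun m z0) z + h z := by
  refine ⟨fun z => (∏ j, (m j : ℝ)) / (2 * π ^ n) *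
    ∑ s ∈ Finset.univ.erase (Finset.univ : Finset (Fin n)),
      mixedKernel m z0 s fun j => ‖z j‖ ^ 2, ?_, fun z hz => ?_⟩
  · exact analyticAt_const.mul (Finset.analyticAt_fun_sum _ fun s hs =>
      analyticAt_mixedKernel hn hm hz0 (Finset.ne_of_mem_erase hs))
  · rw [singularTerm_eq hm hz, szegoFun, laplaceKernel_eq_sum (z0 := z0) hn hm
      (by rw [sum_abs_norm_sq]; exact hz), ← mul_add,
      Finset.add_sum_erase _ (fun s => mixedKernel m z0 s fun j => ‖z j‖ ^ 2) (Finset.mem_univ _)]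

end Decomposition

end ComplexEllipsoid

theorem theorem2 {n : ℕ} (hn : 1 ≤ n) (m : Fin n → ℕ) (hm : ∀ j, 1 ≤ m j) :
    ∃ K : (Fin n → ℂ) → ℝ, ComplexEllipsoid.IsSzegoKernel m K ∧
      ∀ z0 ∈ frontier (ComplexEllipsoid.domain m),
        ∃ Φ : (ComplexEllipsoid.setP m z0 → ℝ) → ℝ,
          AnalyticOnNhd ℝ Φ (ComplexEllipsoid.simplex m z0) ∧
          (∃ h : (Fin n → ℂ) → ℝ, AnalyticAt ℝ h z0 ∧
            ∀ᶠ z in 𝓝[ComplexEllipsoid.domain m] z0,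
              K z = ComplexEllipsoid.singularTerm m z0 Φ z + h z) ∧
          (ComplexEllipsoid.setP m z0 = ∅ →
            ∀ t ∈ ComplexEllipsoid.simplex m z0, Φ t = 1) ∧
          ((ComplexEllipsoid.setP m z0).Nonempty →
            (∀ t ∈ ComplexEllipsoid.simplex m z0, 0 < Φ t) ∧
            ∀ t0 ∈ closure (ComplexEllipsoid.simplex m z0) \ ComplexEllipsoid.simplex m z0,
              Tendsto Φ (𝓝[ComplexEllipsoid.simplex m z0] t0) atTop) := by
  refine ⟨ComplexEllipsoid.szegoFun m, ComplexEllipsoid.isSzegoKernel_szegoFun hn hm,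
    fun z0 hz0 => ⟨ComplexEllipsoid.simplexFun m z0,
      ComplexEllipsoid.analyticOnNhd_simplexFun hn hm, ?_,
      fun hP t _ => ComplexEllipsoid.simplexFun_eq_one hn hP t,
      fun _ => ⟨fun t ht => ComplexEllipsoid.simplexFun_pos hn hm ht,
        fun t0 ht0 => ComplexEllipsoid.tendsto_simplexFun hn hm ht0⟩⟩⟩
  obtain ⟨h, hh, he⟩ := ComplexEllipsoid.exists_analyticAt_szegoFun_eq hn hm
    (ComplexEllipsoid.psi_eq_one_of_mem_frontier hz0)
  exact ⟨h, hh, eventually_mem_nhdsWithin.mono he⟩
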